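/- **Notation.** For $z\in\mathbb C$ let $\sqrt z=|z|^{1/2}e^{i\arg z/2}$ with $\arg z\in[0,2\pi)$. For $\kappa\in\mathbb R$ put $\nu_\kappa(\lambda)=\sqrt{-\lambda^2-2\kappa^2}$, $S_\kappa=\{\lambda\in\mathbb C:\Re\lambda=0,\ |\Im\lambda|\ge\sqrt2\,|\kappa|\}$ and $D_\kappa^+=\{\lambda\in\mathbb C:\Re(\kappa^2+\lambda^2)^2<0,\ \Im\lambda>0\}$; the boundary $\partial D_\kappa^+$ is oriented so that $D_\kappa^+$ lies to its left. Let $$\widehat{u_0}(\kappa,\lambda)=\int_{-\infty}^\infty\int_0^\infty e^{-ix\kappa-iy\lambda}u_0(x,y)\,dy\,dx\quad(\Im\lambda\le0),$$ $$\widetilde{g_j}(\kappa,\eta,t)=\int_0^te^{\eta\tau}\int_{-\infty}^\infty e^{-ix\kappa}g_j(x,\tau)\,dx\,d\tau,\qquad E(\kappa,\lambda;x,y,t)=e^{-(\kappa^2+\lambda^2)^2t+i\kappa x+i\lambda y}.$$ **(a)** For every $\kappa\in\mathbb R$, $\nu_\kappa$ is analytic on $\mathbb C\setminus S_\kappa$.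 If $\kappa\ne0$, then $S_\kappa$ has positive distance from $\overline{D_\kappa^+}$, so $\nu_\kappa$ is analytic in a neighbourhood of every point of $\overline{D_\kappa^+}$; for $\kappa=0$ the same holds at every point of $\overline{D_0^+}\setminus\{0\}$. **(b)** Let $m>3$ and let $u:\mathbb R\times[0,\infty)\times[0,T]\to\mathbb C$ be such that $u(\cdot,\cdot,t)$ is $C^4$ on $\mathbb R\times[0,\infty)$ for every $t\in[0,T]$, and that for all $i+j\le4$ the derivative $\partial_x^i\partial_y^ju$ is continuous on $\mathbb R\times[0,\infty)\times[0,T]$ and bounded there by $C(1+|x|+|y|)^{-m}$ for some constant $C$. Suppose that $$u_t+\Delta^2u=0\quad\text{on }\mathbb R\times(0,\infty)\times(0,T),\qquad \Delta^2=\partial_x^4+2\partial_x^2\partial_y^2+\partial_y^4,$$ that $u(x,0,t)=g_0(x,t)$ and $u_y(x,0,t)=g_1(x,t)$ for $x\in\mathbb R$, $0<t<T$, and that $u(x,y,0)=u_0(x,y)$ for $x\in\mathbb R$, $y>0$. Then for all $x\in\mathbb R$, $y>0$, $0<t<T$, $$u(x,y,t)=\frac1{(2\pi)^2}\int_{-\infty}^\infty\int_{-\infty}^\infty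 E(\kappa,\lambda;x,y,t)\,\widehat{u_0}(\kappa,\lambda)\,d\lambda\,d\kappa+\frac1{(2\pi)^2}\int_{-\infty}^\infty\int_{\partial D_\kappa^+}E(\kappa,\lambda;x,y,t)\,G(\kappa,\lambda;t)\,d\lambda\,d\kappa,$$ where both double integrals converge absolutely and $$G(\kappa,\lambda;t)=-\frac{\nu_\kappa(\lambda)+\lambda}{\nu_\kappa(\lambda)-\lambda}\,\widehat{u_0}(\kappa,-\lambda)+\frac{2\lambda}{\nu_\kappa(\lambda)-\lambda}\,\widehat{u_0}(\kappa,-\nu_\kappa(\lambda))-2\lambda[\lambda+\nu_\kappa(\lambda)]\,\widetilde{g_1}(\kappa,(\kappa^2+\lambda^2)^2,t)+2i\lambda\nu_\kappa(\lambda)[\nu_\kappa(\lambda)+\lambda]\,\widetilde{g_0}(\kappa,(\kappa^2+\lambda^2)^2,t).$$ -/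

import Mathlib

open MeasureTheory Set

noncomputable section

namespace HalfSpaceHeat

/-! ### Partial derivatives and the initial boundary value problem -/

/-- Partial derivative in `x`. -/
def dx (v : ℝ → ℝ → ℝ → ℂ) : ℝ → ℝ → ℝ → ℂ :=
  fun x y t => deriv (fun s => v s y t) x

/-- Partial derivative in `y` on the closed half line `y ≥ 0` (one-sided at `y = 0`). -/
def dy (v : ℝ → ℝ → ℝ → ℂ) : ℝ → ℝ → ℝ → ℂ :=
  fun x y t => derivWithin (fun s => v x s t) (Ici 0) y

/-- `Δ² u = ∂ₓ⁴ u + 2 ∂ₓ² ∂_y² u + ∂_y⁴ u`. -/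
def bilaplacian (u : ℝ → ℝ → ℝ → ℂ) (x y t : ℝ) : ℂ :=
  dx^[4] u x y t + 2 * dx^[2] (dy^[2] u) x y t + dy^[4] u x y t

/-- Smoothness up to the boundary of `ℝ × (0,∞) × (0,T)` and decay as `|(x,y)| → ∞`: for every
time `u` is `C⁴` in `(x,y)` on the closed half plane, all spatial derivatives of order at most
four are continuous on `ℝ × [0,∞) × [0,T]`, and they are `O((1 + |x| + |y|)^(-m))` uniformly
in time. -/
structure SmoothDecaying (T m : ℝ) (u : ℝ → ℝ → ℝ → ℂ) : Prop where
  contDiffOn : ∀ t ∈ Icc 0 T,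
    ContDiffOn ℝ 4 (fun q : ℝ × ℝ => u q.1 q.2 t) (univ ×ˢ Ici 0)
  continuousOn : ∀ i j : ℕ, i + j ≤ 4 →
    ContinuousOn (fun p : ℝ × ℝ × ℝ => dx^[i] (dy^[j] u) p.1 p.2.1 p.2.2)
      (univ ×ˢ Ici 0 ×ˢ Icc 0 T)
  decay : ∃ C : ℝ, ∀ i j : ℕ, i + j ≤ 4 → ∀ x : ℝ, ∀ y ∈ Ici (0 : ℝ), ∀ t ∈ Icc 0 T,
    ‖dx^[i] (dy^[j] u) x y t‖ ≤ C * (1 + |x| + |y|) ^ (-m)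

/-- `u_t + Δ² u = 0` on `ℝ × (0,∞) × (0,T)` with Dirichlet datum `g₀`, Neumann datum `g₁` and
initial datum `u₀`. -/
structure SolvesIBVP (T : ℝ) (u : ℝ → ℝ → ℝ → ℂ) (u₀ g₀ g₁ : ℝ → ℝ → ℂ) : Prop where
  pde : ∀ x : ℝ, ∀ y ∈ Ioi (0 : ℝ), ∀ t ∈ Ioo 0 T,
    HasDerivAt (fun s => u x y s) (-bilaplacian u x y t) t
  dirichlet : ∀ x : ℝ, ∀ t ∈ Ioo 0 T, u x 0 t = g₀ x t
  neumann : ∀ x : ℝ, ∀ t ∈ Ioo 0 T, dy u x 0 t = g₁ x t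
  initial : ∀ x : ℝ, ∀ y ∈ Ioi (0 : ℝ), u x y 0 = u₀ x y

/-! ### Transforms -/

/-- Half space Fourier transform; meaningful for `Im l ≤ 0`. -/
def halfFourier (f : ℝ → ℝ → ℂ) (κ : ℝ) (l : ℂ) : ℂ :=
  ∫ x : ℝ, ∫ y in Ioi (0 : ℝ), Complex.exp (-Complex.I * x * κ - Complex.I * y * l) * f x y

/-- Fourier transform in the variable `x`. -/
def fourierX (g : ℝ → ℝ → ℂ) (κ t : ℝ) : ℂ :=
  ∫ x : ℝ, Complex.exp (-Complex.I * x * κ) * g x t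

/-- The `t`-transform of a boundary datum. -/
def tTransform (g : ℝ → ℝ → ℂ) (κ : ℝ) (η : ℂ) (t : ℝ) : ℂ :=
  ∫ τ in (0 : ℝ)..t, Complex.exp (η * τ) * fourierX g κ τ

/-! ### The branch of the square root and the invariance map -/

/-- The argument in `[0, 2π)`. -/
def argPos (z : ℂ) : ℝ := if 0 ≤ z.arg then z.arg else z.arg + 2 * Real.pi

/-- The square root with argument of `z` taken in `[0, 2π)`. -/
def sqrtPos (z : ℂ) : ℂ := (Real.sqrt ‖z‖ : ℂ) * Complex.exp (Complex.I * (argPos z / 2 : ℝ))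

/-- `ν_κ(l) = √(-l² - 2κ²)`. -/
def nu (κ : ℝ) (l : ℂ) : ℂ := sqrtPos (-l ^ 2 - 2 * (κ : ℂ) ^ 2)

/-- The branch cut `S_κ` of `ν_κ`. -/
def cut (κ : ℝ) : Set ℂ := {l | l.re = 0 ∧ Real.sqrt 2 * |κ| ≤ |l.im|}

/-! ### The region `D_κ⁺` and integration along its boundary -/

/-- `D_κ`. -/
def D (κ : ℝ) : Set ℂ := {l | (((κ : ℂ) ^ 2 + l ^ 2) ^ 2).re < 0}

/-- `D_κ⁺`, the part of `D_κ` in the open upper half plane. -/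
def Dplus (κ : ℝ) : Set ℂ := D κ ∩ {l | 0 < l.im}

/-- The four arcs of `∂D_κ⁺`, each starting at `i|κ|` for `a = 0` and going to infinity:
right (`σ = 1`) or left (`σ = -1`), upper (`τ = 1`) or lower (`τ = -1`). -/
def arc (κ σ τ a : ℝ) : ℂ := ⟨σ * a, Real.sqrt (κ ^ 2 + 2 * a ^ 2) + τ * a⟩

/-- Integral along one arc, from `i|κ|` to infinity. -/
def arcIntegral (κ σ τ : ℝ) (F : ℂ → ℂ) : ℂ :=
  ∫ a in Ioi (0 : ℝ), F (arc κ σ τ a) * deriv (arc κ σ τ) a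

/-- Integral over `∂D_κ⁺`, oriented with `D_κ⁺` on the left: the right component is bounded by
its upper arc run inwards and its lower arc run outwards, the left component by its lower arc run
inwards and its upper arc run outwards. -/
def boundaryIntegral (κ : ℝ) (F : ℂ → ℂ) : ℂ :=
  (-arcIntegral κ 1 1 F + arcIntegral κ 1 (-1) F) +
    (-arcIntegral κ (-1) (-1) F + arcIntegral κ (-1) 1 F)

/-- Absolute convergence of `∫_ℝ ∫_{∂D_κ⁺} F(κ, l) dl dκ`. -/
def BoundaryIntegrable (F : ℝ → ℂ → ℂ) : Prop :=
  ∀ σ ∈ ({1, -1} : Set ℝ), ∀ τ ∈ ({1, -1} : Set ℝ),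
    IntegrableOn (fun p : ℝ × ℝ => F p.1 (arc p.1 σ τ p.2) * deriv (arc p.1 σ τ) p.2)
      (univ ×ˢ Ioi 0)

/-! ### The integrands -/

/-- `E(κ, l; x, y, t) = exp(-(κ² + l²)² t + iκx + ily)`. -/
def E (κ : ℝ) (l : ℂ) (x y t : ℝ) : ℂ :=
  Complex.exp (-((κ : ℂ) ^ 2 + l ^ 2) ^ 2 * t + Complex.I * κ * x + Complex.I * l * y)

/-- `G(κ, l; t)`. -/
def G (u₀ g₀ g₁ : ℝ → ℝ → ℂ) (κ : ℝ) (l : ℂ) (t : ℝ) : ℂ :=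
  -((nu κ l + l) / (nu κ l - l)) * halfFourier u₀ κ (-l)
    + 2 * l / (nu κ l - l) * halfFourier u₀ κ (-nu κ l)
    - 2 * l * (l + nu κ l) * tTransform g₁ κ (((κ : ℂ) ^ 2 + l ^ 2) ^ 2) t
    + 2 * Complex.I * l * nu κ l * (nu κ l + l)
        * tTransform g₀ κ (((κ : ℂ) ^ 2 + l ^ 2) ^ 2) t

/-! ### The arcs do trace the boundary of `D_κ⁺` -/

theorem mem_Dplus_iff (κ : ℝ) (l : ℂ) :
    l ∈ Dplus κ ↔ |l.im - Real.sqrt (κ ^ 2 + 2 * l.re ^ 2)| - |l.re| < 0 := by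
  obtain ⟨a, b⟩ := l
  set s := Real.sqrt (κ ^ 2 + 2 * a ^ 2) with hs
  have hs0 : 0 ≤ s := Real.sqrt_nonneg _
  have hs2 : s ^ 2 = κ ^ 2 + 2 * a ^ 2 := Real.sq_sqrt (by positivity)
  have ha2 : |a| ^ 2 = a ^ 2 := sq_abs a
  have ha0 : 0 ≤ |a| := abs_nonneg a
  have has : |a| ≤ s := abs_le_of_sq_le_sq' (by nlinarith [sq_nonneg κ]) hs0 |>.2
  have hre : ((((κ : ℂ) ^ 2 + (⟨a, b⟩ : ℂ) ^ 2) ^ 2).re)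
      = ((b - s) ^ 2 - a ^ 2) * ((b + s) ^ 2 - a ^ 2) := by
    simp only [pow_two, Complex.mul_re, Complex.add_re, Complex.add_im, Complex.mul_im,
      Complex.ofReal_re, Complex.ofReal_im]
    have h4 : κ ^ 2 = s ^ 2 - 2 * a ^ 2 := by linarith
    have h5 : κ * κ = s ^ 2 - 2 * a ^ 2 := by nlinarith
    simp only [mul_zero, sub_zero, zero_mul, add_zero, zero_add, h5]
    ring
  simp only [Dplus, D, mem_inter_iff, mem_ofPred_eq, hre, sub_neg]
  rw [abs_lt]
  have hfac : ∀ c : ℝ, c ^ 2 - a ^ 2 = (c - |a|) * (c + |a|) := by intro c; nlinarith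
  constructor
  · rintro ⟨h, hb⟩
    have h1 : 0 < (b + s) ^ 2 - a ^ 2 := by rw [hfac]; apply mul_pos <;> linarith
    have h2 : (b - s) ^ 2 - a ^ 2 < 0 := by
      by_contra hc
      push Not at hc
      nlinarith [mul_nonneg hc h1.le]
    have h3 : (b - s) ^ 2 < |a| ^ 2 := by linarith
    exact abs_lt_of_sq_lt_sq' h3 ha0
  · rintro ⟨h1, h2⟩
    have hb : 0 < b := by linarith
    refine ⟨?_, hb⟩
    apply mul_neg_of_neg_of_pos
    · rw [hfac]; apply mul_neg_of_neg_of_pos <;> linarith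
    · rw [hfac]; apply mul_pos <;> linarith

theorem frontier_Dplus (κ : ℝ) :
    frontier (Dplus κ) = ⋃ σ ∈ ({1, -1} : Set ℝ), ⋃ τ ∈ ({1, -1} : Set ℝ),
      arc κ σ τ '' Ici 0 := by
  have hset : Dplus κ = {l : ℂ | |l.im - Real.sqrt (κ ^ 2 + 2 * l.re ^ 2)| - |l.re| < 0} := by
    ext l; exact mem_Dplus_iff κ l
  have hcont : Continuous
      (fun l : ℂ => |l.im - Real.sqrt (κ ^ 2 + 2 * l.re ^ 2)| - |l.re|) := by fun_prop
  have hopen : IsOpen (Dplus κ) := by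
    rw [hset]; exact isOpen_lt hcont continuous_const
  ext l
  simp only [mem_iUnion, exists_prop]
  constructor
  · intro h
    rw [hset] at h
    have h0 : |l.im - Real.sqrt (κ ^ 2 + 2 * l.re ^ 2)| - |l.re| = 0 :=
      frontier_lt_subset_eq hcont continuous_const h
    have key : ∃ σ ∈ ({1, -1} : Set ℝ), l.re = σ * |l.re| := by
      rcases le_total 0 l.re with h | h
      · exact ⟨1, by simp, by rw [abs_of_nonneg h]; ring⟩
      · exact ⟨-1, by simp, by rw [abs_of_nonpos h]; ring⟩
    have key2 : ∃ τ ∈ ({1, -1} : Set ℝ),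
        l.im = Real.sqrt (κ ^ 2 + 2 * l.re ^ 2) + τ * |l.re| := by
      rcases le_total 0 (l.im - Real.sqrt (κ ^ 2 + 2 * l.re ^ 2)) with h | h
      · rw [abs_of_nonneg h] at h0; exact ⟨1, by simp, by linarith⟩
      · rw [abs_of_nonpos h] at h0; exact ⟨-1, by simp, by linarith⟩
    obtain ⟨σ, hσ, h1⟩ := key
    obtain ⟨τ, hτ, h2⟩ := key2
    refine ⟨σ, hσ, τ, hτ, |l.re|, mem_Ici.2 (abs_nonneg _), ?_⟩
    apply Complex.ext
    · simp [arc, ← h1]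
    · simp [arc, ← h2]
  · rintro ⟨σ, hσ, τ, hτ, a, ha, rfl⟩
    have ha' : 0 ≤ a := ha
    have hσ1 : |σ| = 1 := by rcases hσ with rfl | rfl <;> simp
    have hτ1 : |τ| = 1 := by rcases hτ with rfl | rfl <;> simp
    have hσ2 : σ ^ 2 = 1 := by rw [← sq_abs, hσ1]; norm_num
    rw [hopen.frontier_eq]
    constructor
    · have hc : Continuous (fun e : ℝ => (⟨σ * (a + e),
          Real.sqrt (κ ^ 2 + 2 * (a + e) ^ 2) + τ * ((1 - e) * (a + e))⟩ : ℂ)) := by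
        have : (fun e : ℝ => (⟨σ * (a + e),
          Real.sqrt (κ ^ 2 + 2 * (a + e) ^ 2) + τ * ((1 - e) * (a + e))⟩ : ℂ))
          = fun e : ℝ => ((σ * (a + e) : ℝ) : ℂ) + ((Real.sqrt (κ ^ 2 + 2 * (a + e) ^ 2)
            + τ * ((1 - e) * (a + e)) : ℝ) : ℂ) * Complex.I := by
          ext e
          exact Complex.mk_eq_add_mul_I _ _
        rw [this]
        fun_prop
      have hlim := (hc.tendsto 0).mono_left (nhdsWithin_le_nhds (s := Ioi (0 : ℝ)))
      have h0 : (⟨σ * (a + 0),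
          Real.sqrt (κ ^ 2 + 2 * (a + 0) ^ 2) + τ * ((1 - 0) * (a + 0))⟩ : ℂ)
          = arc κ σ τ a := by simp [arc]
      rw [h0] at hlim
      refine mem_closure_of_tendsto hlim ?_
      filter_upwards [Ioo_mem_nhdsGT (show (0 : ℝ) < 1 by norm_num)] with e he
      rw [mem_Dplus_iff]
      have hpos : 0 < a + e := by linarith [he.1]
      have : (σ * (a + e)) ^ 2 = (a + e) ^ 2 := by rw [mul_pow, hσ2, one_mul]
      simp only [this, add_sub_cancel_left, abs_mul, hσ1, hτ1, one_mul, abs_of_pos hpos]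
      rw [abs_of_pos (by linarith [he.2] : (0 : ℝ) < 1 - e)]
      nlinarith [he.1]
    · rw [mem_Dplus_iff]
      have : (σ * a) ^ 2 = a ^ 2 := by rw [mul_pow, hσ2, one_mul]
      simp [arc, this, abs_mul, hσ1, hτ1]

end HalfSpaceHeat

end

open HalfSpaceHeat

/-!
The proof is the unified transform (Fokas) method. The half plane Fourier transform turns the
equation into a *global relation*, valid for `Im l ≤ 0`, between `û(·, t)`, `û₀` and the transforms
of all four traces `u, u_y, u_yy, u_yyy` on `y = 0`. The symbol `(κ² + l²)²` is invariant under
`l ↦ -l` and `l ↦ -ν_κ(l)`, and for `Im l ≥ 0` the global relation may be used at both images: these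
two relations eliminate the unknown traces `u_yy` and `u_yyy`, at the price of a remainder that
involves only `u(·, t)`. The remainder is holomorphic and decays in each of the two components of
`D_κ⁺`, so it contributes nothing to the integral along `∂D_κ⁺`; its apparent pole at `l = i|κ|`,
where `ν_κ(l) = l`, is harmless since `l ↦ û(κ, l, t)` is Lipschitz, which is where `m > 3` enters.
Outside `D_κ⁺` the symbol has nonnegative real part, so there the boundary terms are bounded and the
inversion contour can be moved from the real line to `∂D_κ⁺`. Fourier inversion in `y` is only
conditional, because the extension of `u` by zero jumps at `y = 0`; the deformation is therefore
carried out after multiplication by a Gaussian.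
-/

noncomputable section

open Filter Topology

namespace HalfSpaceHeat

/-! ### The branch of the square root -/

theorem argPos_nonneg (z : ℂ) : 0 ≤ argPos z := by
  unfold argPos
  split_ifs <;> linarith [Complex.neg_pi_lt_arg z, Real.pi_pos]

theorem argPos_lt_two_pi (z : ℂ) : argPos z < 2 * Real.pi := by
  unfold argPos
  split_ifs <;> linarith [Complex.arg_le_pi z, Real.pi_pos]

theorem measurable_argPos : Measurable argPos :=
  Measurable.ite (measurableSet_le measurable_const Complex.measurable_arg)
    Complex.measurable_arg (Complex.measurable_arg.add_const _)

theorem exp_I_mul_argPos (z : ℂ) :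
    Complex.exp (Complex.I * argPos z) = Complex.exp (z.arg * Complex.I) := by
  unfold argPos
  split_ifs
  · rw [mul_comm]
  · push_cast
    rw [mul_add, mul_comm Complex.I, mul_comm Complex.I, Complex.exp_add,
      Complex.exp_two_pi_mul_I, mul_one]

theorem sqrtPos_sq (z : ℂ) : sqrtPos z ^ 2 = z := by
  have exp_half_sq : Complex.exp (Complex.I * (argPos z / 2 : ℝ)) ^ 2
      = Complex.exp (z.arg * Complex.I) := by
    rw [← Complex.exp_nat_mul, ← exp_I_mul_argPos]
    congr 1
    push_cast
    ring
  rw [sqrtPos, mul_pow, exp_half_sq, ← Complex.ofReal_pow, Real.sq_sqrt (norm_nonneg z),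
    Complex.norm_mul_exp_arg_mul_I]

theorem sqrtPos_im_nonneg (z : ℂ) : 0 ≤ (sqrtPos z).im := by
  rw [sqrtPos, Complex.im_ofReal_mul, mul_comm Complex.I, Complex.exp_ofReal_mul_I_im]
  exact mul_nonneg (Real.sqrt_nonneg _) (Real.sin_nonneg_of_nonneg_of_le_pi
    (by linarith [argPos_nonneg z]) (by linarith [argPos_lt_two_pi z]))

theorem measurable_sqrtPos : Measurable sqrtPos := by
  have := measurable_argPos
  unfold sqrtPos
  fun_prop

theorem re_cpow_half_pos {z : ℂ} (hz : z ∈ Complex.slitPlane) : 0 < (z ^ (1 / 2 : ℂ)).re := by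
  have half_arg : (Complex.log z * (1 / 2)).im = z.arg / 2 := by
    rw [show (1 / 2 : ℂ) = ((1 / 2 : ℝ) : ℂ) by push_cast; rfl, Complex.im_mul_ofReal,
      Complex.log_im]
    ring
  rw [Complex.cpow_def_of_ne_zero (Complex.slitPlane_ne_zero hz), Complex.exp_re, half_arg]
  have arg_lt_pi : z.arg < Real.pi :=
    lt_of_le_of_ne (Complex.arg_le_pi z) (Complex.slitPlane_arg_ne_pi hz)
  exact mul_pos (Real.exp_pos _) (Real.cos_pos_of_mem_Ioo
    ⟨by linarith [Complex.neg_pi_lt_arg z], by linarith⟩)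

theorem sqrtPos_eq_I_mul_cpow {z : ℂ} (hz : -z ∈ Complex.slitPlane) :
    sqrtPos z = Complex.I * (-z) ^ (1 / 2 : ℂ) := by
  have rotated_sq : (Complex.I * (-z) ^ (1 / 2 : ℂ)) ^ 2 = z := by
    rw [mul_pow, Complex.I_sq, ← Complex.cpow_nat_mul]
    norm_num
  rcases sq_eq_sq_iff_eq_or_eq_neg.1 ((sqrtPos_sq z).trans rotated_sq.symm) with h | h
  · exact h
  · have him := sqrtPos_im_nonneg z
    rw [h, Complex.neg_im, Complex.I_mul_im] at him
    linarith [re_cpow_half_pos hz]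

/-! ### The invariance map -/

theorem nu_sq (κ : ℝ) (l : ℂ) : nu κ l ^ 2 = -l ^ 2 - 2 * (κ : ℂ) ^ 2 := sqrtPos_sq _

theorem nu_im_nonneg (κ : ℝ) (l : ℂ) : 0 ≤ (nu κ l).im := sqrtPos_im_nonneg _

theorem measurable_nu : Measurable (fun p : ℝ × ℂ => nu p.1 p.2) :=
  measurable_sqrtPos.comp (by fun_prop)

theorem nu_ne_self {κ : ℝ} {l : ℂ} (hl : l.re ≠ 0) : nu κ l ≠ l := by
  intro h
  have hsq := nu_sq κ l
  rw [h] at hsq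
  have factored : (l - Complex.I * κ) * (l + Complex.I * κ) = 0 := by
    linear_combination (1 / 2 : ℂ) * hsq - (κ : ℂ) ^ 2 * Complex.I_sq
  rcases mul_eq_zero.1 factored with h | h
  all_goals exact hl (by simpa using congrArg Complex.re h)

theorem isClosed_cut (κ : ℝ) : IsClosed (cut κ) :=
  (isClosed_eq Complex.continuous_re continuous_const).inter
    (isClosed_le continuous_const (continuous_abs.comp Complex.continuous_im))

theorem mem_slitPlane_of_notMem_cut {κ : ℝ} {l : ℂ} (hl : l ∉ cut κ) :
    -(-l ^ 2 - 2 * (κ : ℂ) ^ 2) ∈ Complex.slitPlane := by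
  contrapose! hl
  rw [Complex.mem_slitPlane_iff] at hl
  push Not at hl
  obtain ⟨hre, him⟩ := hl
  simp only [pow_two, Complex.neg_re, Complex.sub_re, Complex.mul_re, Complex.neg_im,
    Complex.sub_im, Complex.mul_im, Complex.ofReal_re, Complex.ofReal_im, Complex.re_ofNat,
    Complex.im_ofNat] at hre him
  have re_eq_zero : l.re = 0 := by
    rcases mul_eq_zero.1 (by linarith : l.re * l.im = 0) with h | h
    · exact h
    · rw [h] at hre
      nlinarith [mul_self_nonneg κ, mul_self_nonneg l.re]
  rw [re_eq_zero] at hre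
  refine ⟨re_eq_zero, (pow_le_pow_iff_left₀ (by positivity) (abs_nonneg _) two_ne_zero).1 ?_⟩
  rw [mul_pow, Real.sq_sqrt zero_le_two, sq_abs, sq_abs]
  nlinarith

theorem analyticOnNhd_nu (κ : ℝ) : AnalyticOnNhd ℂ (nu κ) (cut κ)ᶜ := by
  refine DifferentiableOn.analyticOnNhd (fun l hl => ?_) (isClosed_cut κ).isOpen_compl
  have radicand : DifferentiableWithinAt ℂ (fun l : ℂ => -(-l ^ 2 - 2 * (κ : ℂ) ^ 2))
      (cut κ)ᶜ l := by fun_prop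
  have rotated := (radicand.cpow_const (c := 1 / 2)
    (mem_slitPlane_of_notMem_cut hl)).const_mul Complex.I
  exact rotated.congr (fun z hz => sqrtPos_eq_I_mul_cpow (mem_slitPlane_of_notMem_cut hz))
    (sqrtPos_eq_I_mul_cpow (mem_slitPlane_of_notMem_cut hl))

theorem nu_im_pos {κ : ℝ} {l : ℂ} (hl : l ∉ cut κ) : 0 < (nu κ l).im := by
  rw [nu, sqrtPos_eq_I_mul_cpow (mem_slitPlane_of_notMem_cut hl), Complex.I_mul_im]
  exact re_cpow_half_pos (mem_slitPlane_of_notMem_cut hl)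

/-! ### Geometry of the region -/

/-- The symbol `(κ² + l²)²` of `Δ²`. -/
abbrev symbol (κ : ℝ) (l : ℂ) : ℂ := ((κ : ℂ) ^ 2 + l ^ 2) ^ 2

theorem symbol_neg (κ : ℝ) (l : ℂ) : symbol κ (-l) = symbol κ l := by
  rw [symbol, neg_sq]

theorem symbol_nu (κ : ℝ) (l : ℂ) : symbol κ (nu κ l) = symbol κ l := by
  simp only [symbol, nu_sq]
  ring

theorem abs_le_sqrt (κ a : ℝ) : |a| ≤ Real.sqrt (κ ^ 2 + 2 * a ^ 2) :=
  Real.le_sqrt_of_sq_le (by rw [sq_abs]; nlinarith [sq_nonneg κ, sq_nonneg a])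

theorem sqrt_le_abs_add (κ a : ℝ) : Real.sqrt (κ ^ 2 + 2 * a ^ 2) ≤ |κ| + 3 / 2 * |a| := by
  refine Real.sqrt_le_iff.2 ⟨by positivity, ?_⟩
  rw [← sq_abs κ, ← sq_abs a]
  nlinarith [abs_nonneg κ, abs_nonneg a, mul_nonneg (abs_nonneg κ) (abs_nonneg a)]

theorem symbol_re (κ : ℝ) (l : ℂ) :
    (symbol κ l).re = ((l.im - Real.sqrt (κ ^ 2 + 2 * l.re ^ 2)) ^ 2 - l.re ^ 2)
      * ((l.im + Real.sqrt (κ ^ 2 + 2 * l.re ^ 2)) ^ 2 - l.re ^ 2) := by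
  set s := Real.sqrt (κ ^ 2 + 2 * l.re ^ 2)
  have κ_sq : κ * κ = s ^ 2 - 2 * l.re ^ 2 := by
    rw [Real.sq_sqrt (by positivity)]
    ring
  simp only [symbol, pow_two, Complex.mul_re, Complex.add_re, Complex.add_im, Complex.mul_im,
    Complex.ofReal_re, Complex.ofReal_im, mul_zero, sub_zero, zero_mul, add_zero, zero_add, κ_sq]
  ring

theorem symbol_re_nonneg {κ : ℝ} {l : ℂ} (him : 0 ≤ l.im)
    (h : |l.re| ≤ |l.im - Real.sqrt (κ ^ 2 + 2 * l.re ^ 2)|) : 0 ≤ (symbol κ l).re := by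
  rw [symbol_re]
  refine mul_nonneg (sub_nonneg.2 (sq_le_sq.2 h)) (sub_nonneg.2 (sq_le_sq.2 ?_))
  rw [abs_of_nonneg (add_nonneg him (Real.sqrt_nonneg _))]
  linarith [abs_le_sqrt κ l.re]

theorem closure_Dplus_subset (κ : ℝ) :
    closure (Dplus κ) ⊆ {l | |l.im - Real.sqrt (κ ^ 2 + 2 * l.re ^ 2)| ≤ |l.re|} :=
  closure_minimal (fun l hl => (sub_neg.1 ((mem_Dplus_iff κ l).1 hl)).le)
    (isClosed_le (by fun_prop) (by fun_prop))

theorem disjoint_thickening_cut {κ : ℝ} (hκ : κ ≠ 0) :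
    Disjoint (Metric.thickening (|κ| / 20) (closure (Dplus κ))) (cut κ) := by
  rw [Set.disjoint_left]
  rintro z hz ⟨re_eq_zero, le_im⟩
  obtain ⟨l, hl, dist_lt⟩ := Metric.mem_thickening_iff.1 hz
  rw [dist_eq_norm] at dist_lt
  have re_lt : |l.re| < |κ| / 20 := by
    simpa [re_eq_zero] using (Complex.abs_re_le_norm (z - l)).trans_lt dist_lt
  have im_sub_lt : |z.im - l.im| < |κ| / 20 := by
    simpa using (Complex.abs_im_le_norm (z - l)).trans_lt dist_lt
  have im_lt : |z.im| < 1.4 * |κ| := by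
    obtain ⟨l_im_ge, l_im_le⟩ := abs_le.1 (mem_ofPred.1 (closure_Dplus_subset κ hl))
    obtain ⟨z_im_gt, z_im_lt⟩ := abs_lt.1 im_sub_lt
    have sqrt_le := sqrt_le_abs_add κ l.re
    have sqrt_nonneg := Real.sqrt_nonneg (κ ^ 2 + 2 * l.re ^ 2)
    rw [abs_lt]
    constructor <;> linarith
  have sqrt_two_ge : (1.4 : ℝ) ≤ Real.sqrt 2 := Real.le_sqrt_of_sq_le (by norm_num)
  nlinarith [abs_pos.2 hκ]

theorem closure_Dplus_subset_compl_cut {κ : ℝ} (hκ : κ ≠ 0) :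
    closure (Dplus κ) ⊆ (cut κ)ᶜ := fun _ hl =>
  (disjoint_thickening_cut hκ).notMem_of_mem_left
    (Metric.self_subset_thickening (div_pos (abs_pos.2 hκ) (by norm_num)) _ hl)

theorem closure_Dplus_zero_diff_subset_compl_cut : closure (Dplus 0) \ {0} ⊆ (cut 0)ᶜ := by
  rintro l ⟨hl, hl0⟩ ⟨re_eq_zero, -⟩
  have im_eq_zero : l.im = 0 := by
    simpa [re_eq_zero] using closure_Dplus_subset 0 hl
  exact hl0 (Complex.ext re_eq_zero im_eq_zero)

/-! ### Geometry of the arcs -/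

@[simp] theorem arc_re (κ σ τ a : ℝ) : (arc κ σ τ a).re = σ * a := rfl

@[simp] theorem arc_im (κ σ τ a : ℝ) :
    (arc κ σ τ a).im = Real.sqrt (κ ^ 2 + 2 * a ^ 2) + τ * a := rfl

theorem arc_eq_add_mul_I (κ σ τ a : ℝ) : arc κ σ τ a
    = ((σ * a : ℝ) : ℂ) + ((Real.sqrt (κ ^ 2 + 2 * a ^ 2) + τ * a : ℝ) : ℂ) * Complex.I :=
  Complex.mk_eq_add_mul_I _ _

theorem measurable_arc (σ τ : ℝ) : Measurable (fun p : ℝ × ℝ => arc p.1 σ τ p.2) := by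
  simp only [arc_eq_add_mul_I]
  fun_prop

theorem continuous_arc (κ σ τ : ℝ) : Continuous (arc κ σ τ) := by
  simp only [funext (arc_eq_add_mul_I κ σ τ)]
  fun_prop

theorem hasDerivAt_arc (κ σ τ : ℝ) {a : ℝ} (ha : a ≠ 0) :
    HasDerivAt (arc κ σ τ)
      ((σ : ℂ) + ((2 * a / Real.sqrt (κ ^ 2 + 2 * a ^ 2) + τ : ℝ) : ℂ) * Complex.I) a := by
  have radicand : HasDerivAt (fun a : ℝ => κ ^ 2 + 2 * a ^ 2) (2 * (2 * a)) a := by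
    simpa using ((hasDerivAt_pow 2 a).const_mul 2).const_add (κ ^ 2)
  have him : HasDerivAt (fun a : ℝ => Real.sqrt (κ ^ 2 + 2 * a ^ 2) + τ * a)
      (2 * a / Real.sqrt (κ ^ 2 + 2 * a ^ 2) + τ) a := by
    convert! (radicand.sqrt (by positivity)).add ((hasDerivAt_id a).const_mul τ) using 1
    field_simp
  have hre : HasDerivAt (fun a : ℝ => σ * a) σ a := by
    simpa using (hasDerivAt_id a).const_mul σ
  rw [funext (arc_eq_add_mul_I κ σ τ)]
  exact hre.ofReal_comp.add (him.ofReal_comp.mul_const Complex.I)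

theorem aestronglyMeasurable_deriv_arc (σ τ : ℝ) :
    AEStronglyMeasurable (fun p : ℝ × ℝ => deriv (arc p.1 σ τ) p.2)
      (volume.restrict (univ ×ˢ Ioi 0)) := by
  have velocity : Measurable (fun p : ℝ × ℝ => ((σ : ℂ)
      + ((2 * p.2 / Real.sqrt (p.1 ^ 2 + 2 * p.2 ^ 2) + τ : ℝ) : ℂ) * Complex.I)) := by
    fun_prop
  refine velocity.aestronglyMeasurable.congr ?_
  filter_upwards [ae_restrict_mem (MeasurableSet.univ.prod measurableSet_Ioi)] with p hp
  exact (hasDerivAt_arc p.1 σ τ (ne_of_gt hp.2)).deriv.symm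

theorem norm_deriv_arc_le (κ : ℝ) {σ τ a : ℝ} (hσ : |σ| ≤ 1) (hτ : |τ| ≤ 1) (ha : 0 < a) :
    ‖deriv (arc κ σ τ) a‖ ≤ 4 := by
  have ratio_le : |2 * a / Real.sqrt (κ ^ 2 + 2 * a ^ 2)| ≤ 2 := by
    have le_sqrt := abs_le_sqrt κ a
    rw [abs_of_pos ha] at le_sqrt
    rw [abs_of_nonneg (by positivity), div_le_iff₀ (by linarith)]
    linarith
  rw [(hasDerivAt_arc κ σ τ ha.ne').deriv]
  calc ‖(σ : ℂ) + ((2 * a / Real.sqrt (κ ^ 2 + 2 * a ^ 2) + τ : ℝ) : ℂ) * Complex.I‖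
      ≤ |σ| + |2 * a / Real.sqrt (κ ^ 2 + 2 * a ^ 2) + τ| := by
        refine (norm_add_le _ _).trans_eq ?_
        rw [norm_mul, Complex.norm_I, mul_one, Complex.norm_real, Complex.norm_real,
          Real.norm_eq_abs, Real.norm_eq_abs]
    _ ≤ 4 := by linarith [abs_add_le (2 * a / Real.sqrt (κ ^ 2 + 2 * a ^ 2)) τ]

theorem abs_eq_one_of_mem {σ : ℝ} (hσ : σ ∈ ({1, -1} : Set ℝ)) : |σ| = 1 :=
  (abs_eq zero_le_one).2 hσ

theorem abs_arc_re (κ : ℝ) {σ : ℝ} (hσ : |σ| = 1) (τ a : ℝ) : |(arc κ σ τ a).re| = |a| := by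
  rw [arc_re, abs_mul, hσ, one_mul]

theorem arc_re_sq (κ : ℝ) {σ : ℝ} (hσ : |σ| = 1) (τ a : ℝ) : (arc κ σ τ a).re ^ 2 = a ^ 2 :=
  sq_eq_sq_iff_abs_eq_abs _ _ |>.2 (abs_arc_re κ hσ τ a)

theorem symbol_arc_re (κ : ℝ) {σ τ : ℝ} (hσ : |σ| = 1) (hτ : |τ| = 1) (a : ℝ) :
    (symbol κ (arc κ σ τ a)).re = 0 := by
  rw [symbol_re, arc_re_sq κ hσ, arc_im, add_sub_cancel_left, mul_pow, ← sq_abs τ, hτ]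
  ring

theorem le_sqrt_sub (κ a : ℝ) : (|κ| + a) / 10 ≤ Real.sqrt (κ ^ 2 + 2 * a ^ 2) - a := by
  rw [le_sub_iff_add_le]
  refine Real.le_sqrt_of_sq_le ?_
  nlinarith [sq_abs κ, sq_nonneg (|κ| - a)]

/-- A convex region containing the points with parameter `r` of all four arcs, on which `Im l`
is comparable to `|κ| + r`. -/
def arcStrip (κ r : ℝ) : Set ℂ :=
  {l | |l.re| ≤ r ∧ (|κ| + r) / 10 ≤ l.im ∧ l.im ≤ |κ| + 3 * r}

theorem convex_arcStrip (κ r : ℝ) : Convex ℝ (arcStrip κ r) := by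
  have hre : Convex ℝ {l : ℂ | |l.re| ≤ r} := by
    simp only [abs_le]
    exact (convex_halfSpace_re_ge (-r)).inter (convex_halfSpace_re_le r)
  exact hre.inter ((convex_halfSpace_im_ge _).inter (convex_halfSpace_im_le _))

theorem arc_mem_arcStrip (κ : ℝ) {σ τ r : ℝ} (hσ : |σ| = 1) (hτ : |τ| ≤ 1) (hr : 0 ≤ r) :
    arc κ σ τ r ∈ arcStrip κ r := by
  have sqrt_le := sqrt_le_abs_add κ r
  rw [abs_of_nonneg hr] at sqrt_le
  obtain ⟨τ_ge, τ_le⟩ := abs_le.1 hτ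
  have mul_ge : -r ≤ τ * r := by nlinarith
  have mul_le : τ * r ≤ r := by nlinarith
  refine ⟨(abs_arc_re κ hσ τ r).trans_le (abs_of_nonneg hr).le, ?_, ?_⟩
  · linarith [le_sqrt_sub κ r, arc_im κ σ τ r]
  · linarith [arc_im κ σ τ r]

theorem arc_im_pos (κ σ : ℝ) {τ r : ℝ} (hτ : |τ| ≤ 1) (hr : 0 < r) :
    0 < (arc κ σ τ r).im := by
  have := (arc_mem_arcStrip κ (σ := 1) (by simp) hτ hr.le).2.1
  exact lt_of_lt_of_le (by positivity) this

/-! ### Partial derivatives on the closed half plane -/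

section Slices

variable {F : Type*} [NormedAddCommGroup F] [NormedSpace ℝ F] {f : ℝ × ℝ → F}

theorem hasDerivAt_fst_slice (hf : DifferentiableOn ℝ f (univ ×ˢ Ici 0)) (x : ℝ) {y : ℝ}
    (hy : 0 ≤ y) :
    HasDerivAt (fun s => f (s, y)) (fderivWithin ℝ f (univ ×ˢ Ici 0) (x, y) (1, 0)) x := by
  have line : HasDerivWithinAt (fun s : ℝ => (s, y)) ((1 : ℝ), (0 : ℝ)) univ x :=
    ((hasDerivAt_id x).prodMk (hasDerivAt_const x y)).hasDerivWithinAt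
  exact hasDerivWithinAt_univ.1 <|
    (hf (x, y) ⟨mem_univ _, hy⟩).hasFDerivWithinAt.comp_hasDerivWithinAt
      (f := fun s : ℝ => (s, y)) x line fun _ _ => ⟨mem_univ _, hy⟩

theorem hasDerivWithinAt_snd_slice (hf : DifferentiableOn ℝ f (univ ×ˢ Ici 0)) (x : ℝ) {y : ℝ}
    (hy : 0 ≤ y) :
    HasDerivWithinAt (fun s => f (x, s)) (fderivWithin ℝ f (univ ×ˢ Ici 0) (x, y) (0, 1))
      (Ici 0) y := by
  have line : HasDerivWithinAt (fun s : ℝ => (x, s)) ((0 : ℝ), (1 : ℝ)) (Ici 0) y :=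
    ((hasDerivAt_const y x).prodMk (hasDerivAt_id y)).hasDerivWithinAt
  exact (hf (x, y) ⟨mem_univ _, hy⟩).hasFDerivWithinAt.comp_hasDerivWithinAt
    (f := fun s : ℝ => (x, s)) y line fun _ hs => ⟨mem_univ _, hs⟩

theorem contDiffOn_fderivWithin_halfPlane_apply {n : ℕ}
    (hf : ContDiffOn ℝ (n + 1 : ℕ) f (univ ×ˢ Ici 0)) (v : ℝ × ℝ) :
    ContDiffOn ℝ n (fun q => fderivWithin ℝ f (univ ×ˢ Ici 0) q v) (univ ×ˢ Ici 0) :=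
  (hf.fderivWithin (uniqueDiffOn_univ.prod (uniqueDiffOn_Ici 0)) (by norm_cast)).clm_apply
    contDiffOn_const

end Slices

section PartialDerivatives

variable {v : ℝ → ℝ → ℝ → ℂ} {t : ℝ} {n : ℕ}

theorem contDiffOn_dx
    (hv : ContDiffOn ℝ (n + 1 : ℕ) (fun q : ℝ × ℝ => v q.1 q.2 t) (univ ×ˢ Ici 0)) :
    ContDiffOn ℝ n (fun q : ℝ × ℝ => dx v q.1 q.2 t) (univ ×ˢ Ici 0) :=
  (contDiffOn_fderivWithin_halfPlane_apply hv (1, 0)).congr fun q hq =>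
    (hasDerivAt_fst_slice (hv.differentiableOn (by norm_cast)) q.1 hq.2).deriv

theorem contDiffOn_dy
    (hv : ContDiffOn ℝ (n + 1 : ℕ) (fun q : ℝ × ℝ => v q.1 q.2 t) (univ ×ˢ Ici 0)) :
    ContDiffOn ℝ n (fun q : ℝ × ℝ => dy v q.1 q.2 t) (univ ×ˢ Ici 0) :=
  (contDiffOn_fderivWithin_halfPlane_apply hv (0, 1)).congr fun q hq =>
    (hasDerivWithinAt_snd_slice (hv.differentiableOn (by norm_cast)) q.1 hq.2).derivWithin
      (uniqueDiffOn_Ici 0 _ hq.2)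

theorem contDiffOn_iterate_dx (i : ℕ)
    (hv : ContDiffOn ℝ (n + i : ℕ) (fun q : ℝ × ℝ => v q.1 q.2 t) (univ ×ˢ Ici 0)) :
    ContDiffOn ℝ n (fun q : ℝ × ℝ => dx^[i] v q.1 q.2 t) (univ ×ˢ Ici 0) := by
  induction i generalizing n with
  | zero => exact hv
  | succ i ih =>
    simp only [Function.iterate_succ_apply']
    exact contDiffOn_dx (ih (n := n + 1) (by convert! hv using 2; ring))

theorem contDiffOn_iterate_dy (j : ℕ)
    (hv : ContDiffOn ℝ (n + j : ℕ) (fun q : ℝ × ℝ => v q.1 q.2 t) (univ ×ˢ Ici 0)) :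
    ContDiffOn ℝ n (fun q : ℝ × ℝ => dy^[j] v q.1 q.2 t) (univ ×ˢ Ici 0) := by
  induction j generalizing n with
  | zero => exact hv
  | succ j ih =>
    simp only [Function.iterate_succ_apply']
    exact contDiffOn_dy (ih (n := n + 1) (by convert! hv using 2; ring))

end PartialDerivatives

namespace SmoothDecaying

variable {T m t : ℝ} {u : ℝ → ℝ → ℝ → ℂ}

theorem differentiableOn (hu : SmoothDecaying T m u) {i j : ℕ} (hij : i + j < 4)
    (ht : t ∈ Icc 0 T) :
    DifferentiableOn ℝ (fun q : ℝ × ℝ => dx^[i] (dy^[j] u) q.1 q.2 t) (univ ×ˢ Ici 0) := by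
  have contDiffOn_one : ContDiffOn ℝ (1 : ℕ) (fun q : ℝ × ℝ => dx^[i] (dy^[j] u) q.1 q.2 t)
      (univ ×ˢ Ici 0) := by
    refine contDiffOn_iterate_dx i (contDiffOn_iterate_dy j ((hu.contDiffOn t ht).of_le ?_))
    norm_cast
    omega
  exact contDiffOn_one.differentiableOn one_ne_zero

theorem hasDerivAt_dx (hu : SmoothDecaying T m u) {i j : ℕ} (hij : i + j < 4)
    (ht : t ∈ Icc 0 T) (x : ℝ) {y : ℝ} (hy : 0 ≤ y) :
    HasDerivAt (fun s => dx^[i] (dy^[j] u) s y t) (dx^[i + 1] (dy^[j] u) x y t) x := by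
  rw [Function.iterate_succ_apply']
  exact (hasDerivAt_fst_slice (hu.differentiableOn hij ht) x hy).differentiableAt.hasDerivAt

theorem hasDerivWithinAt_dy (hu : SmoothDecaying T m u) {j : ℕ} (hj : j < 4)
    (ht : t ∈ Icc 0 T) (x : ℝ) {y : ℝ} (hy : 0 ≤ y) :
    HasDerivWithinAt (fun s => dy^[j] u x s t) (dy^[j + 1] u x y t) (Ici 0) y := by
  rw [Function.iterate_succ_apply']
  exact (hasDerivWithinAt_snd_slice (hu.differentiableOn (i := 0) (by rwa [zero_add]) ht) x
    hy).differentiableWithinAt.hasDerivWithinAt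

end SmoothDecaying

/-! ### Decaying continuous functions on the closed half plane -/

/-- Continuity on the closed half plane and decay of order `m`. The constant is a parameter
because the bounds on the transforms of `u(·, ·, t)` have to be uniform in `t`. -/
structure IsDecaying (C m : ℝ) (w : ℝ → ℝ → ℂ) : Prop where
  continuousOn : ContinuousOn (fun q : ℝ × ℝ => w q.1 q.2) (univ ×ˢ Ici 0)
  bound : ∀ x : ℝ, ∀ y : ℝ, 0 ≤ y → ‖w x y‖ ≤ C * (1 + |x| + |y|) ^ (-m)

theorem SmoothDecaying.exists_isDecaying {T m : ℝ} {u : ℝ → ℝ → ℝ → ℂ}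
    (hu : SmoothDecaying T m u) :
    ∃ C : ℝ, ∀ i j : ℕ, i + j ≤ 4 → ∀ t ∈ Icc 0 T,
      IsDecaying C m (fun x y => dx^[i] (dy^[j] u) x y t) := by
  obtain ⟨C, hC⟩ := hu.decay
  refine ⟨C, fun i j hij t ht => ⟨?_, fun x y hy => hC i j hij x y hy t ht⟩⟩
  exact (hu.continuousOn i j hij).comp (f := fun q : ℝ × ℝ => (q.1, q.2, t)) (by fun_prop)
    fun q hq => ⟨mem_univ _, hq.2, ht⟩

theorem volume_restrict_halfPlane :
    (volume : Measure (ℝ × ℝ)).restrict (univ ×ˢ Ioi 0)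
      = (volume : Measure ℝ).prod (volume.restrict (Ioi 0)) := by
  rw [Measure.volume_eq_prod, ← Measure.prod_restrict, Measure.restrict_univ]

theorem ae_mem_halfPlane :
    ∀ᵐ q ∂(volume : Measure (ℝ × ℝ)).restrict (univ ×ˢ Ioi 0), 0 < q.2 := by
  filter_upwards [ae_restrict_mem (MeasurableSet.univ.prod measurableSet_Ioi)] with q hq
  exact hq.2

theorem integrable_one_add_abs_add_abs_rpow_neg {m : ℝ} (hm : 2 < m) :
    Integrable (fun q : ℝ × ℝ => (1 + |q.1| + |q.2|) ^ (-m)) := by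
  have norm_le (q : ℝ × ℝ) : ‖q‖ ≤ |q.1| + |q.2| :=
    max_le (le_add_of_nonneg_right (abs_nonneg q.2)) (le_add_of_nonneg_left (abs_nonneg q.1))
  refine (integrable_one_add_norm (E := ℝ × ℝ) (r := m) (by simpa using hm)).mono'
    (Measurable.aestronglyMeasurable (by fun_prop)) (Eventually.of_forall fun q => ?_)
  rw [Real.norm_of_nonneg (by positivity)]
  exact Real.rpow_le_rpow_of_nonpos (by positivity) (by linarith [norm_le q]) (by linarith)

theorem integrable_abs_mul_one_add_abs_add_abs_rpow_neg {m : ℝ} (hm : 3 < m) :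
    Integrable (fun q : ℝ × ℝ => |q.2| * (1 + |q.1| + |q.2|) ^ (-m)) := by
  refine (integrable_one_add_abs_add_abs_rpow_neg (m := m - 1) (by linarith)).mono'
    (Measurable.aestronglyMeasurable (by fun_prop)) (Eventually.of_forall fun q => ?_)
  rw [Real.norm_of_nonneg (by positivity), show -(m - 1) = 1 + -m by ring,
    Real.rpow_add (by positivity), Real.rpow_one]
  gcongr
  linarith [abs_nonneg q.1]

theorem integrable_one_add_abs_rpow_neg {m : ℝ} (hm : 1 < m) :
    Integrable (fun x : ℝ => (1 + |x|) ^ (-m)) := by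
  simpa using integrable_one_add_norm (E := ℝ) (μ := volume) (r := m) (by simpa using hm)

theorem norm_exp_neg_I_mul (κ x : ℝ) : ‖Complex.exp (-Complex.I * x * κ)‖ = 1 := by
  rw [show -Complex.I * (x : ℂ) * κ = ((-(x * κ) : ℝ) : ℂ) * Complex.I by push_cast; ring,
    Complex.norm_exp_ofReal_mul_I]

theorem norm_exp_neg_I_mul_le_one {y : ℝ} (hy : 0 ≤ y) {l : ℂ} (hl : l.im ≤ 0) :
    ‖Complex.exp (-Complex.I * y * l)‖ ≤ 1 := by
  have hre : (-Complex.I * (y : ℂ) * l).re = y * l.im := by simp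
  rw [Complex.norm_exp, hre, Real.exp_le_one_iff]
  exact mul_nonpos_of_nonneg_of_nonpos hy hl

theorem exp_sub_eq_mul (κ x y : ℝ) (l : ℂ) :
    Complex.exp (-Complex.I * x * κ - Complex.I * y * l)
      = Complex.exp (-Complex.I * y * l) * Complex.exp (-Complex.I * x * κ) := by
  rw [← Complex.exp_add]
  ring_nf

theorem norm_exp_sub_exp_le {a b : ℂ} (ha : a.re ≤ 0) (hb : b.re ≤ 0) :
    ‖Complex.exp a - Complex.exp b‖ ≤ ‖a - b‖ := by
  simpa using (convex_halfSpace_re_le 0).norm_image_sub_le_of_norm_hasDerivWithin_le (C := 1)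
    (fun z _ => (Complex.hasDerivAt_exp z).hasDerivWithinAt)
    (fun z hz => by simpa [Complex.norm_exp] using hz) hb ha

namespace IsDecaying

variable {C m : ℝ} {w : ℝ → ℝ → ℂ}

theorem nonneg (hw : IsDecaying C m w) : 0 ≤ C := by
  simpa using (norm_nonneg _).trans (hw.bound 0 0 le_rfl)

theorem norm_le_fst (hw : IsDecaying C m w) (hm : 0 ≤ m) (x : ℝ) {y : ℝ} (hy : 0 ≤ y) :
    ‖w x y‖ ≤ C * (1 + |x|) ^ (-m) :=
  (hw.bound x y hy).trans <| mul_le_mul_of_nonneg_left (Real.rpow_le_rpow_of_nonpos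
    (by positivity) (by linarith [abs_nonneg y]) (by linarith)) hw.nonneg

theorem norm_le_snd (hw : IsDecaying C m w) (hm : 0 ≤ m) (x : ℝ) {y : ℝ} (hy : 0 ≤ y) :
    ‖w x y‖ ≤ C * (1 + |y|) ^ (-m) :=
  (hw.bound x y hy).trans <| mul_le_mul_of_nonneg_left (Real.rpow_le_rpow_of_nonpos
    (by positivity) (by linarith [abs_nonneg x]) (by linarith)) hw.nonneg

theorem aestronglyMeasurable (hw : IsDecaying C m w) :
    AEStronglyMeasurable (fun q : ℝ × ℝ => w q.1 q.2) (volume.restrict (univ ×ˢ Ioi 0)) :=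
  (hw.continuousOn.mono (prod_mono le_rfl Ioi_subset_Ici_self)).aestronglyMeasurable
    (MeasurableSet.univ.prod measurableSet_Ioi)

theorem continuous_fst (hw : IsDecaying C m w) {y : ℝ} (hy : 0 ≤ y) :
    Continuous (fun x => w x y) :=
  continuousOn_univ.1 <| hw.continuousOn.comp (f := fun x : ℝ => (x, y)) (by fun_prop)
    fun _ _ => ⟨mem_univ _, hy⟩

theorem continuousOn_snd (hw : IsDecaying C m w) (x : ℝ) : ContinuousOn (fun y => w x y) (Ici 0) :=
  hw.continuousOn.comp (f := fun y : ℝ => (x, y)) (by fun_prop) fun _ hy => ⟨mem_univ _, hy⟩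

theorem add {C₁ C₂ : ℝ} {w₁ w₂ : ℝ → ℝ → ℂ} (h₁ : IsDecaying C₁ m w₁)
    (h₂ : IsDecaying C₂ m w₂) : IsDecaying (C₁ + C₂) m (fun x y => w₁ x y + w₂ x y) where
  continuousOn := h₁.continuousOn.add h₂.continuousOn
  bound x y hy := by
    rw [add_mul]
    exact (norm_add_le _ _).trans (add_le_add (h₁.bound x y hy) (h₂.bound x y hy))

theorem const_mul (hw : IsDecaying C m w) (c : ℂ) :
    IsDecaying (‖c‖ * C) m (fun x y => c * w x y) where
  continuousOn := hw.continuousOn.const_mul c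
  bound x y hy := by
    rw [norm_mul, mul_assoc]
    exact mul_le_mul_of_nonneg_left (hw.bound x y hy) (norm_nonneg c)

theorem integrable_fst (hw : IsDecaying C m w) (hm : 1 < m) (κ : ℝ) {y : ℝ} (hy : 0 ≤ y) :
    Integrable (fun x : ℝ => Complex.exp (-Complex.I * x * κ) * w x y) := by
  have := hw.continuous_fst hy
  refine ((integrable_one_add_abs_rpow_neg hm).const_mul C).mono'
    (Continuous.aestronglyMeasurable (by fun_prop)) (Eventually.of_forall fun x => ?_)
  rw [norm_mul, norm_exp_neg_I_mul, one_mul]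
  exact hw.norm_le_fst (by linarith) x hy

theorem integrableOn_snd (hw : IsDecaying C m w) (hm : 1 < m) (x : ℝ) {l : ℂ}
    (hl : l.im ≤ 0) :
    IntegrableOn (fun y : ℝ => Complex.exp (-Complex.I * y * l) * w x y) (Ioi 0) := by
  have := (hw.continuousOn_snd x).mono Ioi_subset_Ici_self
  refine ((integrable_one_add_abs_rpow_neg hm).const_mul C).integrableOn.mono'
    (ContinuousOn.aestronglyMeasurable (by fun_prop) measurableSet_Ioi) ?_
  filter_upwards [ae_restrict_mem measurableSet_Ioi] with y hy
  rw [norm_mul]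
  exact (mul_le_of_le_one_left (norm_nonneg _) (norm_exp_neg_I_mul_le_one (le_of_lt hy) hl)).trans
    (hw.norm_le_snd (by linarith) x (le_of_lt hy))

theorem norm_exp_mul_le (hw : IsDecaying C m w) (κ x : ℝ) {y : ℝ} (hy : 0 ≤ y) {l : ℂ}
    (hl : l.im ≤ 0) :
    ‖Complex.exp (-Complex.I * x * κ - Complex.I * y * l) * w x y‖
      ≤ C * (1 + |x| + |y|) ^ (-m) := by
  rw [exp_sub_eq_mul, norm_mul, norm_mul, norm_exp_neg_I_mul, mul_one]
  exact (mul_le_of_le_one_left (norm_nonneg _) (norm_exp_neg_I_mul_le_one hy hl)).trans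
    (hw.bound x y hy)

theorem integrableOn_halfPlane (hw : IsDecaying C m w) (hm : 2 < m) (κ : ℝ) {l : ℂ}
    (hl : l.im ≤ 0) :
    IntegrableOn (fun q : ℝ × ℝ =>
      Complex.exp (-Complex.I * q.1 * κ - Complex.I * q.2 * l) * w q.1 q.2) (univ ×ˢ Ioi 0) := by
  refine ((integrable_one_add_abs_add_abs_rpow_neg hm).const_mul C).integrableOn.mono'
    ((Continuous.aestronglyMeasurable (by fun_prop)).mul hw.aestronglyMeasurable) ?_
  filter_upwards [ae_mem_halfPlane] with q hq
  exact hw.norm_exp_mul_le κ q.1 hq.le hl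

theorem integrable_prod (hw : IsDecaying C m w) (hm : 2 < m) (κ : ℝ) {l : ℂ} (hl : l.im ≤ 0) :
    Integrable (fun q : ℝ × ℝ =>
      Complex.exp (-Complex.I * q.1 * κ - Complex.I * q.2 * l) * w q.1 q.2)
      ((volume : Measure ℝ).prod (volume.restrict (Ioi 0))) :=
  volume_restrict_halfPlane ▸ hw.integrableOn_halfPlane hm κ hl

/-! ### The half space Fourier transform of a decaying function -/

theorem halfFourier_eq_setIntegral (hw : IsDecaying C m w) (hm : 2 < m) (κ : ℝ) {l : ℂ}
    (hl : l.im ≤ 0) :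
    halfFourier w κ l = ∫ q in (univ : Set ℝ) ×ˢ Ioi (0 : ℝ),
      Complex.exp (-Complex.I * q.1 * κ - Complex.I * q.2 * l) * w q.1 q.2 := by
  rw [volume_restrict_halfPlane, integral_prod _ (hw.integrable_prod hm κ hl)]
  rfl

theorem halfFourier_eq_integral_fourierX (hw : IsDecaying C m w) (hm : 2 < m) (κ : ℝ) {l : ℂ}
    (hl : l.im ≤ 0) :
    halfFourier w κ l
      = ∫ y in Ioi (0 : ℝ), Complex.exp (-Complex.I * y * l) * fourierX w κ y := by
  simp only [fourierX, ← integral_const_mul, ← mul_assoc, ← exp_sub_eq_mul]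
  exact integral_integral_swap (hw.integrable_prod hm κ hl)

theorem norm_halfFourier_le (hw : IsDecaying C m w) (hm : 2 < m) (κ : ℝ) {l : ℂ}
    (hl : l.im ≤ 0) :
    ‖halfFourier w κ l‖ ≤ C * ∫ q : ℝ × ℝ, (1 + |q.1| + |q.2|) ^ (-m) := by
  have bound_integrable := (integrable_one_add_abs_add_abs_rpow_neg hm).const_mul C
  have bound_nonneg (q : ℝ × ℝ) : 0 ≤ C * (1 + |q.1| + |q.2|) ^ (-m) :=
    mul_nonneg hw.nonneg (by positivity)
  rw [hw.halfFourier_eq_setIntegral hm κ hl, ← integral_const_mul]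
  refine (norm_integral_le_of_norm_le bound_integrable.integrableOn ?_).trans
    (setIntegral_le_integral bound_integrable (Eventually.of_forall bound_nonneg))
  filter_upwards [ae_mem_halfPlane] with q hq
  exact hw.norm_exp_mul_le κ q.1 hq.le hl

theorem norm_exp_sub_exp_mul_le (hw : IsDecaying C m w) (κ x : ℝ) {y : ℝ} (hy : 0 ≤ y)
    {l l' : ℂ} (hl : l.im ≤ 0) (hl' : l'.im ≤ 0) :
    ‖Complex.exp (-Complex.I * x * κ - Complex.I * y * l) * w x y
        - Complex.exp (-Complex.I * x * κ - Complex.I * y * l') * w x y‖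
      ≤ C * (|y| * (1 + |x| + |y|) ^ (-m)) * ‖l - l'‖ := by
  have re_nonpos {k : ℂ} (hk : k.im ≤ 0) : (-Complex.I * (y : ℂ) * k).re ≤ 0 := by
    simpa using mul_nonpos_of_nonneg_of_nonpos hy hk
  have exponent_sub : ‖-Complex.I * (y : ℂ) * l - -Complex.I * y * l'‖ = |y| * ‖l - l'‖ := by
    rw [← mul_sub, norm_mul, norm_mul, norm_neg, Complex.norm_I, one_mul, Complex.norm_real,
      Real.norm_eq_abs]
  calc _ = ‖Complex.exp (-Complex.I * y * l) - Complex.exp (-Complex.I * y * l')‖ * ‖w x y‖ := by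
        rw [← sub_mul, exp_sub_eq_mul, exp_sub_eq_mul, ← sub_mul, norm_mul, norm_mul,
          norm_exp_neg_I_mul, mul_one]
    _ ≤ |y| * ‖l - l'‖ * (C * (1 + |x| + |y|) ^ (-m)) := by
        refine mul_le_mul ?_ (hw.bound x y hy) (norm_nonneg _) (by positivity)
        exact (norm_exp_sub_exp_le (re_nonpos hl) (re_nonpos hl')).trans_eq exponent_sub
    _ = C * (|y| * (1 + |x| + |y|) ^ (-m)) * ‖l - l'‖ := by ring

theorem norm_halfFourier_sub_le (hw : IsDecaying C m w) (hm : 3 < m) (κ : ℝ) {l l' : ℂ}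
    (hl : l.im ≤ 0) (hl' : l'.im ≤ 0) :
    ‖halfFourier w κ l - halfFourier w κ l'‖
      ≤ (C * ∫ q : ℝ × ℝ, |q.2| * (1 + |q.1| + |q.2|) ^ (-m)) * ‖l - l'‖ := by
  have two_lt_m : 2 < m := by linarith
  have bound_integrable :=
    ((integrable_abs_mul_one_add_abs_add_abs_rpow_neg hm).const_mul C).mul_const ‖l - l'‖
  have bound_nonneg (q : ℝ × ℝ) :
      0 ≤ C * (|q.2| * (1 + |q.1| + |q.2|) ^ (-m)) * ‖l - l'‖ :=
    mul_nonneg (mul_nonneg hw.nonneg (by positivity)) (norm_nonneg _)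
  rw [hw.halfFourier_eq_setIntegral two_lt_m κ hl, hw.halfFourier_eq_setIntegral two_lt_m κ hl',
    ← integral_sub (hw.integrableOn_halfPlane two_lt_m κ hl)
      (hw.integrableOn_halfPlane two_lt_m κ hl'), ← integral_const_mul, ← integral_mul_const]
  refine (norm_integral_le_of_norm_le bound_integrable.integrableOn ?_).trans
    (setIntegral_le_integral bound_integrable (Eventually.of_forall bound_nonneg))
  filter_upwards [ae_mem_halfPlane] with q hq
  exact hw.norm_exp_sub_exp_mul_le κ q.1 hq.le hl hl'

theorem norm_exp_mul_mul_le (hw : IsDecaying C m w) (κ x : ℝ) {y : ℝ} (hy : 0 ≤ y) {l : ℂ}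
    (hl : l.im ≤ 0) :
    ‖Complex.exp (-Complex.I * x * κ - Complex.I * y * l) * (-(Complex.I * y)) * w x y‖
      ≤ C * (|y| * (1 + |x| + |y|) ^ (-m)) := by
  have norm_factor : ‖-(Complex.I * (y : ℂ))‖ = |y| := by simp
  rw [mul_right_comm, norm_mul, norm_factor, mul_left_comm, mul_comm]
  exact mul_le_mul_of_nonneg_left (hw.norm_exp_mul_le κ x hy hl) (abs_nonneg y)

theorem differentiableAt_halfFourier (hw : IsDecaying C m w) (hm : 3 < m) (κ : ℝ)
    {l : ℂ} (hl : l.im < 0) : DifferentiableAt ℂ (halfFourier w κ) l := by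
  have lowerHalfPlane_mem : {z : ℂ | z.im < 0} ∈ 𝓝 l :=
    (isOpen_lt Complex.continuous_im continuous_const).mem_nhds hl
  have hasDerivAt_setIntegral := hasDerivAt_integral_of_dominated_loc_of_deriv_le
    (μ := (volume : Measure (ℝ × ℝ)).restrict (univ ×ˢ Ioi 0))
    (F := fun (z : ℂ) (q : ℝ × ℝ) =>
      Complex.exp (-Complex.I * q.1 * κ - Complex.I * q.2 * z) * w q.1 q.2)
    (F' := fun (z : ℂ) (q : ℝ × ℝ) =>
      Complex.exp (-Complex.I * q.1 * κ - Complex.I * q.2 * z) * (-(Complex.I * q.2)) * w q.1 q.2)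
    (bound := fun q => C * (|q.2| * (1 + |q.1| + |q.2|) ^ (-m)))
    lowerHalfPlane_mem
    (Eventually.of_forall fun z =>
      (Continuous.aestronglyMeasurable (by fun_prop)).mul hw.aestronglyMeasurable)
    (hw.integrableOn_halfPlane (by linarith) κ hl.le)
    ((Continuous.aestronglyMeasurable (by fun_prop)).mul hw.aestronglyMeasurable)
    (ae_mem_halfPlane.mono fun q hq z hz => hw.norm_exp_mul_mul_le κ q.1 hq.le (le_of_lt hz))
    ((integrable_abs_mul_one_add_abs_add_abs_rpow_neg hm).const_mul C).integrableOn
    (Eventually.of_forall fun q z _ => by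
      refine (HasDerivAt.cexp ?_).mul_const _
      simpa using ((hasDerivAt_id z).const_mul (Complex.I * (q.2 : ℂ))).const_sub
        (-Complex.I * q.1 * κ))
  refine (hasDerivAt_setIntegral.2.congr_of_eventuallyEq ?_).differentiableAt
  filter_upwards [lowerHalfPlane_mem] with z hz
  exact hw.halfFourier_eq_setIntegral (by linarith) κ (le_of_lt hz)

theorem halfFourier_add {C₁ C₂ : ℝ} {w₁ w₂ : ℝ → ℝ → ℂ} (h₁ : IsDecaying C₁ m w₁)
    (h₂ : IsDecaying C₂ m w₂) (hm : 2 < m) (κ : ℝ) {l : ℂ} (hl : l.im ≤ 0) :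
    halfFourier (fun x y => w₁ x y + w₂ x y) κ l = halfFourier w₁ κ l + halfFourier w₂ κ l := by
  rw [(h₁.add h₂).halfFourier_eq_setIntegral hm κ hl, h₁.halfFourier_eq_setIntegral hm κ hl,
    h₂.halfFourier_eq_setIntegral hm κ hl, ← integral_add (h₁.integrableOn_halfPlane hm κ hl)
      (h₂.integrableOn_halfPlane hm κ hl)]
  simp only [mul_add]

end IsDecaying

theorem halfFourier_const_mul (w : ℝ → ℝ → ℂ) (c : ℂ) (κ : ℝ) (l : ℂ) :
    halfFourier (fun x y => c * w x y) κ l = c * halfFourier w κ l := by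
  simp only [halfFourier, mul_left_comm _ c, integral_const_mul]

/-! ### Transforms of derivatives -/

theorem hasDerivAt_exp_mul_ofReal (c : ℂ) (s : ℝ) :
    HasDerivAt (fun s : ℝ => Complex.exp (c * s)) (c * Complex.exp (c * s)) s := by
  simpa [mul_comm] using ((hasDerivAt_id s).ofReal_comp.const_mul c).cexp

theorem hasDerivAt_exp_neg_I_mul (l : ℂ) (s : ℝ) :
    HasDerivAt (fun s : ℝ => Complex.exp (-Complex.I * s * l))
      (-(Complex.I * l) * Complex.exp (-Complex.I * s * l)) s := by
  simpa only [neg_mul, mul_right_comm _ l] using hasDerivAt_exp_mul_ofReal (-(Complex.I * l)) s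

theorem integral_exp_mul_deriv {f f' : ℝ → ℂ} (l : ℂ) (hf : ∀ x, HasDerivAt f (f' x) x)
    (hint : Integrable (fun x : ℝ => Complex.exp (-Complex.I * x * l) * f x))
    (hint' : Integrable (fun x : ℝ => Complex.exp (-Complex.I * x * l) * f' x)) :
    ∫ x : ℝ, Complex.exp (-Complex.I * x * l) * f' x
      = Complex.I * l * ∫ x : ℝ, Complex.exp (-Complex.I * x * l) * f x := by
  rw [integral_mul_deriv_eq_deriv_mul_of_integrable
    (fun x _ => hasDerivAt_exp_neg_I_mul l x) (fun x _ => hf x) hint'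
    ((hint.const_mul (-(Complex.I * l))).congr (.of_forall fun x => (mul_assoc _ _ _).symm)) hint]
  simp only [mul_assoc, neg_mul, integral_neg, integral_const_mul, neg_neg]

theorem setIntegral_Ioi_exp_mul_deriv {f f' : ℝ → ℂ} (l : ℂ)
    (hcont : ContinuousWithinAt f (Ioi 0) 0) (hf : ∀ y ∈ Ioi (0 : ℝ), HasDerivAt f (f' y) y)
    (hint : IntegrableOn (fun y : ℝ => Complex.exp (-Complex.I * y * l) * f y) (Ioi 0))
    (hint' : IntegrableOn (fun y : ℝ => Complex.exp (-Complex.I * y * l) * f' y) (Ioi 0)) :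
    ∫ y in Ioi (0 : ℝ), Complex.exp (-Complex.I * y * l) * f' y
      = -f 0 + Complex.I * l * ∫ y in Ioi (0 : ℝ), Complex.exp (-Complex.I * y * l) * f y := by
  have hint_deriv : IntegrableOn
      (fun y : ℝ => -(Complex.I * l) * Complex.exp (-Complex.I * y * l) * f y) (Ioi 0) :=
    (hint.const_mul (-(Complex.I * l))).congr (.of_forall fun y => (mul_assoc _ _ _).symm)
  have tendsto_zero : Tendsto (fun y : ℝ => Complex.exp (-Complex.I * y * l) * f y)
      (𝓝[>] 0) (𝓝 (f 0)) := by
    simpa [ContinuousWithinAt] using!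
      (hasDerivAt_exp_neg_I_mul l 0).continuousAt.continuousWithinAt.mul hcont
  have tendsto_atTop := tendsto_zero_of_hasDerivAt_of_integrableOn_Ioi
    (fun y hy => (hasDerivAt_exp_neg_I_mul l y).mul (hf y hy)) (hint_deriv.add hint') hint
  rw [integral_Ioi_mul_deriv_eq_deriv_mul (fun y _ => hasDerivAt_exp_neg_I_mul l y) hf hint'
    hint_deriv tendsto_zero tendsto_atTop]
  simp only [mul_assoc, neg_mul, integral_neg, integral_const_mul, zero_sub, sub_neg_eq_add]

namespace IsDecaying

variable {C C' m : ℝ} {w w' : ℝ → ℝ → ℂ}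

theorem halfFourier_dx (hw : IsDecaying C m w) (hw' : IsDecaying C' m w') (hm : 2 < m)
    (hderiv : ∀ x y : ℝ, 0 ≤ y → HasDerivAt (fun s => w s y) (w' x y) x) (κ : ℝ) {l : ℂ}
    (hl : l.im ≤ 0) : halfFourier w' κ l = Complex.I * κ * halfFourier w κ l := by
  rw [hw.halfFourier_eq_integral_fourierX hm κ hl, hw'.halfFourier_eq_integral_fourierX hm κ hl,
    ← integral_const_mul]
  refine setIntegral_congr_fun measurableSet_Ioi fun y hy => ?_
  have fourierX_deriv : fourierX w' κ y = Complex.I * κ * fourierX w κ y :=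
    integral_exp_mul_deriv κ (fun x => hderiv x y (le_of_lt hy))
      (hw.integrable_fst (by linarith) κ (le_of_lt hy))
      (hw'.integrable_fst (by linarith) κ (le_of_lt hy))
  simp only [fourierX_deriv, mul_left_comm]

theorem halfFourier_dy (hw : IsDecaying C m w) (hw' : IsDecaying C' m w') (hm : 2 < m)
    (hderiv : ∀ x y : ℝ, 0 ≤ y → HasDerivWithinAt (fun s => w x s) (w' x y) (Ici 0) y)
    (κ : ℝ) {l : ℂ} (hl : l.im ≤ 0) :
    halfFourier w' κ l = -fourierX w κ 0 + Complex.I * l * halfFourier w κ l := by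
  have slice (v : ℝ → ℝ → ℂ) (x : ℝ) :
      ∫ y in Ioi (0 : ℝ), Complex.exp (-Complex.I * x * κ - Complex.I * y * l) * v x y
        = Complex.exp (-Complex.I * x * κ)
          * ∫ y in Ioi (0 : ℝ), Complex.exp (-Complex.I * y * l) * v x y := by
    simp only [exp_sub_eq_mul, mul_right_comm _ _ (v x _), integral_mul_const,
      mul_comm (Complex.exp (-Complex.I * x * κ))]
  have slice_deriv (x : ℝ) := setIntegral_Ioi_exp_mul_deriv l
    ((hw.continuousOn_snd x 0 self_mem_Ici).mono Ioi_subset_Ici_self)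
    (fun y hy => (hderiv x y (le_of_lt hy)).hasDerivAt (Ici_mem_nhds hy))
    (hw.integrableOn_snd (by linarith) x hl) (hw'.integrableOn_snd (by linarith) x hl)
  have integrable_trace :
      Integrable (fun x : ℝ => -(Complex.exp (-Complex.I * x * κ) * w x 0)) :=
    (hw.integrable_fst (by linarith) κ le_rfl).neg
  have integrable_slice := (hw.integrable_prod hm κ hl).integral_prod_left
  simp only [slice] at integrable_slice
  simp only [halfFourier, fourierX, slice, slice_deriv]
  rw [← integral_const_mul, ← integral_neg,
    ← integral_add integrable_trace (integrable_slice.const_mul _)]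
  congr 1 with x
  ring

end IsDecaying

/-! ### The global relation -/

/-- The boundary values `∂_y^j u(·, 0, ·)`. -/
def trace (u : ℝ → ℝ → ℝ → ℂ) (j : ℕ) : ℝ → ℝ → ℂ := fun x t => dy^[j] u x 0 t

/-- The boundary values that integration by parts leaves behind in the half space Fourier
transform of `Δ²u(·, ·, t)`. -/
def boundaryFlux (u : ℝ → ℝ → ℝ → ℂ) (κ : ℝ) (l : ℂ) (t : ℝ) : ℂ :=
  fourierX (trace u 3) κ t + Complex.I * l * fourierX (trace u 2) κ t
    - (l ^ 2 + 2 * (κ : ℂ) ^ 2)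
      * (fourierX (trace u 1) κ t + Complex.I * l * fourierX (trace u 0) κ t)

/-- The contribution of the boundary values to the global relation: the time transform of
`boundaryFlux`, written in terms of the transforms of the four traces. -/
def boundaryTerm (u : ℝ → ℝ → ℝ → ℂ) (κ : ℝ) (l : ℂ) (t : ℝ) : ℂ :=
  tTransform (trace u 3) κ (symbol κ l) t + Complex.I * l * tTransform (trace u 2) κ (symbol κ l) t
    - (l ^ 2 + 2 * (κ : ℂ) ^ 2) * (tTransform (trace u 1) κ (symbol κ l) t
      + Complex.I * l * tTransform (trace u 0) κ (symbol κ l) t)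

theorem norm_exp_mul_ofReal_le (η : ℂ) {τ t : ℝ} (hτ : 0 ≤ τ) (hτt : τ ≤ t) :
    ‖Complex.exp (η * τ)‖ ≤ Real.exp (‖η‖ * t) := by
  refine (Complex.norm_exp_le_exp_norm _).trans (Real.exp_le_exp.2 ?_)
  rw [norm_mul, Complex.norm_real, Real.norm_of_nonneg hτ]
  exact mul_le_mul_of_nonneg_left hτt (norm_nonneg η)

namespace SmoothDecaying

variable {T m t : ℝ} {u : ℝ → ℝ → ℝ → ℂ}

theorem continuousOn_bilaplacian (hu : SmoothDecaying T m u) :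
    ContinuousOn (fun p : ℝ × ℝ × ℝ => bilaplacian u p.1 p.2.1 p.2.2)
      (univ ×ˢ Ici 0 ×ˢ Icc 0 T) :=
  ((hu.continuousOn 4 0 (by norm_num)).add
    ((hu.continuousOn 2 2 (by norm_num)).const_mul 2)).add (hu.continuousOn 0 4 (by norm_num))

theorem exists_isDecaying_apply (hu : SmoothDecaying T m u) :
    ∃ C : ℝ, ∀ t ∈ Icc 0 T, IsDecaying C m (fun x y => u x y t) :=
  hu.exists_isDecaying.imp fun _ hC => hC 0 0 (by norm_num)

theorem exists_isDecaying_bilaplacian (hu : SmoothDecaying T m u) :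
    ∃ C : ℝ, ∀ t ∈ Icc 0 T, IsDecaying C m (fun x y => bilaplacian u x y t) := by
  obtain ⟨C, hC⟩ := hu.exists_isDecaying
  exact ⟨_, fun t ht => ((hC 4 0 (by norm_num) t ht).add
    ((hC 2 2 (by norm_num) t ht).const_mul 2)).add (hC 0 4 (by norm_num) t ht)⟩

theorem exists_isDecaying_mul_sub_bilaplacian (hu : SmoothDecaying T m u) (η : ℂ) :
    ∃ C : ℝ, ∀ t ∈ Icc 0 T, IsDecaying C m (fun x y => η * u x y t - bilaplacian u x y t) := by
  obtain ⟨C, hC⟩ := hu.exists_isDecaying_apply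
  obtain ⟨C', hC'⟩ := hu.exists_isDecaying_bilaplacian
  refine ⟨‖η‖ * C + ‖(-1 : ℂ)‖ * C', fun t ht => ?_⟩
  simpa [sub_eq_add_neg] using ((hC t ht).const_mul η).add ((hC' t ht).const_mul (-1))

theorem continuousOn_mul_sub_bilaplacian (hu : SmoothDecaying T m u) (η : ℂ) :
    ContinuousOn (fun p : ℝ × ℝ × ℝ => η * u p.1 p.2.1 p.2.2 - bilaplacian u p.1 p.2.1 p.2.2)
      (univ ×ˢ Ici 0 ×ˢ Icc 0 T) :=
  ((hu.continuousOn 0 0 (by norm_num)).const_mul η).sub hu.continuousOn_bilaplacian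

theorem halfFourier_iterate_dx (hu : SmoothDecaying T m u) (hm : 2 < m) (ht : t ∈ Icc 0 T)
    (κ : ℝ) {l : ℂ} (hl : l.im ≤ 0) {i j : ℕ} (hij : i + j ≤ 4) :
    halfFourier (fun x y => dx^[i] (dy^[j] u) x y t) κ l
      = (Complex.I * κ) ^ i * halfFourier (fun x y => dy^[j] u x y t) κ l := by
  obtain ⟨C, hC⟩ := hu.exists_isDecaying
  induction i with
  | zero => simp
  | succ i ih =>
    rw [(hC i j (by omega) t ht).halfFourier_dx (hC (i + 1) j hij t ht) hm
      (fun x y hy => hu.hasDerivAt_dx (by omega) ht x hy) κ hl, ih (by omega), pow_succ']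
    ring

theorem halfFourier_iterate_dy_succ (hu : SmoothDecaying T m u) (hm : 2 < m) (ht : t ∈ Icc 0 T)
    (κ : ℝ) {l : ℂ} (hl : l.im ≤ 0) {j : ℕ} (hj : j < 4) :
    halfFourier (fun x y => dy^[j + 1] u x y t) κ l
      = -fourierX (trace u j) κ t
        + Complex.I * l * halfFourier (fun x y => dy^[j] u x y t) κ l := by
  obtain ⟨C, hC⟩ := hu.exists_isDecaying
  exact (hC 0 j (by omega) t ht).halfFourier_dy (hC 0 (j + 1) (by omega) t ht) hm
    (fun x y hy => hu.hasDerivWithinAt_dy hj ht x hy) κ hl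

theorem halfFourier_bilaplacian (hu : SmoothDecaying T m u) (hm : 2 < m) (ht : t ∈ Icc 0 T)
    (κ : ℝ) {l : ℂ} (hl : l.im ≤ 0) :
    halfFourier (fun x y => bilaplacian u x y t) κ l
      = symbol κ l * halfFourier (fun x y => u x y t) κ l - boundaryFlux u κ l t := by
  obtain ⟨C, hC⟩ := hu.exists_isDecaying
  have decaying40 := hC 4 0 (by norm_num) t ht
  have decaying22 := (hC 2 2 (by norm_num) t ht).const_mul 2
  have decaying04 := hC 0 4 (by norm_num) t ht
  have linearity : halfFourier (fun x y => bilaplacian u x y t) κ l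
      = halfFourier (fun x y => dx^[4] (dy^[0] u) x y t) κ l
        + 2 * halfFourier (fun x y => dx^[2] (dy^[2] u) x y t) κ l
        + halfFourier (fun x y => dy^[4] u x y t) κ l :=
    ((decaying40.add decaying22).halfFourier_add decaying04 hm κ hl).trans <|
      congrArg (· + _) ((decaying40.halfFourier_add decaying22 hm κ hl).trans
        (congrArg (_ + ·) (halfFourier_const_mul _ 2 κ l)))
  have dy_succ {j : ℕ} (hj : j < 4) := hu.halfFourier_iterate_dy_succ hm ht κ hl hj
  rw [linearity, hu.halfFourier_iterate_dx hm ht κ hl (by norm_num),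
    hu.halfFourier_iterate_dx hm ht κ hl (by norm_num), dy_succ (j := 3) (by norm_num),
    dy_succ (j := 2) (by norm_num), dy_succ (j := 1) (by norm_num), dy_succ (j := 0) (by norm_num),
    boundaryFlux]
  simp only [Function.iterate_zero, id_eq]
  ring_nf
  simp only [Complex.I_sq, Complex.I_pow_three, Complex.I_pow_four]
  ring

theorem halfFourier_mul_sub_bilaplacian (hu : SmoothDecaying T m u) (hm : 2 < m)
    (ht : t ∈ Icc 0 T) (κ : ℝ) {l : ℂ} (hl : l.im ≤ 0) :
    halfFourier (fun x y => symbol κ l * u x y t - bilaplacian u x y t) κ l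
      = boundaryFlux u κ l t := by
  obtain ⟨C, hC⟩ := hu.exists_isDecaying_apply
  obtain ⟨C', hC'⟩ := hu.exists_isDecaying_bilaplacian
  have linearity := ((hC t ht).const_mul (symbol κ l)).halfFourier_add
    ((hC' t ht).const_mul (-1)) hm κ hl
  rw [halfFourier_const_mul, halfFourier_const_mul, hu.halfFourier_bilaplacian hm ht κ hl]
    at linearity
  simpa only [neg_one_mul, ← sub_eq_add_neg, sub_sub_cancel] using linearity

theorem continuousOn_trace (hu : SmoothDecaying T m u) {j : ℕ} (hj : j ≤ 4) :
    ContinuousOn (fun q : ℝ × ℝ => trace u j q.1 q.2) (univ ×ˢ Icc 0 T) :=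
  (hu.continuousOn 0 j (by omega)).comp (f := fun q : ℝ × ℝ => (q.1, 0, q.2)) (by fun_prop)
    fun _ hq => ⟨mem_univ _, self_mem_Ici, hq.2⟩

theorem continuousOn_fourierX_trace (hu : SmoothDecaying T m u) (hm : 1 < m) {j : ℕ}
    (hj : j ≤ 4) (κ : ℝ) : ContinuousOn (fourierX (trace u j) κ) (Icc 0 T) := by
  obtain ⟨C, hC⟩ := hu.exists_isDecaying
  have decaying {t : ℝ} (ht : t ∈ Icc 0 T) := hC 0 j (by omega) t ht
  refine continuousOn_of_dominated (bound := fun x => C * (1 + |x|) ^ (-m))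
    (fun t ht => ((decaying ht).integrable_fst hm κ le_rfl).aestronglyMeasurable)
    (fun t ht => Eventually.of_forall fun x => ?_)
    ((integrable_one_add_abs_rpow_neg hm).const_mul C) (Eventually.of_forall fun x => ?_)
  · rw [norm_mul, norm_exp_neg_I_mul, one_mul]
    exact (decaying ht).norm_le_fst (by linarith) x le_rfl
  · exact continuousOn_const.mul <| (hu.continuousOn_trace hj).comp
      (f := fun τ : ℝ => (x, τ)) (by fun_prop) fun τ hτ => ⟨mem_univ _, hτ⟩

theorem exists_norm_fourierX_trace_le (hu : SmoothDecaying T m u) (hm : 1 < m) :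
    ∃ M : ℝ, ∀ j ≤ 4, ∀ κ : ℝ, ∀ t ∈ Icc 0 T, ‖fourierX (trace u j) κ t‖ ≤ M := by
  obtain ⟨C, hC⟩ := hu.exists_isDecaying
  refine ⟨∫ x : ℝ, C * (1 + |x|) ^ (-m), fun j hj κ t ht => norm_integral_le_of_norm_le
    ((integrable_one_add_abs_rpow_neg hm).const_mul C) (Eventually.of_forall fun x => ?_)⟩
  rw [norm_mul, norm_exp_neg_I_mul, one_mul]
  exact (hC 0 j (by omega) t ht).norm_le_fst (by linarith) x le_rfl

theorem intervalIntegrable_exp_mul_fourierX_trace (hu : SmoothDecaying T m u) (hm : 1 < m)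
    {j : ℕ} (hj : j ≤ 4) (κ : ℝ) (η : ℂ) (ht : t ∈ Icc 0 T) :
    IntervalIntegrable (fun τ : ℝ => Complex.exp (η * τ) * fourierX (trace u j) κ τ)
      volume 0 t := by
  apply ContinuousOn.intervalIntegrable
  rw [uIcc_of_le ht.1]
  exact ContinuousOn.mul (by fun_prop)
    ((hu.continuousOn_fourierX_trace hm hj κ).mono (Icc_subset_Icc_right ht.2))

theorem boundaryTerm_eq_integral_boundaryFlux (hu : SmoothDecaying T m u) (hm : 1 < m)
    (ht : t ∈ Icc 0 T) (κ : ℝ) (l : ℂ) :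
    boundaryTerm u κ l t
      = ∫ τ in (0 : ℝ)..t, Complex.exp (symbol κ l * τ) * boundaryFlux u κ l τ := by
  have integrable {j : ℕ} (hj : j ≤ 4) :=
    hu.intervalIntegrable_exp_mul_fourierX_trace hm hj κ (symbol κ l) ht
  have integrable32 := (integrable (j := 3) (by norm_num)).add
    ((integrable (j := 2) (by norm_num)).const_mul (Complex.I * l))
  have integrable10 := (integrable (j := 1) (by norm_num)).add
    ((integrable (j := 0) (by norm_num)).const_mul (Complex.I * l))
  unfold boundaryTerm tTransform boundaryFlux
  rw [← intervalIntegral.integral_const_mul, ← intervalIntegral.integral_const_mul,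
    ← intervalIntegral.integral_add (integrable (by norm_num))
      ((integrable (by norm_num)).const_mul _),
    ← intervalIntegral.integral_add (integrable (by norm_num))
      ((integrable (by norm_num)).const_mul _),
    ← intervalIntegral.integral_const_mul,
    ← intervalIntegral.integral_sub integrable32 (integrable10.const_mul _)]
  congr 1 with τ
  ring

theorem exp_mul_sub_eq_integral {u₀ g₀ g₁ : ℝ → ℝ → ℂ} (hu : SmoothDecaying T m u)
    (hs : SolvesIBVP T u u₀ g₀ g₁) (η : ℂ) (x : ℝ) {y : ℝ} (hy : 0 < y) (ht : t ∈ Ioo 0 T) :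
    Complex.exp (η * t) * u x y t - u x y 0
      = ∫ τ in (0 : ℝ)..t, Complex.exp (η * τ) * (η * u x y τ - bilaplacian u x y τ) := by
  have mapsTo : MapsTo (fun τ : ℝ => (x, y, τ)) (Icc 0 t) (univ ×ˢ Ici 0 ×ˢ Icc 0 T) :=
    fun τ hτ => ⟨mem_univ _, hy.le, hτ.1, hτ.2.trans ht.2.le⟩
  have continuousOn_u : ContinuousOn (fun τ => u x y τ) (Icc 0 t) :=
    (hu.continuousOn 0 0 (by norm_num)).comp (by fun_prop) mapsTo
  have continuousOn_rate : ContinuousOn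
      (fun τ : ℝ => Complex.exp (η * τ) * (η * u x y τ - bilaplacian u x y τ)) (Icc 0 t) :=
    ContinuousOn.mul (by fun_prop) <| (hu.continuousOn_mul_sub_bilaplacian η).comp
      (f := fun τ : ℝ => (x, y, τ)) (by fun_prop) mapsTo
  have hasDerivAt_exp_mul (τ : ℝ) (hτ : τ ∈ Ioo 0 t) :
      HasDerivAt (fun τ : ℝ => Complex.exp (η * τ) * u x y τ)
        (Complex.exp (η * τ) * (η * u x y τ - bilaplacian u x y τ)) τ := by
    convert! (hasDerivAt_exp_mul_ofReal η τ).mul (hs.pde x y hy τ ⟨hτ.1, hτ.2.trans ht.2⟩) using 1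
    ring
  rw [intervalIntegral.integral_eq_sub_of_hasDerivAt_of_le ht.1.le
    (ContinuousOn.mul (by fun_prop) continuousOn_u) hasDerivAt_exp_mul
    (continuousOn_rate.intervalIntegrable_of_Icc ht.1.le)]
  simp

theorem integrable_halfPlane_prod_time (hu : SmoothDecaying T m u) (hm : 2 < m)
    (ht : t ∈ Icc 0 T) (η : ℂ) (κ : ℝ) {l : ℂ} (hl : l.im ≤ 0) :
    Integrable (Function.uncurry fun (q : ℝ × ℝ) (τ : ℝ) =>
      Complex.exp (-Complex.I * q.1 * κ - Complex.I * q.2 * l) *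
        (Complex.exp (η * τ) * (η * u q.1 q.2 τ - bilaplacian u q.1 q.2 τ)))
      ((volume.restrict (univ ×ˢ Ioi 0)).prod (volume.restrict (Ioc 0 t))) := by
  obtain ⟨C, hC⟩ := hu.exists_isDecaying_mul_sub_bilaplacian η
  have measurableSet_domain : MeasurableSet (((univ : Set ℝ) ×ˢ Ioi (0 : ℝ)) ×ˢ Ioc 0 t) :=
    (MeasurableSet.univ.prod measurableSet_Ioi).prod measurableSet_Ioc
  have mapsTo : MapsTo (fun z : (ℝ × ℝ) × ℝ => (z.1.1, z.1.2, z.2))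
      (((univ : Set ℝ) ×ˢ Ioi (0 : ℝ)) ×ˢ Ioc 0 t) (univ ×ˢ Ici 0 ×ˢ Icc 0 T) :=
    fun z hz => ⟨mem_univ _, Ioi_subset_Ici_self hz.1.2, hz.2.1.le, hz.2.2.trans ht.2⟩
  refine (Integrable.mul_prod (f := fun q : ℝ × ℝ => C * (1 + |q.1| + |q.2|) ^ (-m))
    (g := fun _ : ℝ => Real.exp (‖η‖ * t))
    ((integrable_one_add_abs_add_abs_rpow_neg hm).const_mul C).integrableOn
    (integrable_const _)).mono' ?_ ?_
  · rw [Measure.prod_restrict]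
    have continuousOn_rate := (hu.continuousOn_mul_sub_bilaplacian η).comp
      (f := fun z : (ℝ × ℝ) × ℝ => (z.1.1, z.1.2, z.2)) (by fun_prop) mapsTo
    exact ContinuousOn.aestronglyMeasurable
      (ContinuousOn.mul (by fun_prop) (ContinuousOn.mul (by fun_prop) continuousOn_rate))
      measurableSet_domain
  · rw [Measure.prod_restrict]
    filter_upwards [ae_restrict_mem measurableSet_domain] with ⟨⟨x, y⟩, τ⟩ ⟨⟨_, hy⟩, hτ⟩
    rw [Function.uncurry_apply_pair, mul_left_comm, norm_mul, mul_comm]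
    have rate_decaying := hC τ ⟨hτ.1.le, hτ.2.trans ht.2⟩
    exact mul_le_mul (rate_decaying.norm_exp_mul_le κ x (le_of_lt hy) hl)
      (norm_exp_mul_ofReal_le η hτ.1.le hτ.2) (norm_nonneg _)
      (mul_nonneg rate_decaying.nonneg (by positivity))

theorem exp_mul_halfFourier_sub_eq_integral {u₀ g₀ g₁ : ℝ → ℝ → ℂ} (hu : SmoothDecaying T m u)
    (hm : 2 < m) (hs : SolvesIBVP T u u₀ g₀ g₁) (ht : t ∈ Ioo 0 T) (η : ℂ) (κ : ℝ) {l : ℂ}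
    (hl : l.im ≤ 0) :
    Complex.exp (η * t) * halfFourier (fun x y => u x y t) κ l
        - halfFourier (fun x y => u x y 0) κ l
      = ∫ τ in (0 : ℝ)..t, Complex.exp (η * τ)
          * halfFourier (fun x y => η * u x y τ - bilaplacian u x y τ) κ l := by
  obtain ⟨C, hC⟩ := hu.exists_isDecaying_apply
  obtain ⟨C', hC'⟩ := hu.exists_isDecaying_mul_sub_bilaplacian η
  have ht' : t ∈ Icc 0 T := Ioo_subset_Icc_self ht
  have decaying_t := hC t ht'
  have decaying_zero := hC 0 ⟨le_rfl, ht'.1.trans ht'.2⟩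
  calc Complex.exp (η * t) * halfFourier (fun x y => u x y t) κ l
        - halfFourier (fun x y => u x y 0) κ l
      = ∫ q in (univ : Set ℝ) ×ˢ Ioi (0 : ℝ),
          Complex.exp (-Complex.I * q.1 * κ - Complex.I * q.2 * l)
            * (Complex.exp (η * t) * u q.1 q.2 t - u q.1 q.2 0) := by
        rw [decaying_t.halfFourier_eq_setIntegral hm κ hl,
          decaying_zero.halfFourier_eq_setIntegral hm κ hl, ← integral_const_mul, ← integral_sub
            ((decaying_t.integrableOn_halfPlane hm κ hl).const_mul _)
            (decaying_zero.integrableOn_halfPlane hm κ hl)]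
        simp only [mul_sub, mul_left_comm (Complex.exp (η * t))]
    _ = ∫ q in (univ : Set ℝ) ×ˢ Ioi (0 : ℝ), ∫ τ in Ioc 0 t,
          Complex.exp (-Complex.I * q.1 * κ - Complex.I * q.2 * l)
            * (Complex.exp (η * τ) * (η * u q.1 q.2 τ - bilaplacian u q.1 q.2 τ)) := by
        refine setIntegral_congr_fun (MeasurableSet.univ.prod measurableSet_Ioi) fun q hq => ?_
        simp only [hu.exp_mul_sub_eq_integral hs η q.1 hq.2 ht, integral_const_mul,
          intervalIntegral.integral_of_le ht.1.le]
    _ = _ := by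
        rw [integral_integral_swap (hu.integrable_halfPlane_prod_time hm ht' η κ hl),
          intervalIntegral.integral_of_le ht.1.le]
        refine setIntegral_congr_fun measurableSet_Ioc fun τ hτ => ?_
        simp only [mul_left_comm _ (Complex.exp (η * τ)), integral_const_mul,
          (hC' τ ⟨hτ.1.le, hτ.2.trans ht.2.le⟩).halfFourier_eq_setIntegral hm κ hl]

theorem global_relation {u₀ g₀ g₁ : ℝ → ℝ → ℂ} (hu : SmoothDecaying T m u) (hm : 2 < m)
    (hs : SolvesIBVP T u u₀ g₀ g₁) (ht : t ∈ Ioo 0 T) (κ : ℝ) {l : ℂ} (hl : l.im ≤ 0) :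
    Complex.exp (symbol κ l * t) * halfFourier (fun x y => u x y t) κ l
      = halfFourier (fun x y => u x y 0) κ l + boundaryTerm u κ l t := by
  rw [← sub_eq_iff_eq_add', hu.exp_mul_halfFourier_sub_eq_integral hm hs ht _ κ hl,
    hu.boundaryTerm_eq_integral_boundaryFlux (by linarith) (Ioo_subset_Icc_self ht)]
  refine intervalIntegral.integral_congr fun τ hτ => ?_
  rw [uIcc_of_le ht.1.le] at hτ
  simp only [hu.halfFourier_mul_sub_bilaplacian hm ⟨hτ.1, hτ.2.trans ht.2.le⟩ κ hl]

end SmoothDecaying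

/-! ### Contour deformation -/

theorem one_add_pow_le_exp {c r : ℝ} (hc : 0 < c) (hr : 0 ≤ r) (n : ℕ) :
    (1 + r) ^ n ≤ n.factorial / c ^ n * Real.exp c * Real.exp (c * r) := by
  have exp_ge := Real.pow_div_factorial_le_exp (c * (1 + r)) (by positivity) n
  rw [mul_pow, mul_one_add, Real.exp_add, div_le_iff₀ (by positivity)] at exp_ge
  rw [div_mul_eq_mul_div, div_mul_eq_mul_div, le_div_iff₀ (by positivity)]
  linarith

/-- The majorant, up to a constant, of the integrands of the contour integrals: `|e^{ily}|` times
the largest power of `l` and `κ` that occurs. -/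
def weight (y κ : ℝ) (l : ℂ) : ℝ := (1 + ‖l‖ + |κ|) ^ 4 * Real.exp (-(y * l.im))

theorem weight_pos (y κ : ℝ) (l : ℂ) : 0 < weight y κ l := by
  unfold weight
  positivity

theorem nonneg_of_norm_le_mul_weight {K y κ : ℝ} {l z : ℂ} (h : ‖z‖ ≤ K * weight y κ l) :
    0 ≤ K :=
  nonneg_of_mul_nonneg_left ((norm_nonneg z).trans h) (weight_pos y κ l)

theorem exists_weight_le_exp {y : ℝ} (hy : 0 < y) :
    ∃ C : ℝ, 0 ≤ C ∧ ∀ κ r : ℝ, 0 ≤ r → ∀ l ∈ arcStrip κ r,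
      weight y κ l ≤ C * Real.exp (-(y / 20 * (|κ| + r))) := by
  refine ⟨Nat.factorial 4 / (y / 100) ^ 4 * Real.exp (y / 100), by positivity,
    fun κ r hr l ⟨re_le, le_im, im_le⟩ => ?_⟩
  have norm_le : ‖l‖ ≤ |κ| + 4 * r := by
    refine (Complex.norm_le_abs_re_add_abs_im l).trans ?_
    rw [abs_of_nonneg (le_trans (by positivity) le_im)]
    linarith
  have base_le : 1 + ‖l‖ + |κ| ≤ 1 + 5 * (|κ| + r) := by linarith [abs_nonneg κ]
  have poly_le := one_add_pow_le_exp (c := y / 100) (r := 5 * (|κ| + r)) (by positivity)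
    (by positivity) 4
  calc weight y κ l
      ≤ (1 + 5 * (|κ| + r)) ^ 4 * Real.exp (-(y * ((|κ| + r) / 10))) := by
        unfold weight
        gcongr
    _ ≤ Nat.factorial 4 / (y / 100) ^ 4 * Real.exp (y / 100)
          * Real.exp (y / 100 * (5 * (|κ| + r))) * Real.exp (-(y * ((|κ| + r) / 10))) := by
        gcongr
    _ = Nat.factorial 4 / (y / 100) ^ 4 * Real.exp (y / 100)
          * Real.exp (-(y / 20 * (|κ| + r))) := by
        rw [mul_assoc _ (Real.exp (y / 100 * (5 * (|κ| + r)))), ← Real.exp_add]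
        ring_nf

theorem exists_norm_le_exp_of_norm_le_weight {y : ℝ} (hy : 0 < y) (K κ : ℝ) :
    ∃ C : ℝ, ∀ r, 0 ≤ r → ∀ l ∈ arcStrip κ r, ∀ z : ℂ, ‖z‖ ≤ K * weight y κ l →
      ‖z‖ ≤ C * Real.exp (-(y / 20 * r)) := by
  obtain ⟨C, hC, weight_le⟩ := exists_weight_le_exp hy
  refine ⟨K * C, fun r hr l hl z hz => hz.trans ?_⟩
  have hK := nonneg_of_norm_le_mul_weight hz
  rw [mul_assoc]
  refine mul_le_mul_of_nonneg_left ((weight_le κ r hr l hl).trans ?_) hK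
  gcongr
  linarith [abs_nonneg κ]

theorem tendsto_exp_neg_mul_mul_atTop {d : ℝ} (hd : 0 < d) (K c : ℝ) :
    Tendsto (fun r : ℝ => K * Real.exp (-(d * r)) * (c * r)) atTop (𝓝 0) := by
  have pow_mul_exp := ((Real.tendsto_pow_mul_exp_neg_atTop_nhds_zero 1).comp
    (tendsto_id.const_mul_atTop hd)).const_mul (K * c / d)
  rw [mul_zero] at pow_mul_exp
  refine pow_mul_exp.congr fun r => ?_
  simp only [Function.comp_apply, id_eq, pow_one]
  field_simp

section Curves

variable {γ₁ γ₂ : ℝ → ℂ} {F Φ : ℂ → ℂ}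

theorem norm_primitive_sub_le {a b : ℂ} {B : ℝ}
    (hΦ : ∀ z ∈ segment ℝ a b, HasDerivAt Φ (F z) z) (hB : ∀ z ∈ segment ℝ a b, ‖F z‖ ≤ B) :
    ‖Φ b - Φ a‖ ≤ B * ‖b - a‖ :=
  (convex_segment a b).norm_image_sub_le_of_norm_hasDerivWithin_le
    (fun z hz => (hΦ z hz).hasDerivWithinAt) hB (left_mem_segment ℝ a b) (right_mem_segment ℝ a b)

theorem integral_mul_deriv_sub_integral_mul_deriv
    (hγ₁ : ∀ r > 0, DifferentiableAt ℝ γ₁ r) (hγ₂ : ∀ r > 0, DifferentiableAt ℝ γ₂ r)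
    (hΦ₁ : ∀ r > 0, HasDerivAt Φ (F (γ₁ r)) (γ₁ r)) (hΦ₂ : ∀ r > 0, HasDerivAt Φ (F (γ₂ r)) (γ₂ r))
    (hF₁ : IntegrableOn (fun r => F (γ₁ r) * deriv γ₁ r) (Ioi 0))
    (hF₂ : IntegrableOn (fun r => F (γ₂ r) * deriv γ₂ r) (Ioi 0))
    (gap_zero : ContinuousWithinAt (fun r => Φ (γ₂ r) - Φ (γ₁ r)) (Ici 0) 0)
    (gap_atTop : Tendsto (fun r => Φ (γ₂ r) - Φ (γ₁ r)) atTop (𝓝 0)) :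
    (∫ r in Ioi 0, F (γ₂ r) * deriv γ₂ r) - ∫ r in Ioi 0, F (γ₁ r) * deriv γ₁ r
      = Φ (γ₁ 0) - Φ (γ₂ 0) := by
  have hasDerivAt_gap : ∀ r ∈ Ioi (0 : ℝ), HasDerivAt (fun r => Φ (γ₂ r) - Φ (γ₁ r))
      (F (γ₂ r) * deriv γ₂ r - F (γ₁ r) * deriv γ₁ r) r := fun r hr =>
    ((hΦ₂ r hr).comp_of_eq r (hγ₂ r hr).hasDerivAt rfl).sub
      ((hΦ₁ r hr).comp_of_eq r (hγ₁ r hr).hasDerivAt rfl)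
  rw [← integral_sub hF₂ hF₁,
    integral_Ioi_of_hasDerivAt_of_tendsto gap_zero hasDerivAt_gap (hF₂.sub hF₁) gap_atTop]
  ring

end Curves

/-- Absolute convergence of the integral of `F` along one arc. -/
def ArcIntegrable (κ σ τ : ℝ) (F : ℂ → ℂ) : Prop :=
  IntegrableOn (fun a => F (arc κ σ τ a) * deriv (arc κ σ τ) a) (Ioi 0)

section Arcs

variable {κ σ τ σ₁ τ₁ σ₂ τ₂ y K : ℝ} {F : ℂ → ℂ}

theorem arc_zero (κ σ τ : ℝ) : arc κ σ τ 0 = ⟨0, |κ|⟩ := by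
  simp [arc, Real.sqrt_sq_eq_abs]

theorem differentiableAt_arc (κ σ τ : ℝ) {r : ℝ} (hr : 0 < r) :
    DifferentiableAt ℝ (arc κ σ τ) r :=
  (hasDerivAt_arc κ σ τ hr.ne').differentiableAt

theorem norm_arc_sub_arc_le (κ : ℝ) (hσ₁ : |σ₁| = 1) (hτ₁ : |τ₁| = 1) (hσ₂ : |σ₂| = 1)
    (hτ₂ : |τ₂| = 1) {r : ℝ} (hr : 0 ≤ r) : ‖arc κ σ₂ τ₂ r - arc κ σ₁ τ₁ r‖ ≤ 4 * r := by
  have abs_sub_mul_le {a b : ℝ} (ha : |a| = 1) (hb : |b| = 1) : |(a - b) * r| ≤ 2 * r := by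
    rw [abs_mul, abs_of_nonneg hr]
    gcongr
    linarith [abs_sub a b]
  have hre : (arc κ σ₂ τ₂ r - arc κ σ₁ τ₁ r).re = (σ₂ - σ₁) * r := by
    rw [Complex.sub_re, arc_re, arc_re]
    ring
  have him : (arc κ σ₂ τ₂ r - arc κ σ₁ τ₁ r).im = (τ₂ - τ₁) * r := by
    rw [Complex.sub_im, arc_im, arc_im]
    ring
  refine (Complex.norm_le_abs_re_add_abs_im _).trans ?_
  rw [hre, him]
  linarith [abs_sub_mul_le hσ₂ hσ₁, abs_sub_mul_le hτ₂ hτ₁]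

theorem arcIntegrable_of_norm_le_weight (hσ : |σ| = 1) (hτ : |τ| = 1) (hy : 0 < y)
    (hF : ContinuousOn (fun a => F (arc κ σ τ a)) (Ioi 0))
    (hb : ∀ r > 0, ‖F (arc κ σ τ r)‖ ≤ K * weight y κ (arc κ σ τ r)) :
    ArcIntegrable κ σ τ F := by
  obtain ⟨C, norm_le⟩ := exists_norm_le_exp_of_norm_le_weight hy K κ
  have majorant : IntegrableOn (fun r : ℝ => C * Real.exp (-(y / 20) * r) * 4) (Ioi 0) :=
    ((exp_neg_integrableOn_Ioi 0 (by positivity)).const_mul C).mul_const 4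
  refine majorant.mono' ((hF.aestronglyMeasurable measurableSet_Ioi).mul
    (measurable_deriv _).aestronglyMeasurable) ?_
  filter_upwards [ae_restrict_mem measurableSet_Ioi] with r hr
  have norm_F_le :=
    norm_le r (le_of_lt hr) _ (arc_mem_arcStrip κ hσ hτ.le (le_of_lt hr)) _ (hb r hr)
  rw [norm_mul, neg_mul]
  exact mul_le_mul norm_F_le (norm_deriv_arc_le κ hσ.le hτ.le hr) (norm_nonneg _)
    ((norm_nonneg _).trans norm_F_le)

theorem exists_norm_primitive_arc_sub_le (hσ₁ : |σ₁| = 1) (hτ₁ : |τ₁| = 1) (hσ₂ : |σ₂| = 1)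
    (hτ₂ : |τ₂| = 1) (hy : 0 < y) {Φ : ℂ → ℂ}
    (hΦ : ∀ r > 0, ∀ l ∈ segment ℝ (arc κ σ₁ τ₁ r) (arc κ σ₂ τ₂ r), HasDerivAt Φ (F l) l)
    (hb : ∀ r > 0, ∀ l ∈ segment ℝ (arc κ σ₁ τ₁ r) (arc κ σ₂ τ₂ r), ‖F l‖ ≤ K * weight y κ l) :
    ∃ C : ℝ, ∀ r > 0, ‖Φ (arc κ σ₂ τ₂ r) - Φ (arc κ σ₁ τ₁ r)‖
      ≤ C * Real.exp (-(y / 20 * r)) * (4 * r) := by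
  obtain ⟨C, norm_le⟩ := exists_norm_le_exp_of_norm_le_weight hy K κ
  refine ⟨C, fun r hr => ?_⟩
  have norm_F_le : ∀ l ∈ segment ℝ (arc κ σ₁ τ₁ r) (arc κ σ₂ τ₂ r),
      ‖F l‖ ≤ C * Real.exp (-(y / 20 * r)) := fun l hl =>
    norm_le r hr.le l ((convex_arcStrip κ r).segment_subset (arc_mem_arcStrip κ hσ₁ hτ₁.le hr.le)
      (arc_mem_arcStrip κ hσ₂ hτ₂.le hr.le) hl) _ (hb r hr l hl)
  refine (norm_primitive_sub_le (hΦ r hr) norm_F_le).trans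
    (mul_le_mul_of_nonneg_left (norm_arc_sub_arc_le κ hσ₁ hτ₁ hσ₂ hτ₂ hr.le) ?_)
  exact (norm_nonneg _).trans (norm_F_le _ (left_mem_segment ℝ _ _))

theorem arcIntegral_eq_of_convex (hσ₁ : |σ₁| = 1) (hτ₁ : |τ₁| = 1) (hσ₂ : |σ₂| = 1)
    (hτ₂ : |τ₂| = 1) (hy : 0 < y) {V : Set ℂ} (hVo : IsOpen V) (hVc : Convex ℝ V)
    (hF : DifferentiableOn ℂ F V) (h₁ : ∀ r > 0, arc κ σ₁ τ₁ r ∈ V)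
    (h₂ : ∀ r > 0, arc κ σ₂ τ₂ r ∈ V)
    (hb : ∀ r > 0, ∀ l ∈ segment ℝ (arc κ σ₁ τ₁ r) (arc κ σ₂ τ₂ r), ‖F l‖ ≤ K * weight y κ l) :
    arcIntegral κ σ₁ τ₁ F = arcIntegral κ σ₂ τ₂ F := by
  obtain ⟨Φ, hΦ⟩ := hVc.exists_forall_hasDerivWithinAt hF
  replace hΦ : ∀ z ∈ V, HasDerivAt Φ (F z) z := fun z hz => (hΦ z hz).hasDerivAt (hVo.mem_nhds hz)
  have integrable {σ τ : ℝ} (hσ : |σ| = 1) (hτ : |τ| = 1) (h : ∀ r > 0, arc κ σ τ r ∈ V)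
      (hb : ∀ r > 0, ‖F (arc κ σ τ r)‖ ≤ K * weight y κ (arc κ σ τ r)) : ArcIntegrable κ σ τ F :=
    arcIntegrable_of_norm_le_weight hσ hτ hy
      (hF.continuousOn.comp (continuous_arc κ σ τ).continuousOn h) hb
  obtain ⟨C, norm_gap_le⟩ := exists_norm_primitive_arc_sub_le hσ₁ hτ₁ hσ₂ hτ₂ hy
    (fun r hr l hl => hΦ l (hVc.segment_subset (h₁ r hr) (h₂ r hr) hl)) hb
  have gap_zero :
      ContinuousWithinAt (fun r => Φ (arc κ σ₂ τ₂ r) - Φ (arc κ σ₁ τ₁ r)) (Ici 0) 0 := by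
    rw [← continuousWithinAt_Ioi_iff_Ici, ContinuousWithinAt, arc_zero, arc_zero, sub_self]
    have majorant : Continuous (fun r : ℝ => C * Real.exp (-(y / 20 * r)) * (4 * r)) := by fun_prop
    refine squeeze_zero_norm' (eventually_nhdsWithin_of_forall norm_gap_le) ?_
    simpa using (majorant.tendsto 0).mono_left nhdsWithin_le_nhds
  have gap_atTop := squeeze_zero_norm' ((eventually_gt_atTop 0).mono norm_gap_le)
    (tendsto_exp_neg_mul_mul_atTop (by positivity) C 4)
  have sub_eq := integral_mul_deriv_sub_integral_mul_deriv
    (fun r => differentiableAt_arc κ σ₁ τ₁) (fun r => differentiableAt_arc κ σ₂ τ₂)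
    (fun r hr => hΦ _ (h₁ r hr)) (fun r hr => hΦ _ (h₂ r hr))
    (integrable hσ₁ hτ₁ h₁ fun r hr => hb r hr _ (left_mem_segment ℝ _ _))
    (integrable hσ₂ hτ₂ h₂ fun r hr => hb r hr _ (right_mem_segment ℝ _ _)) gap_zero gap_atTop
  rw [arc_zero, arc_zero, sub_self] at sub_eq
  exact (sub_eq_zero.1 sub_eq).symm

theorem arcIntegral_component_eq (hσ : σ ∈ ({1, -1} : Set ℝ)) (hy : 0 < y)
    (hF : DifferentiableOn ℂ F {l | 0 < σ * l.re ∧ 0 < l.im})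
    (hb : ∀ l : ℂ, 0 < σ * l.re → 0 < l.im → ‖F l‖ ≤ K * weight y κ l) :
    arcIntegral κ σ 1 F = arcIntegral κ σ (-1) F := by
  have arc_mem {τ : ℝ} (hτ : |τ| ≤ 1) (r : ℝ) (hr : 0 < r) :
      arc κ σ τ r ∈ {l : ℂ | 0 < σ * l.re ∧ 0 < l.im} := by
    refine ⟨?_, arc_im_pos κ σ hτ hr⟩
    rcases hσ with rfl | rfl <;> simpa using hr
  have isOpen_quadrant : IsOpen {l : ℂ | 0 < σ * l.re ∧ 0 < l.im} :=
    (isOpen_lt continuous_const (continuous_const.mul Complex.continuous_re)).inter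
      (isOpen_lt continuous_const Complex.continuous_im)
  have convex_quadrant : Convex ℝ {l : ℂ | 0 < σ * l.re ∧ 0 < l.im} := by
    have convex_halfPlane : Convex ℝ {l : ℂ | 0 < σ * l.re} := by
      rcases hσ with rfl | rfl
      · simpa using convex_halfSpace_re_gt 0
      · simpa using convex_halfSpace_re_lt 0
    exact convex_halfPlane.inter (convex_halfSpace_im_gt 0)
  have hσ' := abs_eq_one_of_mem hσ
  refine arcIntegral_eq_of_convex (K := K) hσ' (by simp) hσ' (by simp) hy isOpen_quadrant
    convex_quadrant hF (arc_mem (by simp)) (arc_mem (by simp)) fun r hr l hl => ?_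
  obtain ⟨hre, him⟩ :=
    convex_quadrant.segment_subset (arc_mem (by simp) r hr) (arc_mem (by simp) r hr) hl
  exact hb l hre him

theorem arcIntegral_upper_eq (hy : 0 < y) (hF : Differentiable ℂ F)
    (hb : ∀ l : ℂ, 0 ≤ l.im → 0 ≤ (symbol κ l).re → ‖F l‖ ≤ K * weight y κ l) :
    arcIntegral κ 1 1 F = arcIntegral κ (-1) 1 F := by
  refine arcIntegral_eq_of_convex (K := K) (by simp) (by simp) (by simp) (by simp) hy isOpen_univ
    convex_univ hF.differentiableOn (fun _ _ => mem_univ _) (fun _ _ => mem_univ _)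
    fun r hr l hl => ?_
  have hre : |l.re| ≤ r := ((convex_arcStrip κ r).segment_subset
    (arc_mem_arcStrip κ (by simp) (by simp) hr.le)
    (arc_mem_arcStrip κ (by simp) (by simp) hr.le) hl).1
  have him : l.im = Real.sqrt (κ ^ 2 + 2 * r ^ 2) + r := by
    obtain ⟨a, b, _, _, hab, rfl⟩ := hl
    simp only [Complex.add_im, Complex.real_smul, Complex.im_ofReal_mul, arc_im]
    linear_combination (Real.sqrt (κ ^ 2 + 2 * r ^ 2) + r) * hab
  have sqrt_le : Real.sqrt (κ ^ 2 + 2 * l.re ^ 2) ≤ Real.sqrt (κ ^ 2 + 2 * r ^ 2) := by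
    have re_sq_le : l.re ^ 2 ≤ r ^ 2 := sq_le_sq.2 (by rwa [abs_of_pos hr])
    gcongr
  have im_nonneg : 0 ≤ l.im := him ▸ by positivity
  exact hb l im_nonneg (symbol_re_nonneg im_nonneg (le_abs.2 (Or.inl (by linarith))))

end Arcs

/-! ### From the real line to the boundary of `D_κ⁺` -/

theorem integrable_exp_neg_mul_abs {c : ℝ} (hc : 0 < c) :
    Integrable (fun x : ℝ => Real.exp (-(c * |x|))) := by
  have right : IntegrableOn (fun x : ℝ => Real.exp (-(c * |x|))) (Ioi 0) :=
    (exp_neg_integrableOn_Ioi 0 hc).congr_fun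
      (fun x hx => by simp only [abs_of_pos (mem_Ioi.1 hx), neg_mul]) measurableSet_Ioi
  have left : IntegrableOn (fun x : ℝ => Real.exp (-(c * |x|))) (Iic 0) :=
    (integrableOn_exp_mul_Iic hc 0).congr_fun
      (fun x hx => by rw [abs_of_nonpos hx, mul_neg, neg_neg]) measurableSet_Iic
  rw [← integrableOn_univ, ← Iic_union_Ioi (a := (0 : ℝ))]
  exact left.union right

/-- The closed region between the real line and the two lower arcs of the boundary of `D_κ⁺`. -/
def belowArcs (κ : ℝ) : Set ℂ :=
  {l | 0 ≤ l.im ∧ l.im ≤ Real.sqrt (κ ^ 2 + 2 * l.re ^ 2) - |l.re|}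

/-- The Gaussian regularisation of `F`, which decays along the real directions. -/
def gaussianMul (ε : ℝ) (F : ℂ → ℂ) (l : ℂ) : ℂ := Complex.exp (-(ε : ℂ) * l ^ 2) * F l

section BelowArcs

variable {κ σ y K ε : ℝ} {F : ℂ → ℂ}

theorem symbol_re_nonneg_of_mem_belowArcs {l : ℂ} (hl : l ∈ belowArcs κ) :
    0 ≤ (symbol κ l).re :=
  symbol_re_nonneg hl.1 (le_abs.2 (Or.inr (by linarith [hl.2])))

theorem im_sq_le_of_mem_belowArcs {l : ℂ} (hl : l ∈ belowArcs κ) : l.im ^ 2 ≤ l.re ^ 2 + κ ^ 2 := by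
  have sqrt_sq : Real.sqrt (κ ^ 2 + 2 * l.re ^ 2) ^ 2 = κ ^ 2 + 2 * l.re ^ 2 :=
    Real.sq_sqrt (by positivity)
  nlinarith [hl.1, hl.2, abs_le_sqrt κ l.re, sq_abs l.re, abs_nonneg l.re]

theorem segment_subset_belowArcs (κ : ℝ) (hσ : |σ| = 1) {r : ℝ} (hr : 0 ≤ r) :
    segment ℝ ((σ * r : ℝ) : ℂ) (arc κ σ (-1) r) ⊆ {l | l ∈ belowArcs κ ∧ |l.re| = r} := by
  rintro l ⟨a, b, ha, hb, hab, rfl⟩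
  have hre : (a • ((σ * r : ℝ) : ℂ) + b • arc κ σ (-1) r).re = σ * r := by
    simp only [Complex.add_re, Complex.smul_re, Complex.ofReal_re, arc_re, smul_eq_mul]
    linear_combination σ * r * hab
  have him : (a • ((σ * r : ℝ) : ℂ) + b • arc κ σ (-1) r).im
      = b * (Real.sqrt (κ ^ 2 + 2 * r ^ 2) - r) := by
    simp only [Complex.add_im, Complex.smul_im, Complex.ofReal_im, arc_im, smul_eq_mul]
    ring
  have re_abs : |σ * r| = r := by rw [abs_mul, hσ, one_mul, abs_of_nonneg hr]
  have gap_nonneg : 0 ≤ Real.sqrt (κ ^ 2 + 2 * r ^ 2) - r :=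
    sub_nonneg.2 ((le_abs_self r).trans (abs_le_sqrt κ r))
  refine ⟨⟨?_, ?_⟩, by rw [hre, re_abs]⟩ <;> rw [him]
  · positivity
  · rw [hre, ← sq_abs (σ * r), re_abs]
    exact mul_le_of_le_one_left gap_nonneg (by linarith)

theorem ofReal_mem_belowArcs (κ r : ℝ) : (r : ℂ) ∈ belowArcs κ := by
  refine ⟨by simp, ?_⟩
  simpa using abs_le_sqrt κ r

theorem arc_mem_belowArcs (κ : ℝ) (hσ : |σ| = 1) {r : ℝ} (hr : 0 ≤ r) :
    arc κ σ (-1) r ∈ belowArcs κ :=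
  (segment_subset_belowArcs κ hσ hr (right_mem_segment ℝ _ _)).1

theorem norm_exp_neg_mul_sq (ε : ℝ) (l : ℂ) :
    ‖Complex.exp (-(ε : ℂ) * l ^ 2)‖ = Real.exp (-(ε * (l.re ^ 2 - l.im ^ 2))) := by
  rw [Complex.norm_exp]
  congr 1
  simp [pow_two]

theorem norm_gaussianMul_le (hε : 0 ≤ ε) {l : ℂ} (hl : l ∈ belowArcs κ) :
    ‖gaussianMul ε F l‖ ≤ Real.exp (ε * κ ^ 2) * ‖F l‖ := by
  rw [gaussianMul, norm_mul, norm_exp_neg_mul_sq]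
  gcongr
  nlinarith [im_sq_le_of_mem_belowArcs hl]

theorem weight_le_of_mem_belowArcs (hy : 0 ≤ y) {c : ℝ} (hc : 0 < c) {l : ℂ} (hl : l ∈ belowArcs κ)
    (hκ : 4 * |κ| ≤ |l.re|) :
    weight y κ l ≤ Nat.factorial 4 / c ^ 4 * Real.exp c * Real.exp (c * (3 * |l.re|)) := by
  have norm_le : ‖l‖ + |κ| ≤ 3 * |l.re| := by
    have abs_im_eq := abs_of_nonneg hl.1
    linarith [Complex.norm_le_abs_re_add_abs_im l, hl.2, sqrt_le_abs_add κ l.re, abs_nonneg l.re]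
  have exp_le_one : Real.exp (-(y * l.im)) ≤ 1 :=
    Real.exp_le_one_iff.2 (neg_nonpos.2 (mul_nonneg hy hl.1))
  calc weight y κ l ≤ (1 + 3 * |l.re|) ^ 4 * 1 := by
        unfold weight
        gcongr ?_ ^ 4 * ?_
        linarith
    _ ≤ _ := by
        rw [mul_one]
        exact one_add_pow_le_exp hc (by positivity) 4

theorem exists_norm_gaussianMul_le_exp (hy : 0 ≤ y) (hε : 0 < ε)
    (hb : ∀ l ∈ belowArcs κ, ‖F l‖ ≤ K * weight y κ l) :
    ∃ M : ℝ, ∀ l ∈ belowArcs κ, 1 + 4 * |κ| ≤ |l.re| →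
      ‖gaussianMul ε F l‖ ≤ M * Real.exp (-(ε / 8 * |l.re|)) := by
  refine ⟨K * (Nat.factorial 4 / (ε / 24) ^ 4 * Real.exp (ε / 24)), fun l hl hre => ?_⟩
  have hK := nonneg_of_norm_le_mul_weight (hb l hl)
  have gaussian_le : Real.exp (-(ε * (l.re ^ 2 - l.im ^ 2))) ≤ Real.exp (-(ε * (|l.re| / 4))) := by
    have im_le : l.im ≤ 3 / 4 * |l.re| := by linarith [hl.2, sqrt_le_abs_add κ l.re]
    have : |l.re| / 4 ≤ l.re ^ 2 - l.im ^ 2 := by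
      nlinarith [hl.1, sq_abs l.re, abs_nonneg κ]
    gcongr
  have norm_F_le := (hb l hl).trans (mul_le_mul_of_nonneg_left
    (weight_le_of_mem_belowArcs hy (c := ε / 24) (by positivity) hl (by linarith)) hK)
  rw [gaussianMul, norm_mul, norm_exp_neg_mul_sq]
  refine (mul_le_mul gaussian_le norm_F_le (norm_nonneg _) (Real.exp_pos _).le).trans_eq ?_
  rw [mul_comm, mul_assoc, mul_assoc, mul_assoc, mul_assoc, ← Real.exp_add]
  ring_nf

theorem integrable_gaussianMul_ofReal (hy : 0 ≤ y) (hε : 0 < ε) (hF : Continuous F)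
    (hb : ∀ l ∈ belowArcs κ, ‖F l‖ ≤ K * weight y κ l) :
    Integrable (fun r : ℝ => gaussianMul ε F r) := by
  obtain ⟨M, norm_le⟩ := exists_norm_gaussianMul_le_exp hy hε hb
  have continuous_gaussianMul : Continuous (fun r : ℝ => gaussianMul ε F r) := by
    unfold gaussianMul
    fun_prop
  have isBigO : (fun r : ℝ => gaussianMul ε F r)
      =O[cocompact ℝ] fun r => Real.exp (-(ε / 8 * |r|)) := by
    refine Asymptotics.IsBigO.of_bound M ?_
    filter_upwards [(tendsto_norm_cocompact_atTop (E := ℝ)).eventually_ge_atTop (1 + 4 * |κ|)]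
      with r hr
    rw [Real.norm_of_nonneg (Real.exp_pos _).le]
    exact norm_le r (ofReal_mem_belowArcs κ r) (by simpa using hr)
  exact continuous_gaussianMul.locallyIntegrable.integrable_of_isBigO_cocompact isBigO
    ((integrable_exp_neg_mul_abs (by positivity)).integrableAtFilter _)

theorem arcIntegrable_lower (hσ : |σ| = 1) (hy : 0 < y) (hF : Continuous F)
    (hb : ∀ l ∈ belowArcs κ, ‖F l‖ ≤ K * weight y κ l) : ArcIntegrable κ σ (-1) F :=
  arcIntegrable_of_norm_le_weight hσ (by simp) hy
    (hF.comp (continuous_arc κ σ (-1))).continuousOn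
    fun _ hr => hb _ (arc_mem_belowArcs κ hσ (le_of_lt hr))

theorem arcIntegrable_gaussianMul (hσ : |σ| = 1) (hy : 0 < y) (hε : 0 ≤ ε) (hF : Continuous F)
    (hb : ∀ l ∈ belowArcs κ, ‖F l‖ ≤ K * weight y κ l) :
    ArcIntegrable κ σ (-1) (gaussianMul ε F) := by
  refine arcIntegrable_lower (K := Real.exp (ε * κ ^ 2) * K) hσ hy ?_ fun l hl => ?_
  · unfold gaussianMul
    fun_prop
  · rw [mul_assoc]
    exact (norm_gaussianMul_le hε hl).trans (by gcongr; exact hb l hl)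

theorem tendsto_primitive_gap (hσ : |σ| = 1) (hy : 0 ≤ y) (hε : 0 < ε) {Φ : ℂ → ℂ}
    (hΦ : ∀ l, HasDerivAt Φ (gaussianMul ε F l) l)
    (hb : ∀ l ∈ belowArcs κ, ‖F l‖ ≤ K * weight y κ l) :
    Tendsto (fun r : ℝ => Φ (arc κ σ (-1) r) - Φ ((σ * r : ℝ) : ℂ)) atTop (𝓝 0) := by
  obtain ⟨M, norm_le⟩ := exists_norm_gaussianMul_le_exp hy hε hb
  refine squeeze_zero_norm' ?_ (tendsto_exp_neg_mul_mul_atTop (d := ε / 8) (by positivity) M 1)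
  filter_upwards [eventually_ge_atTop (1 + 4 * |κ|)] with r hr
  have hr₀ : 0 ≤ r := by linarith [abs_nonneg κ]
  have norm_le_of_mem : ∀ l ∈ segment ℝ ((σ * r : ℝ) : ℂ) (arc κ σ (-1) r),
      ‖gaussianMul ε F l‖ ≤ M * Real.exp (-(ε / 8 * r)) := fun l hl => by
    obtain ⟨l_mem, hre⟩ := segment_subset_belowArcs κ hσ hr₀ hl
    exact hre ▸ norm_le l l_mem (hre ▸ hr)
  have length_le : ‖arc κ σ (-1) r - ((σ * r : ℝ) : ℂ)‖ ≤ 1 * r := by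
    have vertical : arc κ σ (-1) r - ((σ * r : ℝ) : ℂ)
        = ((Real.sqrt (κ ^ 2 + 2 * r ^ 2) - r : ℝ) : ℂ) * Complex.I := by
      rw [arc_eq_add_mul_I]
      push_cast
      ring
    have sqrt_le := sqrt_le_abs_add κ r
    have le_sqrt := abs_le_sqrt κ r
    rw [abs_of_nonneg hr₀] at sqrt_le le_sqrt
    rw [vertical, norm_mul, Complex.norm_I, mul_one, Complex.norm_real,
      Real.norm_of_nonneg (by linarith)]
    linarith
  exact (norm_primitive_sub_le (fun l _ => hΦ l) norm_le_of_mem).trans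
    (mul_le_mul_of_nonneg_left length_le
      ((norm_nonneg _).trans (norm_le_of_mem _ (left_mem_segment ℝ _ _))))

theorem arcIntegral_gaussianMul_sub (hσ : σ ∈ ({1, -1} : Set ℝ)) (hy : 0 < y) (hε : 0 < ε)
    (hF : Continuous F) {Φ : ℂ → ℂ} (hΦ : ∀ l, HasDerivAt Φ (gaussianMul ε F l) l)
    (hb : ∀ l ∈ belowArcs κ, ‖F l‖ ≤ K * weight y κ l) :
    arcIntegral κ σ (-1) (gaussianMul ε F)
        - (∫ r in Ioi (0 : ℝ), gaussianMul ε F ((σ * r : ℝ) : ℂ)) * σ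
      = Φ 0 - Φ ⟨0, |κ|⟩ := by
  have hσ' := abs_eq_one_of_mem hσ
  have hasDerivAt_ray (r : ℝ) : HasDerivAt (fun r : ℝ => ((σ * r : ℝ) : ℂ)) (σ : ℂ) r := by
    simpa using ((hasDerivAt_id r).const_mul σ).ofReal_comp
  have integrable_ray : IntegrableOn (fun r : ℝ => gaussianMul ε F ((σ * r : ℝ) : ℂ)
      * deriv (fun r : ℝ => ((σ * r : ℝ) : ℂ)) r) (Ioi 0) := by
    have hσ₀ : σ ≠ 0 := abs_pos.1 (hσ' ▸ one_pos)
    simp only [fun r => (hasDerivAt_ray r).deriv]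
    exact (((integrable_gaussianMul_ofReal hy.le hε hF hb).comp_mul_left' hσ₀).integrableOn
      (s := Ioi 0)).mul_const _
  have continuous_Φ : Continuous Φ := continuous_iff_continuousAt.2 fun l => (hΦ l).continuousAt
  have continuous_gap : Continuous fun r : ℝ => Φ (arc κ σ (-1) r) - Φ ((σ * r : ℝ) : ℂ) :=
    (continuous_Φ.comp (continuous_arc κ σ (-1))).sub (continuous_Φ.comp (by fun_prop))
  have sub_eq := integral_mul_deriv_sub_integral_mul_deriv
    (fun r _ => (hasDerivAt_ray r).differentiableAt)
    (fun r => differentiableAt_arc κ σ (-1)) (fun r _ => hΦ _) (fun r _ => hΦ _) integrable_ray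
    (arcIntegrable_gaussianMul hσ' hy hε.le hF hb) continuous_gap.continuousWithinAt
    (tendsto_primitive_gap hσ' hy.le hε hΦ hb)
  simp only [fun r => (hasDerivAt_ray r).deriv, integral_mul_const] at sub_eq
  simpa [arc_zero, arcIntegral] using sub_eq
theorem integral_gaussianMul_eq (hy : 0 < y) (hε : 0 < ε) (hF : Differentiable ℂ F)
    (hb : ∀ l ∈ belowArcs κ, ‖F l‖ ≤ K * weight y κ l) :
    ∫ r : ℝ, gaussianMul ε F r
      = -arcIntegral κ (-1) (-1) (gaussianMul ε F) + arcIntegral κ 1 (-1) (gaussianMul ε F) := by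
  have differentiable_gaussianMul : Differentiable ℂ (gaussianMul ε F) := by
    unfold gaussianMul
    fun_prop
  obtain ⟨Φ, hΦ⟩ := differentiable_gaussianMul.isExactOn_univ
  replace hΦ : ∀ l, HasDerivAt Φ (gaussianMul ε F l) l := fun l => hΦ l (mem_univ l)
  have right := arcIntegral_gaussianMul_sub (σ := 1) (by simp) hy hε hF.continuous hΦ hb
  have left := arcIntegral_gaussianMul_sub (σ := -1) (by simp) hy hε hF.continuous hΦ hb
  simp only [one_mul, neg_one_mul, Complex.ofReal_one, mul_one, Complex.ofReal_neg, mul_neg]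
    at right left
  have reflect := integral_comp_neg_Ioi (0 : ℝ) (fun r : ℝ => gaussianMul ε F r)
  simp only [Complex.ofReal_neg, neg_zero] at reflect
  have hR := integrable_gaussianMul_ofReal hy.le hε hF.continuous hb
  rw [← intervalIntegral.integral_Iic_add_Ioi hR.integrableOn hR.integrableOn]
  linear_combination left - right - reflect

theorem tendsto_arcIntegral_gaussianMul (hσ : |σ| = 1) (hF : ArcIntegrable κ σ (-1) F) :
    Tendsto (fun c : ℝ => arcIntegral κ σ (-1) (gaussianMul c⁻¹ F)) atTop
      (𝓝 (arcIntegral κ σ (-1) F)) := by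
  refine tendsto_integral_filter_of_dominated_convergence
    (fun a => Real.exp (κ ^ 2) * ‖F (arc κ σ (-1) a) * deriv (arc κ σ (-1)) a‖) ?_ ?_
    (hF.norm.const_mul _) ?_
  · refine Eventually.of_forall fun c => ?_
    have gaussian : Continuous fun a => Complex.exp (-((c⁻¹ : ℝ) : ℂ) * arc κ σ (-1) a ^ 2) := by
      have := continuous_arc κ σ (-1)
      fun_prop
    simp only [gaussianMul, mul_assoc]
    exact gaussian.aestronglyMeasurable.mul hF.aestronglyMeasurable
  · filter_upwards [eventually_ge_atTop 1] with c hc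
    filter_upwards [ae_restrict_mem measurableSet_Ioi] with a ha
    have inv_mul_le : c⁻¹ * κ ^ 2 ≤ κ ^ 2 :=
      mul_le_of_le_one_left (sq_nonneg κ) (inv_le_one_of_one_le₀ hc)
    rw [norm_mul, norm_mul, ← mul_assoc]
    gcongr
    refine (norm_gaussianMul_le (by positivity) (arc_mem_belowArcs κ hσ (le_of_lt ha))).trans ?_
    gcongr
  · refine Eventually.of_forall fun a => ?_
    have tendsto_gaussian :
        Tendsto (fun c : ℝ => Complex.exp (-((c⁻¹ : ℝ) : ℂ) * arc κ σ (-1) a ^ 2)) atTop (𝓝 1) := by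
      simpa using (tendsto_inv_atTop_zero.ofReal.neg.mul_const (arc κ σ (-1) a ^ 2)).cexp
    simpa [gaussianMul] using (tendsto_gaussian.mul_const (F (arc κ σ (-1) a))).mul_const
      (deriv (arc κ σ (-1)) a)

theorem tendsto_integral_gaussianMul (hy : 0 < y) (hF : Differentiable ℂ F)
    (hb : ∀ l : ℂ, 0 ≤ l.im → 0 ≤ (symbol κ l).re → ‖F l‖ ≤ K * weight y κ l) :
    Tendsto (fun c : ℝ => ∫ r : ℝ, gaussianMul c⁻¹ F r) atTop (𝓝 (boundaryIntegral κ F)) := by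
  have hb' : ∀ l ∈ belowArcs κ, ‖F l‖ ≤ K * weight y κ l := fun l hl =>
    hb l hl.1 (symbol_re_nonneg_of_mem_belowArcs hl)
  have tendsto_arc {σ : ℝ} (hσ : |σ| = 1) :=
    tendsto_arcIntegral_gaussianMul hσ (arcIntegrable_lower hσ hy hF.continuous hb')
  have boundary_eq : boundaryIntegral κ F
      = -arcIntegral κ (-1) (-1) F + arcIntegral κ 1 (-1) F := by
    rw [boundaryIntegral, arcIntegral_upper_eq hy hF hb]
    ring
  rw [boundary_eq]
  refine ((tendsto_arc (by simp)).neg.add (tendsto_arc (by simp))).congr' ?_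
  filter_upwards [eventually_gt_atTop 0] with c hc
  exact (integral_gaussianMul_eq hy (inv_pos.2 hc) hF hb').symm

end BelowArcs

/-! ### Fourier inversion -/

section GaussianInversion

open scoped FourierTransform RealInnerProductSpace

variable {V W : Type*} [NormedAddCommGroup V] [InnerProductSpace ℝ V] [MeasurableSpace V]
  [BorelSpace V] [FiniteDimensional ℝ V] [NormedAddCommGroup W] [NormedSpace ℂ W] [CompleteSpace W]

/- Unlike Mathlib's inversion theorem this does not ask for integrability of the Fourier transform,
which fails for the extension by zero of a function on a half line. -/
theorem tendsto_integral_gaussian_smul_fourier {f : V → W} (hf : Integrable f) {v : V}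
    (hv : ContinuousAt f v) :
    Tendsto (fun c : ℝ => ∫ w : V, Complex.exp (-(c : ℂ)⁻¹ * ‖w‖ ^ 2
      + 2 * Real.pi * Complex.I * ⟪v, w⟫) • 𝓕 f w) atTop (𝓝 (f v)) := by
  refine (Real.tendsto_integral_gaussian_smul' hf hv).congr' ?_
  filter_upwards [eventually_gt_atTop 0] with c hc
  have re_pos : 0 < ((c : ℂ)⁻¹).re := by simpa using hc
  have fourier_flip := VectorFourier.integral_fourierIntegral_smul_eq_flip (L := innerₗ V)
    Real.continuous_fourierChar continuous_inner
    (GaussianFourier.integrable_cexp_neg_mul_sq_norm_add re_pos (2 * Real.pi * Complex.I) v) hf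
  rw [flip_innerₗ] at fourier_flip
  refine Eq.trans (integral_congr_ae (Eventually.of_forall fun w => ?_)) fourier_flip
  have fourier_gaussian := fourier_gaussian_innerProductSpace' re_pos v w
  rw [div_inv_eq_mul, div_inv_eq_mul] at fourier_gaussian
  refine congrArg (· • f w) (Eq.trans ?_ fourier_gaussian.symm)
  ring_nf

end GaussianInversion

/-- The Fourier transform on the line in the angular frequency, as in `fourierX`. -/
def lineFourier (f : ℝ → ℂ) (κ : ℝ) : ℂ := ∫ x : ℝ, Complex.exp (-Complex.I * x * κ) * f x

section LineFourier

variable {f : ℝ → ℂ}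

open scoped FourierTransform in
theorem fourier_eq_lineFourier (f : ℝ → ℂ) (w : ℝ) : 𝓕 f w = lineFourier f (2 * Real.pi * w) := by
  rw [Real.fourier_eq', lineFourier]
  refine integral_congr_ae (Eventually.of_forall fun x => ?_)
  simp only [smul_eq_mul, RCLike.inner_apply, conj_trivial]
  push_cast
  ring_nf

theorem two_pi_mul_integral_comp_two_pi_mul (g : ℝ → ℂ) :
    (2 * Real.pi : ℂ) * ∫ w : ℝ, g (2 * Real.pi * w) = ∫ l : ℝ, g l := by
  have two_pi_pos : 0 < 2 * Real.pi := by positivity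
  rw [Measure.integral_comp_mul_left, abs_of_pos (by positivity), Complex.real_smul, ← mul_assoc]
  push_cast
  rw [mul_inv_cancel₀ (by exact_mod_cast two_pi_pos.ne'), one_mul]

open scoped FourierTransform RealInnerProductSpace in
theorem tendsto_integral_gaussian_mul_lineFourier (hf : Integrable f) {y : ℝ}
    (hy : ContinuousAt f y) :
    Tendsto (fun c : ℝ => ∫ l : ℝ, Complex.exp (-((c⁻¹ : ℝ) : ℂ) * (l : ℂ) ^ 2)
      * (Complex.exp (Complex.I * l * y) * lineFourier f l)) atTop (𝓝 (2 * Real.pi * f y)) := by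
  have rescaled := ((tendsto_integral_gaussian_smul_fourier hf hy).comp
    (tendsto_id.atTop_div_const (show 0 < 4 * Real.pi ^ 2 by positivity))).const_mul
      (2 * Real.pi : ℂ)
  refine rescaled.congr fun c => ?_
  rw [← two_pi_mul_integral_comp_two_pi_mul]
  refine congrArg _ (integral_congr_ae (Eventually.of_forall fun w => ?_))
  have norm_sq : ((‖w‖ : ℝ) : ℂ) ^ 2 = (w : ℂ) ^ 2 := by
    rw [← Complex.ofReal_pow, Real.norm_eq_abs, sq_abs, Complex.ofReal_pow]
  simp only [fourier_eq_lineFourier, smul_eq_mul, id_eq, norm_sq, ← mul_assoc, ← Complex.exp_add,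
    RCLike.inner_apply, conj_trivial]
  refine congrArg (Complex.exp · * _) ?_
  push_cast
  rw [inv_div]
  ring

open scoped FourierTransform in
theorem two_pi_mul_eq_integral_lineFourier (hf : Integrable f) (hc : Continuous f)
    (hfi : Integrable (lineFourier f)) (x : ℝ) :
    2 * Real.pi * f x = ∫ κ : ℝ, Complex.exp (Complex.I * κ * x) * lineFourier f κ := by
  have integrable_fourier : Integrable (𝓕 f) :=
    (hfi.comp_mul_left' (R := 2 * Real.pi) (by positivity)).congr
      (Eventually.of_forall fun w => (fourier_eq_lineFourier f w).symm)
  rw [← congrFun (hc.fourierInv_fourier_eq hf integrable_fourier) x, Real.fourierInv_eq',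
    ← two_pi_mul_integral_comp_two_pi_mul
      fun κ : ℝ => Complex.exp (Complex.I * κ * x) * lineFourier f κ]
  refine congrArg ((2 * Real.pi : ℂ) * ·) (integral_congr_ae (Eventually.of_forall fun w => ?_))
  simp only [fourier_eq_lineFourier, smul_eq_mul, RCLike.inner_apply, conj_trivial]
  push_cast
  ring_nf

end LineFourier

/-! ### Regularity and size of the transforms -/

theorem differentiable_integral_exp_mul {h : ℝ → ℂ} {t : ℝ} (ht : 0 ≤ t)
    (hh : ContinuousOn h (Icc 0 t)) :
    Differentiable ℂ (fun η : ℂ => ∫ τ in (0 : ℝ)..t, Complex.exp (η * τ) * h τ) := by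
  intro η₀
  obtain ⟨M, norm_h_le⟩ := isCompact_Icc.exists_bound_of_continuousOn hh
  have subset : uIoc 0 t ⊆ Icc 0 t := uIoc_of_le ht ▸ Ioc_subset_Icc_self
  have measurable_h : AEStronglyMeasurable h (volume.restrict (uIoc 0 t)) :=
    (hh.mono subset).aestronglyMeasurable measurableSet_uIoc
  have norm_deriv_le : ∀ τ ∈ uIoc 0 t, ∀ η ∈ Metric.ball η₀ 1,
      ‖Complex.exp (η * τ) * τ * h τ‖ ≤ Real.exp ((‖η₀‖ + 1) * t) * t * M := by
    intro τ hτ η hη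
    have τ_mem := subset hτ
    have norm_τ_le : ‖(τ : ℂ)‖ ≤ t := by
      rw [Complex.norm_real, Real.norm_of_nonneg τ_mem.1]
      exact τ_mem.2
    have norm_η_le : ‖η‖ ≤ ‖η₀‖ + 1 := by
      linarith [norm_sub_norm_le η η₀, mem_ball_iff_norm.1 hη]
    have norm_exp_le : ‖Complex.exp (η * τ)‖ ≤ Real.exp ((‖η₀‖ + 1) * t) :=
      (norm_exp_mul_ofReal_le η τ_mem.1 τ_mem.2).trans (by gcongr)
    rw [norm_mul, norm_mul]
    gcongr
    exact norm_h_le τ τ_mem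
  refine (intervalIntegral.hasDerivAt_integral_of_dominated_loc_of_deriv_le
    (F := fun η τ => Complex.exp (η * τ) * h τ) (F' := fun η τ => Complex.exp (η * τ) * τ * h τ)
    (bound := fun _ => Real.exp ((‖η₀‖ + 1) * t) * t * M) (Metric.ball_mem_nhds η₀ one_pos)
    (Eventually.of_forall fun η => (Continuous.aestronglyMeasurable (by fun_prop)).mul measurable_h)
    (ContinuousOn.intervalIntegrable ?_)
    ((Continuous.aestronglyMeasurable (by fun_prop)).mul measurable_h)
    (Eventually.of_forall norm_deriv_le) intervalIntegrable_const
    (Eventually.of_forall fun τ _ η _ => ?_)).2.differentiableAt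
  · rw [uIcc_of_le ht]
    exact ContinuousOn.mul (by fun_prop) hh
  · simpa using (((hasDerivAt_id η).mul_const (τ : ℂ)).cexp).mul_const (h τ)

section

variable {T m : ℝ} {u : ℝ → ℝ → ℝ → ℂ}

namespace SmoothDecaying

theorem differentiable_tTransform (hu : SmoothDecaying T m u) (hm : 1 < m) {j : ℕ} (hj : j ≤ 4)
    (κ : ℝ) {t : ℝ} (ht : t ∈ Icc 0 T) : Differentiable ℂ (fun η => tTransform (trace u j) κ η t) :=
  differentiable_integral_exp_mul ht.1
    ((hu.continuousOn_fourierX_trace hm hj κ).mono (Icc_subset_Icc_right ht.2))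

theorem differentiable_boundaryTerm (hu : SmoothDecaying T m u) (hm : 1 < m) (κ : ℝ) {t : ℝ}
    (ht : t ∈ Icc 0 T) : Differentiable ℂ (fun l => boundaryTerm u κ l t) := by
  have differentiable_trace (j : ℕ) (hj : j ≤ 4) :
      Differentiable ℂ (fun l : ℂ => tTransform (trace u j) κ (symbol κ l) t) :=
    (hu.differentiable_tTransform hm hj κ ht).comp (by unfold symbol; fun_prop)
  have := differentiable_trace 0 (by norm_num)
  have := differentiable_trace 1 (by norm_num)
  have := differentiable_trace 2 (by norm_num)
  have := differentiable_trace 3 (by norm_num)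
  unfold boundaryTerm
  fun_prop

theorem exists_norm_tTransform_le (hu : SmoothDecaying T m u) (hm : 1 < m) {t : ℝ}
    (ht : t ∈ Icc 0 T) :
    ∃ M : ℝ, ∀ j ≤ 4, ∀ (κ : ℝ) (η : ℂ), 0 ≤ η.re →
      ‖tTransform (trace u j) κ η t‖ ≤ M * Real.exp (η.re * t) := by
  obtain ⟨M, norm_trace_le⟩ := hu.exists_norm_fourierX_trace_le hm
  refine ⟨M * t, fun j hj κ η hη => ?_⟩
  have integrand_le : ∀ τ ∈ uIoc 0 t,
      ‖Complex.exp (η * τ) * fourierX (trace u j) κ τ‖ ≤ Real.exp (η.re * t) * M := fun τ hτ => by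
    rw [uIoc_of_le ht.1] at hτ
    rw [norm_mul, Complex.norm_exp, Complex.re_mul_ofReal]
    gcongr
    · exact hτ.2
    · exact norm_trace_le j hj κ τ ⟨hτ.1.le, hτ.2.trans ht.2⟩
  refine (intervalIntegral.norm_integral_le_of_norm_le_const integrand_le).trans_eq ?_
  rw [sub_zero, abs_of_nonneg ht.1]
  ring

end SmoothDecaying

theorem norm_E (κ : ℝ) (l : ℂ) (x y t : ℝ) :
    ‖E κ l x y t‖ = Real.exp (-((symbol κ l).re * t)) * Real.exp (-(y * l.im)) := by
  have exponent_re : (-((κ : ℂ) ^ 2 + l ^ 2) ^ 2 * t + Complex.I * κ * x + Complex.I * l * y).re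
      = -((symbol κ l).re * t) + -(y * l.im) := by
    rw [Complex.add_re, Complex.add_re, Complex.re_mul_ofReal, Complex.neg_re]
    simp
    ring
  rw [E, Complex.norm_exp, exponent_re, Real.exp_add]

theorem norm_E_mul_le {κ t B X : ℝ} {l z : ℂ} (x y : ℝ)
    (hz : ‖z‖ ≤ B * Real.exp ((symbol κ l).re * t) * X) :
    ‖E κ l x y t * z‖ ≤ B * (X * Real.exp (-(y * l.im))) := by
  rw [norm_mul, norm_E]
  refine (mul_le_mul_of_nonneg_left hz (by positivity)).trans_eq ?_
  rw [Real.exp_neg ((symbol κ l).re * t)]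
  field_simp

theorem norm_boundaryTerm_le {κ t B : ℝ} {l : ℂ}
    (hB : ∀ j ≤ 3, ‖tTransform (trace u j) κ (symbol κ l) t‖ ≤ B) :
    ‖boundaryTerm u κ l t‖ ≤ 3 * B * (1 + ‖l‖ + |κ|) ^ 4 := by
  have hB₀ : 0 ≤ B := (norm_nonneg _).trans (hB 0 (by norm_num))
  have one_le : 1 ≤ 1 + ‖l‖ + |κ| := by linarith [norm_nonneg l, abs_nonneg κ]
  have pair_le (a b : ℂ) (ha : ‖a‖ ≤ B) (hb : ‖b‖ ≤ B) :
      ‖a + Complex.I * l * b‖ ≤ B * (1 + ‖l‖ + |κ|) := by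
    have norm_mul_le : ‖l‖ * ‖b‖ ≤ ‖l‖ * B := mul_le_mul_of_nonneg_left hb (norm_nonneg l)
    have := norm_add_le a (Complex.I * l * b)
    rw [norm_mul, norm_mul, Complex.norm_I, one_mul] at this
    linarith [mul_nonneg hB₀ (abs_nonneg κ)]
  have coeff_le : ‖l ^ 2 + 2 * (κ : ℂ) ^ 2‖ ≤ 2 * (1 + ‖l‖ + |κ|) ^ 2 := by
    refine (norm_add_le _ _).trans ?_
    simp only [norm_mul, norm_pow, Complex.norm_real, Real.norm_eq_abs, Complex.norm_ofNat]
    nlinarith [norm_nonneg l, abs_nonneg κ, mul_nonneg (norm_nonneg l) (abs_nonneg κ)]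
  calc ‖boundaryTerm u κ l t‖
      ≤ B * (1 + ‖l‖ + |κ|) + 2 * (1 + ‖l‖ + |κ|) ^ 2 * (B * (1 + ‖l‖ + |κ|)) := by
        refine (norm_sub_le _ _).trans (add_le_add
          (pair_le _ _ (hB 3 (by norm_num)) (hB 2 (by norm_num))) ?_)
        rw [norm_mul]
        gcongr
        exact pair_le _ _ (hB 1 (by norm_num)) (hB 0 (by norm_num))
    _ = B * ((1 + ‖l‖ + |κ|) ^ 1 + 2 * (1 + ‖l‖ + |κ|) ^ 3) := by ring
    _ ≤ B * ((1 + ‖l‖ + |κ|) ^ 4 + 2 * (1 + ‖l‖ + |κ|) ^ 4) := by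
        gcongr <;> first | exact one_le | norm_num
    _ = 3 * B * (1 + ‖l‖ + |κ|) ^ 4 := by ring

theorem SmoothDecaying.exists_norm_boundaryTerm_le (hu : SmoothDecaying T m u) (hm : 1 < m)
    {t : ℝ} (ht : t ∈ Icc 0 T) (x y : ℝ) :
    ∃ K : ℝ, ∀ (κ : ℝ) (l : ℂ), 0 ≤ (symbol κ l).re →
      ‖E κ l x y t * boundaryTerm u κ l t‖ ≤ K * weight y κ l := by
  obtain ⟨M, norm_tTransform_le⟩ := hu.exists_norm_tTransform_le hm ht
  refine ⟨3 * M, fun κ l hre => norm_E_mul_le x y ?_⟩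
  rw [mul_assoc]
  refine (norm_boundaryTerm_le fun j hj =>
    norm_tTransform_le j (hj.trans (by norm_num)) κ _ hre).trans_eq ?_
  ring

end

/-! ### Elimination of the unknown boundary values -/

/-- What remains of the boundary term once the global relations at `-l` and `-ν_κ(l)` have been used
to eliminate the traces of `u_yy` and `u_yyy`: it involves only the solution at the final time. The
quotient is a difference quotient of `halfFourier (u · · t) κ`, hence bounded near `l = i|κ|`. -/
def remainder (u : ℝ → ℝ → ℝ → ℂ) (κ : ℝ) (l : ℂ) (t : ℝ) : ℂ :=
  halfFourier (fun x y => u x y t) κ (-l)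
    + 2 * l * ((halfFourier (fun x y => u x y t) κ (-l)
      - halfFourier (fun x y => u x y t) κ (-nu κ l)) / (nu κ l - l))

section Elimination

variable {T m : ℝ} {u : ℝ → ℝ → ℝ → ℂ} {u₀ g₀ g₁ : ℝ → ℝ → ℂ}

theorem tTransform_congr {g g' : ℝ → ℝ → ℂ} {t : ℝ} (ht : 0 ≤ t)
    (h : ∀ x, ∀ τ ∈ Ioc 0 t, g x τ = g' x τ) (κ : ℝ) (η : ℂ) :
    tTransform g κ η t = tTransform g' κ η t := by
  refine intervalIntegral.integral_congr_ae (Eventually.of_forall fun τ hτ => ?_)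
  rw [uIoc_of_le ht] at hτ
  simp only [fourierX, h _ τ hτ]

namespace SolvesIBVP

theorem halfFourier_initial (hs : SolvesIBVP T u u₀ g₀ g₁) (κ : ℝ) (l : ℂ) :
    halfFourier u₀ κ l = halfFourier (fun x y => u x y 0) κ l := by
  unfold halfFourier
  congr 1 with x
  refine setIntegral_congr_fun measurableSet_Ioi fun y hy => ?_
  simp only [hs.initial x y hy]

theorem G_eq (hs : SolvesIBVP T u u₀ g₀ g₁) {t : ℝ} (ht : t ∈ Ioo 0 T) (κ : ℝ) (l : ℂ) :
    G u₀ g₀ g₁ κ l t = G (fun x y => u x y 0) (trace u 0) (trace u 1) κ l t := by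
  have mem_Ioo {τ : ℝ} (hτ : τ ∈ Ioc 0 t) : τ ∈ Ioo 0 T := ⟨hτ.1, hτ.2.trans_lt ht.2⟩
  simp only [G, hs.halfFourier_initial,
    tTransform_congr ht.1.le fun x τ hτ => (hs.dirichlet x τ (mem_Ioo hτ)).symm,
    tTransform_congr ht.1.le fun x τ hτ => (hs.neumann x τ (mem_Ioo hτ)).symm]
  rfl

end SolvesIBVP

theorem boundaryTerm_eq_G_add_remainder (hu : SmoothDecaying T m u) (hm : 2 < m)
    (hs : SolvesIBVP T u u₀ g₀ g₁) {t : ℝ} (ht : t ∈ Ioo 0 T) (κ : ℝ) {l : ℂ} (him : 0 ≤ l.im)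
    (hre : l.re ≠ 0) :
    boundaryTerm u κ l t
      = G u₀ g₀ g₁ κ l t + Complex.exp (symbol κ l * t) * remainder u κ l t := by
  have nu_sub_ne_zero : nu κ l - l ≠ 0 := sub_ne_zero.2 (nu_ne_self hre)
  have relation_neg := hu.global_relation hm hs ht κ (l := -l) (by simpa using him)
  have relation_neg_nu := hu.global_relation hm hs ht κ (l := -nu κ l)
    (by simpa using nu_im_nonneg κ l)
  have sq_add : l ^ 2 + 2 * (κ : ℂ) ^ 2 = -nu κ l ^ 2 := by rw [nu_sq]; ring
  have nu_sq_add : nu κ l ^ 2 + 2 * (κ : ℂ) ^ 2 = -l ^ 2 := by rw [nu_sq]; ring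
  simp only [boundaryTerm, symbol_neg, symbol_nu, neg_sq, sq_add, nu_sq_add]
    at relation_neg relation_neg_nu
  rw [hs.G_eq ht]
  simp only [boundaryTerm, G, remainder, sq_add]
  field_simp
  linear_combination (-(nu κ l + l)) * relation_neg + 2 * l * relation_neg_nu

namespace SmoothDecaying

theorem exists_norm_remainder_le (hu : SmoothDecaying T m u) (hm : 3 < m) {t : ℝ}
    (ht : t ∈ Icc 0 T) :
    ∃ K : ℝ, ∀ (κ : ℝ) (l : ℂ), 0 ≤ l.im → l.re ≠ 0 →
      ‖remainder u κ l t‖ ≤ K * (1 + ‖l‖ + |κ|) ^ 4 := by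
  obtain ⟨C, isDecaying⟩ := hu.exists_isDecaying_apply
  have hw := isDecaying t ht
  set A := C * ∫ q : ℝ × ℝ, (1 + |q.1| + |q.2|) ^ (-m)
  set L := C * ∫ q : ℝ × ℝ, |q.2| * (1 + |q.1| + |q.2|) ^ (-m)
  refine ⟨A + 2 * L, fun κ l him hre => ?_⟩
  have neg_im : (-l).im ≤ 0 := by simpa using him
  have neg_nu_im : (-nu κ l).im ≤ 0 := by simpa using nu_im_nonneg κ l
  have norm_pos : 0 < ‖nu κ l - l‖ := norm_pos_iff.2 (sub_ne_zero.2 (nu_ne_self hre))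
  have norm_le : ‖halfFourier (fun x y => u x y t) κ (-l)‖ ≤ A :=
    hw.norm_halfFourier_le (by linarith) κ neg_im
  have quotient_le : ‖(halfFourier (fun x y => u x y t) κ (-l)
      - halfFourier (fun x y => u x y t) κ (-nu κ l)) / (nu κ l - l)‖ ≤ L := by
    rw [norm_div, div_le_iff₀ norm_pos]
    simpa only [neg_sub_neg] using hw.norm_halfFourier_sub_le hm κ neg_im neg_nu_im
  have A_nonneg : 0 ≤ A := (norm_nonneg _).trans norm_le
  have L_nonneg : 0 ≤ L := (norm_nonneg _).trans quotient_le
  have one_le : 1 ≤ 1 + ‖l‖ + |κ| := by linarith [norm_nonneg l, abs_nonneg κ]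
  calc ‖remainder u κ l t‖ ≤ A + 2 * ‖l‖ * L := by
        refine (norm_add_le _ _).trans (add_le_add norm_le ?_)
        rw [norm_mul, norm_mul, Complex.norm_ofNat]
        gcongr
    _ ≤ A * (1 + ‖l‖ + |κ|) + 2 * (1 + ‖l‖ + |κ|) * L := by
        gcongr
        · exact le_mul_of_one_le_right A_nonneg one_le
        · linarith [abs_nonneg κ]
    _ = (A + 2 * L) * (1 + ‖l‖ + |κ|) := by ring
    _ ≤ (A + 2 * L) * (1 + ‖l‖ + |κ|) ^ 4 := by
        gcongr
        exact le_self_pow₀ one_le (by norm_num)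

theorem exists_norm_E_mul_remainder_le (hu : SmoothDecaying T m u) (hm : 3 < m) {t : ℝ}
    (ht : t ∈ Icc 0 T) (x y : ℝ) :
    ∃ K : ℝ, ∀ (κ : ℝ) (l : ℂ), 0 ≤ l.im → l.re ≠ 0 →
      ‖E κ l x y t * (Complex.exp (symbol κ l * t) * remainder u κ l t)‖ ≤ K * weight y κ l := by
  obtain ⟨K, remainder_le⟩ := hu.exists_norm_remainder_le hm ht
  refine ⟨K, fun κ l him hre => norm_E_mul_le x y ?_⟩
  rw [norm_mul, Complex.norm_exp, Complex.re_mul_ofReal]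
  refine (mul_le_mul_of_nonneg_left (remainder_le κ l him hre) (by positivity)).trans_eq ?_
  ring

theorem differentiableOn_remainder (hu : SmoothDecaying T m u) (hm : 3 < m) {t : ℝ}
    (ht : t ∈ Icc 0 T) (κ : ℝ) :
    DifferentiableOn ℂ (fun l => remainder u κ l t) {l | l.re ≠ 0 ∧ 0 < l.im} := by
  obtain ⟨C, isDecaying⟩ := hu.exists_isDecaying_apply
  have hw := isDecaying t ht
  rintro l ⟨hre, him⟩
  have notMem_cut : l ∉ cut κ := fun h => hre h.1
  have nu_differentiable : DifferentiableAt ℂ (nu κ) l :=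
    (analyticOnNhd_nu κ l notMem_cut).differentiableAt
  have at_neg : DifferentiableAt ℂ (fun l => halfFourier (fun x y => u x y t) κ (-l)) l :=
    (hw.differentiableAt_halfFourier hm κ (l := -l) (by simpa using him)).comp l
      differentiableAt_id.neg
  have at_neg_nu :
      DifferentiableAt ℂ (fun l => halfFourier (fun x y => u x y t) κ (-nu κ l)) l :=
    DifferentiableAt.comp (g := halfFourier (fun x y => u x y t) κ) (f := fun l => -nu κ l) l
      (hw.differentiableAt_halfFourier hm κ (by simpa using nu_im_pos notMem_cut))
      nu_differentiable.fun_neg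
  exact (at_neg.add ((differentiableAt_id.const_mul 2).mul ((at_neg.sub at_neg_nu).div
    (nu_differentiable.sub differentiableAt_id)
      (sub_ne_zero.2 (nu_ne_self hre))))).differentiableWithinAt

end SmoothDecaying

theorem differentiable_E (κ x y t : ℝ) : Differentiable ℂ (fun l => E κ l x y t) := by
  unfold E
  fun_prop

theorem arc_mem_of_pos (κ : ℝ) {σ τ a : ℝ} (hσ : |σ| = 1) (hτ : |τ| = 1) (ha : 0 < a) :
    arc κ σ τ a ∈ {l : ℂ | l.re ≠ 0 ∧ 0 < l.im} := by
  refine ⟨fun hre => ha.ne' ?_, arc_im_pos κ σ hτ.le ha⟩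
  rw [← pow_eq_zero_iff two_ne_zero, ← arc_re_sq κ hσ τ a, hre, zero_pow two_ne_zero]

theorem arcIntegral_sub {κ σ τ : ℝ} {F₁ F₂ : ℂ → ℂ} (h₁ : ArcIntegrable κ σ τ F₁)
    (h₂ : ArcIntegrable κ σ τ F₂) :
    arcIntegral κ σ τ (fun l => F₁ l - F₂ l) = arcIntegral κ σ τ F₁ - arcIntegral κ σ τ F₂ := by
  unfold arcIntegral
  rw [← integral_sub h₁ h₂]
  simp only [sub_mul]

theorem arcIntegral_congr {κ σ τ : ℝ} {F₁ F₂ : ℂ → ℂ} (hσ : |σ| = 1) (hτ : |τ| = 1)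
    (h : ∀ l : ℂ, l.re ≠ 0 → 0 < l.im → F₁ l = F₂ l) :
    arcIntegral κ σ τ F₁ = arcIntegral κ σ τ F₂ := by
  refine setIntegral_congr_fun measurableSet_Ioi fun a ha => ?_
  have arc_mem := arc_mem_of_pos κ hσ hτ ha
  simp only [h _ arc_mem.1 arc_mem.2]

theorem boundaryIntegral_eq_of_eq_sub {κ y K : ℝ} {F F₁ R : ℂ → ℂ} (hy : 0 < y)
    (hF : ∀ σ ∈ ({1, -1} : Set ℝ), ∀ τ ∈ ({1, -1} : Set ℝ), ArcIntegrable κ σ τ F)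
    (hR : DifferentiableOn ℂ R {l | l.re ≠ 0 ∧ 0 < l.im})
    (hRb : ∀ l : ℂ, l.re ≠ 0 → 0 < l.im → ‖R l‖ ≤ K * weight y κ l)
    (h : ∀ l : ℂ, l.re ≠ 0 → 0 < l.im → F₁ l = F l - R l) :
    boundaryIntegral κ F₁ = boundaryIntegral κ F := by
  have re_ne_zero {σ : ℝ} {l : ℂ} (hl : 0 < σ * l.re) : l.re ≠ 0 := right_ne_zero_of_mul hl.ne'
  have R_integrable : ∀ σ ∈ ({1, -1} : Set ℝ), ∀ τ ∈ ({1, -1} : Set ℝ),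
      ArcIntegrable κ σ τ R := fun σ hσ τ hτ => by
    have arc_mem {a : ℝ} := arc_mem_of_pos κ (abs_eq_one_of_mem hσ) (abs_eq_one_of_mem hτ) (a := a)
    exact arcIntegrable_of_norm_le_weight (abs_eq_one_of_mem hσ) (abs_eq_one_of_mem hτ) hy
      (hR.continuousOn.comp (continuous_arc κ σ τ).continuousOn fun a ha => arc_mem ha)
      fun a ha => hRb _ (arc_mem ha).1 (arc_mem ha).2
  have R_cancels : ∀ σ ∈ ({1, -1} : Set ℝ), arcIntegral κ σ 1 R = arcIntegral κ σ (-1) R :=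
    fun σ hσ => arcIntegral_component_eq hσ hy (hR.mono fun l hl => ⟨re_ne_zero hl.1, hl.2⟩)
      fun l hre him => hRb l (re_ne_zero hre) him
  have split : ∀ σ ∈ ({1, -1} : Set ℝ), ∀ τ ∈ ({1, -1} : Set ℝ),
      arcIntegral κ σ τ F₁ = arcIntegral κ σ τ F - arcIntegral κ σ τ R := fun σ hσ τ hτ => by
    rw [arcIntegral_congr (abs_eq_one_of_mem hσ) (abs_eq_one_of_mem hτ) h,
      arcIntegral_sub (hF σ hσ τ hτ) (R_integrable σ hσ τ hτ)]
  unfold boundaryIntegral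
  rw [split 1 (by simp) 1 (by simp), split 1 (by simp) (-1) (by simp),
    split (-1) (by simp) 1 (by simp), split (-1) (by simp) (-1) (by simp),
    R_cancels 1 (by simp), R_cancels (-1) (by simp)]
  ring

theorem boundaryIntegral_E_mul_G (hu : SmoothDecaying T m u) (hm : 3 < m)
    (hs : SolvesIBVP T u u₀ g₀ g₁) {t : ℝ} (ht : t ∈ Ioo 0 T) (κ x : ℝ) {y : ℝ} (hy : 0 < y) :
    boundaryIntegral κ (fun l => E κ l x y t * G u₀ g₀ g₁ κ l t)
      = boundaryIntegral κ (fun l => E κ l x y t * boundaryTerm u κ l t) := by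
  have t_mem : t ∈ Icc 0 T := Ioo_subset_Icc_self ht
  obtain ⟨K, boundaryTerm_le⟩ := hu.exists_norm_boundaryTerm_le (by linarith) t_mem x y
  obtain ⟨K', remainder_le⟩ := hu.exists_norm_E_mul_remainder_le hm t_mem x y
  have boundaryTerm_differentiable : Differentiable ℂ fun l => E κ l x y t * boundaryTerm u κ l t :=
    (differentiable_E κ x y t).mul (hu.differentiable_boundaryTerm (by linarith) κ t_mem)
  refine boundaryIntegral_eq_of_eq_sub (K := K')
    (R := fun l => E κ l x y t * (Complex.exp (symbol κ l * t) * remainder u κ l t)) hy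
    (fun σ hσ τ hτ => ?_) ?_ (fun l hre him => remainder_le κ l him.le hre) (fun l hre him => ?_)
  · exact arcIntegrable_of_norm_le_weight (abs_eq_one_of_mem hσ) (abs_eq_one_of_mem hτ) hy
      (boundaryTerm_differentiable.continuous.comp (continuous_arc κ σ τ)).continuousOn fun r _ =>
        boundaryTerm_le κ _ (symbol_arc_re κ (abs_eq_one_of_mem hσ) (abs_eq_one_of_mem hτ) r).ge
  · exact (differentiable_E κ x y t).differentiableOn.mul
      (DifferentiableOn.mul (Differentiable.differentiableOn (by unfold symbol; fun_prop))
        (hu.differentiableOn_remainder hm t_mem κ))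
  · rw [boundaryTerm_eq_G_add_remainder hu (by linarith) hs ht κ him.le hre]
    ring

end Elimination

/-! ### The integrand on the real line -/

section RealLine

theorem symbol_ofReal_re (κ l : ℝ) : (symbol κ l).re = (κ ^ 2 + l ^ 2) ^ 2 := by
  unfold symbol
  norm_cast

theorem norm_E_ofReal_le {t : ℝ} (ht : 0 ≤ t) (κ l x y : ℝ) :
    ‖E κ l x y t‖ ≤ Real.exp t * (Real.exp (-(2 * t) * κ ^ 2) * Real.exp (-(2 * t) * l ^ 2)) := by
  rw [norm_E, symbol_ofReal_re, Complex.ofReal_im, mul_zero, neg_zero, Real.exp_zero, mul_one,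
    ← Real.exp_add, ← Real.exp_add, Real.exp_le_exp]
  nlinarith [mul_nonneg ht (sq_nonneg (κ ^ 2 + l ^ 2 - 1))]

theorem IsDecaying.continuous_halfFourier_ofReal {C m : ℝ} {w : ℝ → ℝ → ℂ}
    (hw : IsDecaying C m w) (hm : 2 < m) :
    Continuous (fun p : ℝ × ℝ => halfFourier w p.1 (p.2 : ℂ)) := by
  have ofReal_im_le (l : ℝ) : (l : ℂ).im ≤ 0 := (Complex.ofReal_im l).le
  simp_rw [fun p : ℝ × ℝ => hw.halfFourier_eq_setIntegral hm p.1 (ofReal_im_le p.2)]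
  refine continuous_of_dominated
    (fun p => (hw.integrableOn_halfPlane hm p.1 (ofReal_im_le p.2)).aestronglyMeasurable)
    (fun p => ?_) ((integrable_one_add_abs_add_abs_rpow_neg hm).const_mul C).integrableOn
    (Eventually.of_forall fun q => by fun_prop)
  filter_upwards [ae_mem_halfPlane] with q hq
  exact hw.norm_exp_mul_le p.1 q.1 hq.le (ofReal_im_le p.2)

theorem IsDecaying.continuous_E_mul_halfFourier {C m : ℝ} {w : ℝ → ℝ → ℂ}
    (hw : IsDecaying C m w) (hm : 2 < m) (x y t : ℝ) :
    Continuous (fun p : ℝ × ℝ => E p.1 p.2 x y t * halfFourier w p.1 p.2) := by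
  have := hw.continuous_halfFourier_ofReal hm
  unfold E
  fun_prop

theorem IsDecaying.norm_E_mul_halfFourier_le {C m t : ℝ} {w : ℝ → ℝ → ℂ}
    (hw : IsDecaying C m w) (hm : 2 < m) (ht : 0 ≤ t) (κ l x y : ℝ) :
    ‖E κ l x y t * halfFourier w κ l‖
      ≤ Real.exp t * (Real.exp (-(2 * t) * κ ^ 2) * Real.exp (-(2 * t) * l ^ 2))
        * (C * ∫ q : ℝ × ℝ, (1 + |q.1| + |q.2|) ^ (-m)) := by
  rw [norm_mul]
  exact mul_le_mul (norm_E_ofReal_le ht κ l x y)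
    (hw.norm_halfFourier_le hm κ (by simp)) (norm_nonneg _) (by positivity)

theorem IsDecaying.integrable_E_mul_halfFourier {C m t : ℝ} {w : ℝ → ℝ → ℂ}
    (hw : IsDecaying C m w) (hm : 2 < m) (ht : 0 < t) (x y : ℝ) :
    Integrable (fun p : ℝ × ℝ => E p.1 p.2 x y t * halfFourier w p.1 p.2) := by
  have gaussian_integrable := integrable_exp_neg_mul_sq (b := 2 * t) (by positivity)
  exact (((gaussian_integrable.mul_prod gaussian_integrable).const_mul _).mul_const _).mono'
    (hw.continuous_E_mul_halfFourier hm x y t).aestronglyMeasurable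
    (Eventually.of_forall fun p => hw.norm_E_mul_halfFourier_le hm ht.le p.1 p.2 x y)

theorem IsDecaying.integrable_E_mul_halfFourier_right {C m t : ℝ} {w : ℝ → ℝ → ℂ}
    (hw : IsDecaying C m w) (hm : 2 < m) (ht : 0 < t) (κ x y : ℝ) :
    Integrable (fun l : ℝ => E κ l x y t * halfFourier w κ l) := by
  have gaussian_integrable := integrable_exp_neg_mul_sq (b := 2 * t) (by positivity)
  exact (((gaussian_integrable.const_mul _).const_mul _).mul_const _).mono'
    ((hw.continuous_E_mul_halfFourier hm x y t).comp (.prodMk_right κ)).aestronglyMeasurable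
    (Eventually.of_forall fun l => hw.norm_E_mul_halfFourier_le hm ht.le κ l x y)

theorem SmoothDecaying.E_mul_halfFourier_add_boundaryTerm {T m : ℝ} {u : ℝ → ℝ → ℝ → ℂ}
    {u₀ g₀ g₁ : ℝ → ℝ → ℂ} (hu : SmoothDecaying T m u) (hm : 2 < m)
    (hs : SolvesIBVP T u u₀ g₀ g₁) {t : ℝ} (ht : t ∈ Ioo 0 T) (κ x y : ℝ) {l : ℂ}
    (hl : l.im ≤ 0) :
    E κ l x y t * halfFourier (fun x y => u x y 0) κ l + E κ l x y t * boundaryTerm u κ l t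
      = Complex.exp (Complex.I * κ * x) * (Complex.exp (Complex.I * l * y)
        * halfFourier (fun x y => u x y t) κ l) := by
  rw [← mul_add, ← hu.global_relation hm hs ht κ hl, E, ← mul_assoc, ← mul_assoc,
    ← Complex.exp_add, ← Complex.exp_add]
  congr 2
  ring

end RealLine

/-! ### The representation at a fixed tangential frequency -/

section FixedFrequency

namespace IsDecaying

variable {C m : ℝ} {w : ℝ → ℝ → ℂ}

theorem continuousOn_fourierX (hw : IsDecaying C m w) (hm : 1 < m) (κ : ℝ) :
    ContinuousOn (fourierX w κ) (Ici 0) := by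
  refine continuousOn_of_dominated (bound := fun x => C * (1 + |x|) ^ (-m))
    (fun y hy => (hw.integrable_fst hm κ hy).aestronglyMeasurable)
    (fun y hy => Eventually.of_forall fun x => ?_)
    ((integrable_one_add_abs_rpow_neg hm).const_mul C)
    (Eventually.of_forall fun x => continuousOn_const.mul (hw.continuousOn_snd x))
  rw [norm_mul, norm_exp_neg_I_mul, one_mul]
  exact hw.norm_le_fst (by linarith) x hy

theorem integrableOn_fourierX (hw : IsDecaying C m w) (hm : 2 < m) (κ : ℝ) :
    IntegrableOn (fourierX w κ) (Ioi 0) := by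
  refine (hw.integrable_prod hm κ (l := 0) (by simp)).integral_prod_right.congr
    (Eventually.of_forall fun y => ?_)
  simp only [mul_zero, sub_zero, fourierX]

theorem lineFourier_indicator_fourierX (hw : IsDecaying C m w) (hm : 2 < m) (κ l : ℝ) :
    lineFourier ((Ioi 0).indicator (fourierX w κ)) l = halfFourier w κ l := by
  rw [hw.halfFourier_eq_integral_fourierX hm κ (by simp), ← integral_indicator measurableSet_Ioi,
    lineFourier]
  simp only [indicator_mul_right]

theorem tendsto_integral_gaussianMul_halfFourier (hw : IsDecaying C m w) (hm : 2 < m) (κ : ℝ)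
    {y : ℝ} (hy : 0 < y) :
    Tendsto (fun c : ℝ => ∫ l : ℝ, gaussianMul c⁻¹
        (fun l => Complex.exp (Complex.I * l * y) * halfFourier w κ l) l) atTop
      (𝓝 (2 * Real.pi * fourierX w κ y)) := by
  have integrable_indicator : Integrable ((Ioi 0).indicator (fourierX w κ)) :=
    (integrable_indicator_iff measurableSet_Ioi).2 (hw.integrableOn_fourierX hm κ)
  have continuousAt_indicator : ContinuousAt ((Ioi 0).indicator (fourierX w κ)) y :=
    ((hw.continuousOn_fourierX (by linarith) κ).continuousAt (Ici_mem_nhds hy)).congr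
      (eqOn_indicator.symm.eventuallyEq_of_mem (Ioi_mem_nhds hy))
  have inversion :=
    tendsto_integral_gaussian_mul_lineFourier integrable_indicator continuousAt_indicator
  rw [indicator_of_mem (mem_Ioi.2 hy)] at inversion
  simpa only [gaussianMul, hw.lineFourier_indicator_fourierX hm] using inversion

end IsDecaying

variable {F : ℂ → ℂ}

theorem norm_cexp_neg_mul_sq_ofReal_le_one {ε : ℝ} (hε : 0 ≤ ε) (r : ℝ) :
    ‖Complex.exp (-(ε : ℂ) * (r : ℂ) ^ 2)‖ ≤ 1 := by
  rw [norm_exp_neg_mul_sq, Complex.ofReal_re, Complex.ofReal_im, Real.exp_le_one_iff]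
  simpa using by positivity

theorem integrable_gaussianMul_of_integrable {ε : ℝ} (hε : 0 ≤ ε)
    (hF : Integrable (fun r : ℝ => F r)) : Integrable (fun r : ℝ => gaussianMul ε F r) :=
  hF.bdd_mul (Continuous.aestronglyMeasurable (by fun_prop))
    (Eventually.of_forall fun r => norm_cexp_neg_mul_sq_ofReal_le_one hε r)

theorem tendsto_integral_gaussianMul_of_integrable (hF : Integrable (fun r : ℝ => F r)) :
    Tendsto (fun c : ℝ => ∫ r : ℝ, gaussianMul c⁻¹ F r) atTop (𝓝 (∫ r : ℝ, F r)) := by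
  refine (Real.tendsto_integral_cexp_sq_smul hF).congr fun c => ?_
  congr 1 with r
  rw [smul_eq_mul, gaussianMul, ← Complex.ofReal_pow, Real.norm_eq_abs, sq_abs]
  push_cast
  rfl

theorem representation_fixed_frequency {T m t : ℝ} {u : ℝ → ℝ → ℝ → ℂ} {u₀ g₀ g₁ : ℝ → ℝ → ℂ}
    (hu : SmoothDecaying T m u) (hm : 3 < m) (hs : SolvesIBVP T u u₀ g₀ g₁) (ht : t ∈ Ioo 0 T)
    (κ x : ℝ) {y : ℝ} (hy : 0 < y) :
    2 * Real.pi * (Complex.exp (Complex.I * κ * x) * fourierX (fun x y => u x y t) κ y)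
      = (∫ l : ℝ, E κ l x y t * halfFourier (fun x y => u x y 0) κ l)
        + boundaryIntegral κ (fun l => E κ l x y t * G u₀ g₀ g₁ κ l t) := by
  have t_mem : t ∈ Icc 0 T := Ioo_subset_Icc_self ht
  have two_lt_m : 2 < m := by linarith
  obtain ⟨C, isDecaying⟩ := hu.exists_isDecaying_apply
  obtain ⟨K, boundaryTerm_le⟩ := hu.exists_norm_boundaryTerm_le (by linarith) t_mem x y
  have initial_integrable := (isDecaying 0 ⟨le_rfl, t_mem.1.trans t_mem.2⟩)
    |>.integrable_E_mul_halfFourier_right two_lt_m ht.1 κ x y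
  have boundaryTerm_differentiable : Differentiable ℂ fun l => E κ l x y t * boundaryTerm u κ l t :=
    (differentiable_E κ x y t).mul (hu.differentiable_boundaryTerm (by linarith) κ t_mem)
  have solution_limit := ((isDecaying t t_mem).tendsto_integral_gaussianMul_halfFourier two_lt_m κ
    hy).const_mul (Complex.exp (Complex.I * κ * x))
  have initial_limit := tendsto_integral_gaussianMul_of_integrable
    (F := fun l => E κ l x y t * halfFourier (fun x y => u x y 0) κ l) initial_integrable
  have boundary_limit := tendsto_integral_gaussianMul hy boundaryTerm_differentiable
    fun l _ hl => boundaryTerm_le κ l hl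
  rw [boundaryIntegral_E_mul_G hu hm hs ht κ x hy, mul_left_comm]
  refine tendsto_nhds_unique solution_limit ((initial_limit.add boundary_limit).congr' ?_)
  filter_upwards [eventually_gt_atTop 0] with c hc
  rw [← integral_add (integrable_gaussianMul_of_integrable (by positivity) initial_integrable)
    (integrable_gaussianMul_ofReal hy.le (by positivity) boundaryTerm_differentiable.continuous
      fun l hl => boundaryTerm_le κ l (symbol_re_nonneg_of_mem_belowArcs hl)),
    ← integral_const_mul]
  congr 1 with l
  simp only [gaussianMul, ← mul_add,
    hu.E_mul_halfFourier_add_boundaryTerm two_lt_m hs ht κ x y (Complex.ofReal_im l).le]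
  ring

end FixedFrequency

/-! ### Measurability of the transforms -/

section Measurability

theorem stronglyMeasurable_halfFourier {w : ℝ → ℝ → ℂ}
    (hw : Measurable (fun q : ℝ × ℝ => w q.1 q.2)) :
    StronglyMeasurable (fun p : ℝ × ℂ => halfFourier w p.1 p.2) := by
  refine StronglyMeasurable.integral_prod_right (f := fun (p : ℝ × ℂ) (x : ℝ) =>
    ∫ y in Ioi (0 : ℝ), Complex.exp (-Complex.I * x * p.1 - Complex.I * y * p.2) * w x y) ?_
  refine StronglyMeasurable.integral_prod_right (f := fun (p : (ℝ × ℂ) × ℝ) (y : ℝ) =>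
    Complex.exp (-Complex.I * p.2 * p.1.1 - Complex.I * y * p.1.2) * w p.2 y) ?_
  refine Measurable.stronglyMeasurable ?_
  unfold Function.uncurry
  fun_prop

theorem stronglyMeasurable_fourierX {g : ℝ → ℝ → ℂ}
    (hg : Measurable (fun q : ℝ × ℝ => g q.1 q.2)) :
    StronglyMeasurable (fun p : ℝ × ℝ => fourierX g p.1 p.2) := by
  refine StronglyMeasurable.integral_prod_right (f := fun (p : ℝ × ℝ) (x : ℝ) =>
    Complex.exp (-Complex.I * x * p.1) * g x p.2) ?_
  refine Measurable.stronglyMeasurable ?_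
  unfold Function.uncurry
  fun_prop

theorem stronglyMeasurable_tTransform {g : ℝ → ℝ → ℂ}
    (hg : Measurable (fun q : ℝ × ℝ => g q.1 q.2)) {t : ℝ} (ht : 0 ≤ t) :
    StronglyMeasurable (fun p : ℝ × ℂ => tTransform g p.1 p.2 t) := by
  simp only [tTransform, intervalIntegral.integral_of_le ht]
  refine StronglyMeasurable.integral_prod_right (f := fun (p : ℝ × ℂ) (τ : ℝ) =>
    Complex.exp (p.2 * τ) * fourierX g p.1 τ) ?_
  have fourierX_measurable := (stronglyMeasurable_fourierX hg).measurable
  refine Measurable.stronglyMeasurable ?_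
  unfold Function.uncurry
  fun_prop

theorem measurable_indicator_of_continuousOn {α β : Type*} [TopologicalSpace α]
    [MeasurableSpace α] [OpensMeasurableSpace α] [TopologicalSpace β] [MeasurableSpace β]
    [BorelSpace β] [Zero β] {f : α → β} {s : Set α} (hf : ContinuousOn f s)
    (hs : MeasurableSet s) : Measurable (s.indicator f) := by
  classical
  rw [← piecewise_eq_indicator]
  exact hf.measurable_piecewise continuousOn_const hs

theorem IsDecaying.measurable_halfFourier {C m : ℝ} {w : ℝ → ℝ → ℂ} (hw : IsDecaying C m w) :
    Measurable (fun p : ℝ × ℂ => halfFourier w p.1 p.2) := by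
  have halfFourier_indicator (p : ℝ × ℂ) : halfFourier w p.1 p.2 = halfFourier
      (fun x y => indicator (univ ×ˢ Ici 0) (fun q : ℝ × ℝ => w q.1 q.2) (x, y)) p.1 p.2 := by
    unfold halfFourier
    congr 1 with x
    refine setIntegral_congr_fun measurableSet_Ioi fun y hy => ?_
    have mem : (x, y) ∈ (univ : Set ℝ) ×ˢ Ici 0 := ⟨mem_univ x, Ioi_subset_Ici_self hy⟩
    simp only [indicator_of_mem mem]
  simp only [halfFourier_indicator]
  exact (stronglyMeasurable_halfFourier (measurable_indicator_of_continuousOn hw.continuousOn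
    (MeasurableSet.univ.prod measurableSet_Ici))).measurable

namespace SmoothDecaying

variable {T m : ℝ} {u : ℝ → ℝ → ℝ → ℂ}

theorem measurable_tTransform_trace (hu : SmoothDecaying T m u) {j : ℕ} (hj : j ≤ 4) {t : ℝ}
    (ht : t ∈ Icc 0 T) : Measurable (fun p : ℝ × ℂ => tTransform (trace u j) p.1 p.2 t) := by
  have tTransform_indicator (p : ℝ × ℂ) : tTransform (trace u j) p.1 p.2 t = tTransform
      (fun x τ => indicator (univ ×ˢ Icc 0 T) (fun q : ℝ × ℝ => trace u j q.1 q.2) (x, τ))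
      p.1 p.2 t :=
    tTransform_congr ht.1 (fun x τ hτ => (indicator_of_mem
      (show (x, τ) ∈ univ ×ˢ Icc 0 T from ⟨mem_univ x, hτ.1.le, hτ.2.trans ht.2⟩)
      fun q : ℝ × ℝ => trace u j q.1 q.2).symm) _ _
  simp only [tTransform_indicator]
  exact (stronglyMeasurable_tTransform (measurable_indicator_of_continuousOn
    (hu.continuousOn_trace hj) (MeasurableSet.univ.prod measurableSet_Icc)) ht.1).measurable

theorem measurable_G (hu : SmoothDecaying T m u) {t : ℝ} (ht : t ∈ Icc 0 T) :
    Measurable (fun p : ℝ × ℂ => G (fun x y => u x y 0) (trace u 0) (trace u 1) p.1 p.2 t) := by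
  have nu_measurable := measurable_nu
  obtain ⟨C, isDecaying⟩ := hu.exists_isDecaying_apply
  have halfFourier_measurable := (isDecaying 0 ⟨le_rfl, ht.1.trans ht.2⟩).measurable_halfFourier
  have dirichlet_measurable := hu.measurable_tTransform_trace (j := 0) (by norm_num) ht
  have neumann_measurable := hu.measurable_tTransform_trace (j := 1) (by norm_num) ht
  unfold G
  fun_prop

end SmoothDecaying

end Measurability

/-! ### Absolute convergence and the representation formula -/

section Representation

variable {T m : ℝ} {u : ℝ → ℝ → ℝ → ℂ} {u₀ g₀ g₁ : ℝ → ℝ → ℂ}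

theorem exists_norm_E_mul_G_le (hu : SmoothDecaying T m u) (hm : 3 < m)
    (hs : SolvesIBVP T u u₀ g₀ g₁) {t : ℝ} (ht : t ∈ Ioo 0 T) (x y : ℝ) :
    ∃ K : ℝ, ∀ (κ : ℝ) (l : ℂ), 0 ≤ l.im → l.re ≠ 0 → 0 ≤ (symbol κ l).re →
      ‖E κ l x y t * G u₀ g₀ g₁ κ l t‖ ≤ K * weight y κ l := by
  have t_mem : t ∈ Icc 0 T := Ioo_subset_Icc_self ht
  obtain ⟨K, boundaryTerm_le⟩ := hu.exists_norm_boundaryTerm_le (by linarith) t_mem x y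
  obtain ⟨K', remainder_le⟩ := hu.exists_norm_E_mul_remainder_le hm t_mem x y
  refine ⟨K + K', fun κ l him hre hsymbol => ?_⟩
  rw [eq_sub_of_add_eq (boundaryTerm_eq_G_add_remainder hu (by linarith) hs ht κ him hre).symm,
    mul_sub, add_mul]
  exact (norm_sub_le _ _).trans
    (add_le_add (boundaryTerm_le κ l hsymbol) (remainder_le κ l him hre))

theorem aestronglyMeasurable_E_mul_G_mul_deriv_arc (hu : SmoothDecaying T m u)
    (hs : SolvesIBVP T u u₀ g₀ g₁) {t : ℝ} (ht : t ∈ Ioo 0 T) (x y σ τ : ℝ) :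
    AEStronglyMeasurable (fun p : ℝ × ℝ => E p.1 (arc p.1 σ τ p.2) x y t
        * G u₀ g₀ g₁ p.1 (arc p.1 σ τ p.2) t * deriv (arc p.1 σ τ) p.2)
      (volume.restrict (univ ×ˢ Ioi 0)) := by
  have arc_measurable := measurable_arc σ τ
  have G_measurable := (hu.measurable_G (Ioo_subset_Icc_self ht)).comp
    (f := fun p : ℝ × ℝ => (p.1, arc p.1 σ τ p.2)) (by fun_prop)
  have E_measurable : Measurable fun p : ℝ × ℝ => E p.1 (arc p.1 σ τ p.2) x y t := by
    unfold E
    fun_prop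
  simp only [hs.G_eq ht]
  exact (E_measurable.mul G_measurable).aestronglyMeasurable.mul
    (aestronglyMeasurable_deriv_arc σ τ)

theorem integrableOn_exp_neg_mul_abs_add {c : ℝ} (hc : 0 < c) :
    IntegrableOn (fun p : ℝ × ℝ => Real.exp (-(c * (|p.1| + p.2)))) (univ ×ˢ Ioi 0) := by
  rw [IntegrableOn, volume_restrict_halfPlane]
  refine ((integrable_exp_neg_mul_abs hc).mul_prod (exp_neg_integrableOn_Ioi 0 hc)).congr
    (Eventually.of_forall fun p => ?_)
  simp only [← Real.exp_add]
  congr 1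
  ring

theorem boundaryIntegrable_of_norm_le_weight {F : ℝ → ℂ → ℂ} {K y : ℝ} (hy : 0 < y)
    (hF : ∀ σ τ : ℝ, AEStronglyMeasurable
      (fun p : ℝ × ℝ => F p.1 (arc p.1 σ τ p.2) * deriv (arc p.1 σ τ) p.2)
      (volume.restrict (univ ×ˢ Ioi 0)))
    (hb : ∀ (κ : ℝ) (l : ℂ), 0 ≤ l.im → l.re ≠ 0 → 0 ≤ (symbol κ l).re →
      ‖F κ l‖ ≤ K * weight y κ l) :
    BoundaryIntegrable F := by
  intro σ hσ τ hτ
  have abs_σ := abs_eq_one_of_mem hσ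
  have abs_τ := abs_eq_one_of_mem hτ
  obtain ⟨C, C_nonneg, weight_le⟩ := exists_weight_le_exp hy
  refine ((integrableOn_exp_neg_mul_abs_add (c := y / 20) (by positivity)).const_mul
    (K * C * 4)).mono' (hF σ τ) ?_
  filter_upwards [ae_mem_halfPlane] with ⟨κ, a⟩ (ha : 0 < a)
  have arc_mem := arc_mem_of_pos κ abs_σ abs_τ ha
  have norm_le := hb κ _ arc_mem.2.le arc_mem.1 (symbol_arc_re κ abs_σ abs_τ a).ge
  have K_nonneg : 0 ≤ K := nonneg_of_norm_le_mul_weight norm_le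
  calc ‖F κ (arc κ σ τ a) * deriv (arc κ σ τ) a‖
      ≤ K * (C * Real.exp (-(y / 20 * (|κ| + a)))) * 4 := by
        rw [norm_mul]
        refine mul_le_mul (norm_le.trans ?_) (norm_deriv_arc_le κ abs_σ.le abs_τ.le ha)
          (norm_nonneg _) (by positivity)
        exact mul_le_mul_of_nonneg_left
          (weight_le κ a ha.le _ (arc_mem_arcStrip κ abs_σ abs_τ.le ha.le)) K_nonneg
    _ = K * C * 4 * Real.exp (-(y / 20 * (|κ| + a))) := by ring

theorem boundaryIntegrable_E_mul_G (hu : SmoothDecaying T m u) (hm : 3 < m)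
    (hs : SolvesIBVP T u u₀ g₀ g₁) {t : ℝ} (ht : t ∈ Ioo 0 T) (x : ℝ) {y : ℝ} (hy : 0 < y) :
    BoundaryIntegrable (fun κ l => E κ l x y t * G u₀ g₀ g₁ κ l t) := by
  obtain ⟨K, norm_le⟩ := exists_norm_E_mul_G_le hu hm hs ht x y
  exact boundaryIntegrable_of_norm_le_weight hy
    (aestronglyMeasurable_E_mul_G_mul_deriv_arc hu hs ht x y) norm_le

theorem BoundaryIntegrable.integrable_boundaryIntegral {F : ℝ → ℂ → ℂ}
    (hF : BoundaryIntegrable F) : Integrable (fun κ => boundaryIntegral κ (F κ)) := by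
  have arcIntegral_integrable : ∀ σ ∈ ({1, -1} : Set ℝ), ∀ τ ∈ ({1, -1} : Set ℝ),
      Integrable (fun κ => arcIntegral κ σ τ (F κ)) := fun σ hσ τ hτ => by
    have arc_integrable := hF σ hσ τ hτ
    rw [IntegrableOn, volume_restrict_halfPlane] at arc_integrable
    exact arc_integrable.integral_prod_left
  exact ((arcIntegral_integrable 1 (by simp) 1 (by simp)).neg.add
      (arcIntegral_integrable 1 (by simp) (-1) (by simp))).add
    ((arcIntegral_integrable (-1) (by simp) (-1) (by simp)).neg.add
      (arcIntegral_integrable (-1) (by simp) 1 (by simp)))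

theorem integrable_of_integrable_exp_I_mul {f : ℝ → ℂ} {x : ℝ}
    (hf : Integrable (fun κ : ℝ => Complex.exp (Complex.I * κ * x) * f κ)) : Integrable f := by
  refine (hf.bdd_mul (f := fun κ : ℝ => Complex.exp (-Complex.I * κ * x)) (c := 1)
    (Continuous.aestronglyMeasurable (by fun_prop))
    (Eventually.of_forall fun κ => (norm_exp_neg_I_mul x κ).le)).congr
    (Eventually.of_forall fun κ => ?_)
  simp only [← mul_assoc, ← Complex.exp_add, neg_mul, neg_add_cancel, Complex.exp_zero, one_mul]

theorem SmoothDecaying.integrable_E_mul_halfFourier_zero (hu : SmoothDecaying T m u) (hm : 2 < m)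
    {t : ℝ} (ht : t ∈ Ioo 0 T) (x y : ℝ) :
    Integrable (fun p : ℝ × ℝ => E p.1 p.2 x y t * halfFourier (fun x y => u x y 0) p.1 p.2) := by
  obtain ⟨C, isDecaying⟩ := hu.exists_isDecaying_apply
  exact (isDecaying 0 ⟨le_rfl, (ht.1.trans ht.2).le⟩).integrable_E_mul_halfFourier hm ht.1 x y

theorem representation_formula (hu : SmoothDecaying T m u) (hm : 3 < m)
    (hs : SolvesIBVP T u u₀ g₀ g₁) {t : ℝ} (ht : t ∈ Ioo 0 T) (x : ℝ) {y : ℝ} (hy : 0 < y) :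
    u x y t = 1 / (2 * (Real.pi : ℂ)) ^ 2 *
        (∫ κ : ℝ, ∫ l : ℝ, E κ l x y t * halfFourier (fun x y => u x y 0) κ l) +
      1 / (2 * (Real.pi : ℂ)) ^ 2 *
        (∫ κ : ℝ, boundaryIntegral κ (fun l => E κ l x y t * G u₀ g₀ g₁ κ l t)) := by
  obtain ⟨C, isDecaying⟩ := hu.exists_isDecaying_apply
  have decaying := isDecaying t (Ioo_subset_Icc_self ht)
  have pi_ne_zero : (Real.pi : ℂ) ≠ 0 := Complex.ofReal_ne_zero.2 Real.pi_ne_zero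
  have initial_integrable :=
    (hu.integrable_E_mul_halfFourier_zero (by linarith) ht x y).integral_prod_left
  have boundary_integrable :=
    (boundaryIntegrable_E_mul_G hu hm hs ht x hy).integrable_boundaryIntegral
  have fourierX_integrable : Integrable (fourierX (fun x y => u x y t) · y) := by
    refine integrable_of_integrable_exp_I_mul (x := x)
      ((integrable_const_mul_iff (c := (2 * Real.pi : ℂ)) (by simp [pi_ne_zero]) _).1 ?_)
    simp only [representation_fixed_frequency hu hm hs ht _ x hy]
    exact initial_integrable.add boundary_integrable
  have solution_integrable : Integrable (fun s => u s y t) := by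
    simpa using decaying.integrable_fst (by linarith) 0 hy.le
  have inversion : 2 * Real.pi * u x y t
      = ∫ κ : ℝ, Complex.exp (Complex.I * κ * x) * fourierX (fun x y => u x y t) κ y :=
    two_pi_mul_eq_integral_lineFourier solution_integrable (decaying.continuous_fst hy.le)
      fourierX_integrable x
  rw [← mul_add, ← integral_add initial_integrable boundary_integrable]
  simp only [← representation_fixed_frequency hu hm hs ht _ x hy]
  rw [integral_const_mul, ← inversion]
  field_simp

end Representation

end HalfSpaceHeat

end

theorem mainTheorem4 :
    -- analyticity of the invariance map
    (∀ κ : ℝ, AnalyticOnNhd ℂ (nu κ) (cut κ)ᶜ) ∧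
    (∀ κ : ℝ, κ ≠ 0 →
      (∃ δ > 0, Disjoint (Metric.thickening δ (closure (Dplus κ))) (cut κ)) ∧
      AnalyticOnNhd ℂ (nu κ) (closure (Dplus κ))) ∧
    AnalyticOnNhd ℂ (nu 0) (closure (Dplus 0) \ {0}) ∧
    -- the representation formula
    ∀ (T m : ℝ) (_ : 3 < m) (u : ℝ → ℝ → ℝ → ℂ) (u₀ g₀ g₁ : ℝ → ℝ → ℂ),
      SmoothDecaying T m u → SolvesIBVP T u u₀ g₀ g₁ →
      ∀ (x : ℝ), ∀ y ∈ Set.Ioi (0 : ℝ), ∀ t ∈ Set.Ioo 0 T,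
        MeasureTheory.Integrable
          (fun p : ℝ × ℝ => E p.1 p.2 x y t * halfFourier u₀ p.1 p.2) ∧
        BoundaryIntegrable (fun κ l => E κ l x y t * G u₀ g₀ g₁ κ l t) ∧
        u x y t =
          1 / (2 * (Real.pi : ℂ)) ^ 2 *
            (∫ κ : ℝ, ∫ l : ℝ, E κ l x y t * halfFourier u₀ κ l) +
          1 / (2 * (Real.pi : ℂ)) ^ 2 *
            (∫ κ : ℝ, boundaryIntegral κ (fun l => E κ l x y t * G u₀ g₀ g₁ κ l t)) := by
  refine ⟨analyticOnNhd_nu, fun κ hκ => ⟨⟨|κ| / 20, by positivity, disjoint_thickening_cut hκ⟩,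
      (analyticOnNhd_nu κ).mono (closure_Dplus_subset_compl_cut hκ)⟩,
    (analyticOnNhd_nu 0).mono closure_Dplus_zero_diff_subset_compl_cut,
    fun T m hm u u₀ g₀ g₁ hu hs x y hy t ht =>
      ⟨?_, boundaryIntegrable_E_mul_G hu hm hs ht x hy, ?_⟩⟩
  · simp only [hs.halfFourier_initial]
    exact hu.integrable_E_mul_halfFourier_zero (by linarith) ht x y
  · simp only [hs.halfFourier_initial]
    exact representation_formula hu hm hs ht x hy
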